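/- Let $\ell$ be a prime. For $A=\mathbb{Z}$ (discrete) or $A=\mathbb{Z}_\ell$ (the $\ell$-adic integers with the profinite topology), let $A^\bullet$ be the cosimplicial topological abelian group with $A^n=A\cdot e_{0\to1}\oplus\dots\oplus A\cdot e_{n-1\to n}\cong H_1(\Delta^n/(\Delta^n)_0;A)$, where $(\Delta^n)_0$ is the set of vertices, in which an order-preserving map $f:[n]\to[m]$ sends $e_{i\to i+1}$ to $e_{f(i)\to f(i+1)}:=\sum_{f(i)\le j<f(i+1)}e_{j\to j+1}$. For a discrete group $H$ let $B(A,H)=|\operatorname{Hom}(A^\bullet,H)|$ be the geometric realization of the simplicial set whose $n$-simplices are the continuous homomorphisms $A^n\to H$. The completion map $\mathbb{Z}\to\mathbb{Z}_\ell$ induces, by precomposition, a natural map $B(\mathbb{Z}_\ell,H)\to B(\mathbb{Z},H)$. Suppose that $H$ is locally finite, that is, $H=\operatorname{colim}_i H_i$ is a filtered colimit of finite groups $H_i$. Then the natural map $$B(\mathbb{Z}_\ell,H)\longrightarrow B(\mathbb{Z},H)$$ is a mod-$\ell$ equivalence, i.e. it induces an isomorphism $H_n(B(\mathbb{Z}_\ell,H);\mathbb{Z}/\ell)\to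 H_n(B(\mathbb{Z},H);\mathbb{Z}/\ell)$ on singular homology for every $n\ge 0$. -/

import Mathlib

open CategoryTheory CategoryTheory.Limits

universe u

noncomputable section

namespace CommClassifying

/-- The action of an order-preserving map `f : [n] → [m]` on the reduced free abelian cosimplicial
group `A^n = H₁(Δⁿ/(Δⁿ)₀; A)`, written in the ordered basis `e_{0→1}, …, e_{n-1→n}`.
The `i`-th basis vector `e_{i→i+1}` goes to `e_{f(i)→f(i+1)}`, which is the sum of all
`e_{j→j+1}` with `f(i) ≤ j` and `j + 1 ≤ f(i+1)`. -/
def pushforward (A : Type*) [AddCommMonoid A] {n m : ℕ} (f : Fin (n + 1) →o Fin (m + 1)) :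
    (Fin n → A) →+ (Fin m → A) where
  toFun a j := ∑ i : Fin n, if f i.castSucc ≤ j.castSucc ∧ j.succ ≤ f i.succ then a i else 0
  map_zero' := by ext j; simp
  map_add' a b := by
    ext j
    simp only [Pi.add_apply, ← Finset.sum_add_distrib]
    exact Finset.sum_congr rfl fun i _ => by split_ifs <;> simp

theorem pushforward_apply (A : Type*) [AddCommMonoid A] {n m : ℕ}
    (f : Fin (n + 1) →o Fin (m + 1)) (a : Fin n → A) (j : Fin m) :
    pushforward A f a j =
      ∑ i : Fin n, if f i.castSucc ≤ j.castSucc ∧ j.succ ≤ f i.succ then a i else 0 := rfl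

theorem pushforward_id (A : Type*) [AddCommMonoid A] {n : ℕ} (a : Fin n → A) :
    pushforward A (OrderHom.id : Fin (n + 1) →o Fin (n + 1)) a = a := by
  ext j
  rw [pushforward_apply, Finset.sum_eq_single j]
  · simp
  · intro i _ hij
    refine if_neg ?_
    simp only [OrderHom.id_coe, id_eq, Fin.le_def, Fin.val_castSucc, Fin.val_succ]
    intro h
    exact hij (Fin.ext (by omega))
  · simp

/-- For a monotone sequence, `[u s, u t)` is the disjoint union of the `[u j, u (j+1))`. -/
theorem exists_step {m p : ℕ} (g : Fin (m + 1) →o Fin (p + 1)) (k : Fin p) (s t : Fin (m + 1))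
    (hs : g s ≤ k.castSucc) (ht : k.succ ≤ g t) :
    ∃ j : Fin m, (s ≤ j.castSucc ∧ j.succ ≤ t) ∧ (g j.castSucc ≤ k.castSucc ∧ k.succ ≤ g j.succ) := by
  induction t using Fin.induction with
  | zero =>
    have h := g.monotone (Fin.zero_le s)
    simp only [Fin.le_def, Fin.val_castSucc, Fin.val_succ] at h hs ht
    omega
  | succ j ih =>
    by_cases h : k.succ ≤ g j.castSucc
    · obtain ⟨j', ⟨h1, h2⟩, h3⟩ := ih h
      refine ⟨j', ⟨h1, h2.trans ?_⟩, h3⟩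
      exact (Fin.castSucc_lt_succ (i := j)).le
    · refine ⟨j, ⟨?_, le_rfl⟩, ?_, ht⟩
      · by_contra hlt
        have h2 : j.succ ≤ s := by
          simp only [Fin.le_def, Fin.val_castSucc, Fin.val_succ] at hlt ⊢
          omega
        have h3 := g.monotone h2
        simp only [Fin.le_def, Fin.val_castSucc, Fin.val_succ] at h3 hs ht
        omega
      · simp only [Fin.le_def, Fin.val_castSucc, Fin.val_succ] at h ⊢
        omega

theorem step_unique {m p : ℕ} (g : Fin (m + 1) →o Fin (p + 1)) (k : Fin p) (j j' : Fin m)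
    (h : g j.castSucc ≤ k.castSucc ∧ k.succ ≤ g j.succ)
    (h' : g j'.castSucc ≤ k.castSucc ∧ k.succ ≤ g j'.succ) : j = j' := by
  have key : ∀ i i' : Fin m, k.succ ≤ g i.succ → g i'.castSucc ≤ k.castSucc → i' ≤ i := by
    intro i i' h1 h2
    by_contra hlt
    have h3 : i.succ ≤ i'.castSucc := by
      simp only [Fin.le_def, Fin.val_castSucc, Fin.val_succ] at hlt ⊢
      omega
    have h4 := g.monotone h3
    simp only [Fin.le_def, Fin.val_castSucc, Fin.val_succ] at h1 h2 h4
    omega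
  exact le_antisymm (key j' j h'.2 h.1) (key j j' h.2 h'.1)

theorem pushforward_comp (A : Type*) [AddCommMonoid A] {n m p : ℕ}
    (g : Fin (m + 1) →o Fin (p + 1)) (f : Fin (n + 1) →o Fin (m + 1)) (a : Fin n → A) :
    pushforward A (g.comp f) a = pushforward A g (pushforward A f a) := by
  ext k
  simp only [pushforward_apply, OrderHom.comp_coe, Function.comp_apply]
  have h1 : ∀ j : Fin m,
      (if g j.castSucc ≤ k.castSucc ∧ k.succ ≤ g j.succ then
        ∑ i : Fin n, (if f i.castSucc ≤ j.castSucc ∧ j.succ ≤ f i.succ then a i else 0) else 0) =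
      ∑ i : Fin n, if (f i.castSucc ≤ j.castSucc ∧ j.succ ≤ f i.succ) ∧
        (g j.castSucc ≤ k.castSucc ∧ k.succ ≤ g j.succ) then a i else 0 := by
    intro j
    by_cases h : g j.castSucc ≤ k.castSucc ∧ k.succ ≤ g j.succ <;> simp [h]
  rw [Finset.sum_congr rfl fun j _ => h1 j, Finset.sum_comm]
  refine Finset.sum_congr rfl fun i _ => ?_
  by_cases h : g (f i.castSucc) ≤ k.castSucc ∧ k.succ ≤ g (f i.succ)
  · obtain ⟨j, hj1, hj2⟩ := exists_step g k _ _ h.1 h.2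
    rw [if_pos h, Finset.sum_eq_single j, if_pos ⟨hj1, hj2⟩]
    · intro j' _ hne
      exact if_neg fun h' => hne (step_unique g k _ _ h'.2 hj2)
    · simp
  · rw [if_neg h]
    refine (Finset.sum_eq_zero fun j _ => if_neg fun h' => h ?_).symm
    exact ⟨(g.monotone h'.1.1).trans h'.2.1, h'.2.2.trans (g.monotone h'.1.2)⟩

/-- Additive maps act coordinatewise and commute with the cosimplicial structure. -/
theorem pushforward_map {A A' : Type*} [AddCommMonoid A] [AddCommMonoid A'] (φ : A →+ A')
    {n m : ℕ} (f : Fin (n + 1) →o Fin (m + 1)) (a : Fin n → A) :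
    pushforward A' f (fun i => φ (a i)) = fun j => φ (pushforward A f a j) := by
  ext j
  simp only [pushforward_apply, map_sum]
  exact Finset.sum_congr rfl fun i _ => by split_ifs <;> simp

/-- The cosimplicial structure map `pushforward A f`, as a continuous homomorphism of topological
groups (`A^n` has the product topology and is written multiplicatively). -/
def pushforwardHom (A : Type*) [AddCommGroup A] [TopologicalSpace A] [IsTopologicalAddGroup A]
    {n m : ℕ} (f : Fin (n + 1) →o Fin (m + 1)) :
    Multiplicative (Fin n → A) →ₜ* Multiplicative (Fin m → A) where
  toMonoidHom := AddMonoidHom.toMultiplicative (pushforward A f)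
  continuous_toFun := by
    have h : Continuous (pushforward A f) := by
      refine continuous_pi fun j => ?_
      simp only [pushforward_apply]
      refine continuous_finsetSum _ fun i _ => ?_
      split_ifs
      · exact continuous_apply i
      · exact continuous_const
    exact h

/-- The homomorphism `A^n → A'^n` induced coordinatewise by a continuous homomorphism `A → A'`. -/
def coordHom {A A' : Type*} [AddCommGroup A] [TopologicalSpace A] [AddCommGroup A']
    [TopologicalSpace A'] (φ : A →ₜ+ A') (n : ℕ) :
    Multiplicative (Fin n → A) →ₜ* Multiplicative (Fin n → A') where
  toMonoidHom := AddMonoidHom.toMultiplicative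
    { toFun := fun a i => φ (a i)
      map_zero' := by ext i; simp
      map_add' := fun a b => by ext i; simp }
  continuous_toFun := by
    have h : Continuous fun (a : Fin n → A) (i : Fin n) => φ (a i) :=
      continuous_pi fun i => (map_continuous φ).comp (continuous_apply i)
    exact h

/-- The simplicial set `Hom(A^•, G)`: its `n`-simplices are the continuous homomorphisms
`A^n → G`, and its structure maps are precomposition with those of the cosimplicial group `A^•`.
For `A = ℤ` (discrete topology) these are all homomorphisms `ℤ^n → G`. -/
def homSSet (A : Type) [AddCommGroup A] [TopologicalSpace A] [IsTopologicalAddGroup A]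
    (G : Type u) [Group G] [TopologicalSpace G] : SSet.{u} where
  obj Δ := Multiplicative (Fin Δ.unop.len → A) →ₜ* G
  map f := TypeCat.ofHom fun ρ => ρ.comp (pushforwardHom A f.unop.toOrderHom)
  map_id Δ := by
    ext ρ x
    exact congrArg (fun y => ρ (Multiplicative.ofAdd y)) (pushforward_id A x.toAdd)
  map_comp f g := by
    ext ρ x
    exact congrArg (fun y => ρ (Multiplicative.ofAdd y))
      (pushforward_comp A f.unop.toOrderHom g.unop.toOrderHom x.toAdd)

/-- The map `Hom(A'^•, G) → Hom(A^•, G)` given by precomposition with `A → A'`. -/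
def homSSetMap {A A' : Type} [AddCommGroup A] [TopologicalSpace A] [IsTopologicalAddGroup A]
    [AddCommGroup A'] [TopologicalSpace A'] [IsTopologicalAddGroup A'] (φ : A →ₜ+ A')
    (G : Type u) [Group G] [TopologicalSpace G] : homSSet A' G ⟶ homSSet A G where
  app Δ := TypeCat.ofHom fun ρ => ρ.comp (coordHom φ Δ.unop.len)
  naturality Δ Δ' f := by
    ext ρ
    refine ContinuousMonoidHom.ext fun x => ?_
    exact congrArg (fun y => (show _ →ₜ* G from ρ) (Multiplicative.ofAdd y))
      (pushforward_map φ.toAddMonoidHom f.unop.toOrderHom x.toAdd)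

/-- The space `B(A, G) = |Hom(A^•, G)|` for a discrete group `G`. The spaces of homomorphisms
into a discrete group that occur here are discrete (for `A = ℤ_ℓ` the topology is the colimit of
the discrete spaces `Hom((ℤ/ℓ^k)^n, G)`), so that the geometric realization of the simplicial space
is the one of the underlying simplicial set. -/
def B (A : Type) [AddCommGroup A] [TopologicalSpace A] [IsTopologicalAddGroup A]
    (G : Type u) [Group G] [TopologicalSpace G] [DiscreteTopology G] : TopCat.{u} :=
  SSet.toTop.obj (homSSet A G)

/-- The map `B(A', G) → B(A, G)` induced by a continuous homomorphism `A → A'`. -/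
def BMap {A A' : Type} [AddCommGroup A] [TopologicalSpace A] [IsTopologicalAddGroup A]
    [AddCommGroup A'] [TopologicalSpace A'] [IsTopologicalAddGroup A'] (φ : A →ₜ+ A')
    (G : Type u) [Group G] [TopologicalSpace G] [DiscreteTopology G] : B A' G ⟶ B A G :=
  SSet.toTop.map (homSSetMap φ G)

/-- The completion map `ℤ → ℤ_ℓ`. -/
def completionMap (l : ℕ) [Fact l.Prime] : ℤ →ₜ+ ℤ_[l] where
  toAddMonoidHom := Int.castAddHom ℤ_[l]
  continuous_toFun := continuous_of_discreteTopology

/-- A map of spaces is a mod-`l` equivalence if it induces an isomorphism on singular homology with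
coefficients in `ℤ/l` in every degree. -/
def IsModEquivalence (l : ℕ) {X Y : TopCat.{u}} (f : X ⟶ Y) : Prop :=
  ∀ n : ℕ, IsIso (((AlgebraicTopology.singularHomologyFunctor (ModuleCat.{u} (ZMod l)) n).obj
    (ModuleCat.of (ZMod l) (ULift.{u} (ZMod l)))).map f)

/-- A group is locally finite if it is a filtered colimit of finite groups. -/
def IsLocallyFinite (H : Type u) [Group H] : Prop :=
  ∃ (J : Type u) (_ : SmallCategory J) (_ : IsFiltered J) (F : J ⥤ GrpCat.{u})
    (ι : F ⟶ (Functor.const J).obj (GrpCat.of H)),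
    (∀ j, Finite (F.obj j)) ∧ Nonempty (IsColimit (Cocone.mk (GrpCat.of H) ι))

end CommClassifying

end

/-! Only torsion matters. A homomorphism from `ℤⁿ` to a locally finite group has finite commutative
image, so it is the product of an `ℓ`-primary part and a part of order prime to `ℓ`. Taking
`ℓ`-primary parts is an idempotent simplicial endomorphism `P` of `Hom(ℤ^•, H)` (`primaryMap`). Its
image is `Hom(ℤ_ℓ^•, H)`: a homomorphism killed by a power of `ℓ` extends to the completion, and
every continuous homomorphism on `ℤ_ℓⁿ` takes values of `ℓ`-power order in a discrete group. So the
comparison map is the inclusion of a retract (`exists_retraction`), and it remains to see that `P`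
is homologous to the identity mod `ℓ`.

This uses acyclic carriers. A simplex `ρ` lies in `Hom(ℤ^•, K)`, where `K` is its finite commutative
image, and `Hom(ℤ^•, K)` is the bar construction: tuples of points of `K` modulo translation. There
`P` is induced by an idempotent of `K` whose kernel has order prime to `ℓ`. The prism between the
identity and this idempotent is not invariant under translation, but the sum of the prisms over all
cosets representatives shifted by the kernel is, and the order of the kernel can be inverted mod
`ℓ`. Hence cycles of positive degree killed by `P` are boundaries (`exists_bd_eq_of_idempotent`),
and a homotopy on cycles is built degree by degree, each value supported in the image of its simplex
(`exists_carried_homotopy`).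

The passage to realizations needs little. Injectivity on singular homology follows from the
retraction. Surjectivity needs that each singular cycle of `|Y|` is homologous to a simplicial one
(`exists_simplicial_cycle`). By compactness this reduces to finite simplicial sets, where the unit
`Y → Sing |Y|` is shown to be a homology isomorphism by attaching one cell at a time, using
barycentric subdivision, excision and a collar of the boundary of the simplex. -/

noncomputable section

open Simplicial Opposite AlgebraicTopology

namespace CommClassifying

/-! ### Quasi-isomorphisms of complexes of modules in terms of elements. -/

section Concrete

variable {k : Type} [CommRing k]

/-- Homology is the quotient of the kernel by the image. The first clause is injectivity of the
induced map on these quotients, the second surjectivity. -/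
lemma shortComplex_quasiIso_iff {S₁ S₂ : ShortComplex (ModuleCat.{u} k)} (φ : S₁ ⟶ S₂) :
    ShortComplex.QuasiIso φ ↔
      (∀ x : S₁.X₂, S₁.g x = 0 → ∀ y : S₂.X₁, φ.τ₂ x = S₂.f y → ∃ w : S₁.X₁, S₁.f w = x) ∧
      (∀ y : S₂.X₂, S₂.g y = 0 → ∃ x : S₁.X₂, S₁.g x = 0 ∧ ∃ w : S₂.X₁, y = φ.τ₂ x + S₂.f w) := by
  let γ : ShortComplex.LeftHomologyMapData φ S₁.moduleCatLeftHomologyData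
    S₂.moduleCatLeftHomologyData := default
  rw [γ.quasiIso_iff, ConcreteCategory.isIso_iff_bijective]
  obtain ⟨κ, η, hK, hH, hη⟩ : ∃ (κ : LinearMap.ker S₁.g.hom →ₗ[k] LinearMap.ker S₂.g.hom)
      (η : (LinearMap.ker S₁.g.hom ⧸ LinearMap.range S₁.moduleCatToCycles) →ₗ[k]
        (LinearMap.ker S₂.g.hom ⧸ LinearMap.range S₂.moduleCatToCycles)),
      (∀ x, (κ x : S₂.X₂) = φ.τ₂ (x : S₁.X₂)) ∧
      (∀ x, η (Submodule.Quotient.mk x) = Submodule.Quotient.mk (κ x)) ∧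
      (Function.Bijective (ConcreteCategory.hom γ.φH) ↔ Function.Bijective η) :=
    ⟨γ.φK.hom, γ.φH.hom, fun x => congr($(γ.commi).hom x), fun x => congr($(γ.commπ).hom x),
      Iff.rfl⟩
  rw [hη]
  constructor
  · rintro ⟨hi, hs⟩
    constructor
    · intro x hx y hy
      have h0 : η (Submodule.Quotient.mk ⟨x, hx⟩) = η 0 := by
        rw [hH, map_zero]
        refine (Submodule.Quotient.mk_eq_zero _).2 ⟨y, Subtype.ext ?_⟩
        rw [hK]; exact hy.symm
      obtain ⟨w, hw⟩ := (Submodule.Quotient.mk_eq_zero _).1 (hi h0)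
      exact ⟨w, congrArg Subtype.val hw⟩
    · intro y hy
      obtain ⟨q, hq⟩ := hs (Submodule.Quotient.mk ⟨y, hy⟩)
      obtain ⟨⟨x, hx⟩, rfl⟩ := Submodule.Quotient.mk_surjective _ q
      refine ⟨x, hx, ?_⟩
      obtain ⟨w, hw⟩ := (Submodule.Quotient.eq _).1 (hq.symm.trans (hH ⟨x, hx⟩))
      refine ⟨w, ?_⟩
      have h2 : S₂.f w = y - (κ ⟨x, hx⟩ : S₂.X₂) := congrArg Subtype.val hw
      rw [h2, hK]; abel
  · rintro ⟨hi, hs⟩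
    constructor
    · rw [injective_iff_map_eq_zero]
      intro q hq
      obtain ⟨⟨x, hx⟩, rfl⟩ := Submodule.Quotient.mk_surjective _ q
      obtain ⟨w, hw⟩ := (Submodule.Quotient.mk_eq_zero _).1 ((hH ⟨x, hx⟩).symm.trans hq)
      have h2 : S₂.f w = (κ ⟨x, hx⟩ : S₂.X₂) := congrArg Subtype.val hw
      obtain ⟨v, hv⟩ := hi x hx w (by rw [h2, hK])
      exact (Submodule.Quotient.mk_eq_zero _).2 ⟨v, Subtype.ext hv⟩
    · intro q
      obtain ⟨⟨y, hy⟩, rfl⟩ := Submodule.Quotient.mk_surjective _ q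
      obtain ⟨x, hx, w, hw⟩ := hs y hy
      refine ⟨Submodule.Quotient.mk ⟨x, hx⟩, (hH ⟨x, hx⟩).trans ?_⟩
      symm
      rw [Submodule.Quotient.eq]
      refine ⟨w, Subtype.ext ?_⟩
      change S₂.f w = y - (κ ⟨x, hx⟩ : S₂.X₂)
      rw [hK, hw]; abel

/-- Truncated subtraction is harmless in degree zero: the differential `d 0 0` vanishes by shape, so
every `0`-chain counts as a cycle. -/
lemma quasiIso_iff_elementwise {K L : ChainComplex (ModuleCat.{u} k) ℕ} (f : K ⟶ L) :
    QuasiIso f ↔ ∀ n : ℕ,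
      (∀ x : K.X n, K.d n (n - 1) x = 0 → ∀ y : L.X (n + 1), f.f n x = L.d (n + 1) n y →
        ∃ w : K.X (n + 1), K.d (n + 1) n w = x) ∧
      (∀ y : L.X n, L.d n (n - 1) y = 0 → ∃ x : K.X n, K.d n (n - 1) x = 0 ∧
        ∃ w : L.X (n + 1), y = f.f n x + L.d (n + 1) n w) := by
  rw [quasiIso_iff]
  refine forall_congr' fun n => ?_
  rw [quasiIsoAt_iff' f (n + 1) n (n - 1) (by simp) (by cases n <;> simp)]
  exact shortComplex_quasiIso_iff _

end Concrete

/-! ### Simplicial chains and homology isomorphisms. -/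

section Chains

variable (k : Type) [CommRing k]

/-- The free `k`-module functor, for rings in the lowest universe. -/
def freeMod : Type u ⥤ ModuleCat.{u} k where
  obj X := ModuleCat.of k (X →₀ k)
  map f := ModuleCat.ofHom (Finsupp.lmapDomain k k f)
  map_id X := by
    ext : 1
    exact Finsupp.lmapDomain_id k k
  map_comp f g := by
    ext : 1
    exact Finsupp.lmapDomain_comp k k f g

/-- The coefficient module of the singular homology functor. -/
abbrev coeffMod : ModuleCat.{u} k := ModuleCat.of k (ULift.{u} k)

/-- The inclusion of a summand in a free module. -/
def freeInc {X : Type u} (x : X) : coeffMod.{u} k ⟶ (freeMod.{u} k).obj X :=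
  ModuleCat.ofHom (X := ULift.{u} k) (Y := X →₀ k)
    ((Finsupp.lsingle x).comp (ULift.moduleEquiv : ULift.{u} k ≃ₗ[k] k).toLinearMap)

lemma freeInc_map {X Y : Type u} (f : X ⟶ Y) (x : X) :
    freeInc k x ≫ (freeMod k).map f = freeInc k (f x) := by
  ext r
  exact Finsupp.mapDomain_single

variable {k} in
/-- The homomorphism from a free module given by its restrictions to the summands. -/
def freeDesc {X : Type u} {M : ModuleCat.{u} k} (f : X → (coeffMod.{u} k ⟶ M)) :
    (freeMod.{u} k).obj X ⟶ M :=
  ModuleCat.ofHom (X := X →₀ k) (Finsupp.lsum k fun x =>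
    (f x).hom.comp (ULift.moduleEquiv : ULift.{u} k ≃ₗ[k] k).symm.toLinearMap)

lemma freeInc_desc {X : Type u} {M : ModuleCat.{u} k} (f : X → (coeffMod.{u} k ⟶ M)) (x : X) :
    freeInc k x ≫ freeDesc f = f x := by
  ext r
  exact Finsupp.lsum_single k (fun x =>
    (f x).hom.comp (ULift.moduleEquiv : ULift.{u} k ≃ₗ[k] k).symm.toLinearMap) x _

variable {k} in
lemma freeMod_hom_ext {X : Type u} {M : ModuleCat.{u} k} {f g : (freeMod.{u} k).obj X ⟶ M}
    (h : ∀ x, freeInc k x ≫ f = freeInc k x ≫ g) : f = g := by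
  ext : 1
  exact Finsupp.lhom_ext (M := k) fun x r => congr($(h x).hom (ULift.up r))

/-- Free modules as coproducts of copies of the coefficients. -/
def freeModIso : sigmaConst.obj (coeffMod.{u} k) ≅ freeMod.{u} k :=
  NatIso.ofComponents
    (fun X =>
      { hom := Sigma.desc (freeInc k)
        inv := freeDesc (Sigma.ι (fun _ : X => coeffMod.{u} k))
        hom_inv_id := Sigma.hom_ext _ _ fun x => by
          exact (Sigma.ι_desc_assoc _ _ _).trans ((freeInc_desc k _ x).trans (Category.comp_id _).symm)
        inv_hom_id := freeMod_hom_ext fun x => by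
          rw [← Category.assoc, freeInc_desc, Sigma.ι_desc, Category.comp_id] })
    (fun {X Y} f => Sigma.hom_ext _ _ fun x => by
      dsimp only [sigmaConst_obj_map]
      rw [Sigma.ι_desc_assoc, freeInc_map, Sigma.ι_comp_map'_assoc, Category.id_comp, Sigma.ι_desc])

/-- Simplicial chains with coefficients in `k`. -/
def chains : SSet.{u} ⥤ ChainComplex (ModuleCat.{u} k) ℕ :=
  (SimplicialObject.whiskering _ _).obj (freeMod k) ⋙ alternatingFaceMapComplex _

/-- Singular homology is defined through coproducts of copies of the coefficients. This isomorphism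
passes to finitely supported functions, in which all computations take place. -/
def chainsIso : (SSet.chainComplexFunctor (ModuleCat.{u} k)).obj (coeffMod k) ≅ chains k :=
  Functor.isoWhiskerRight ((SimplicialObject.whiskering _ _).mapIso (freeModIso k))
    (alternatingFaceMapComplex _)

/-- The boundary on simplicial chains. -/
def bd (X : SSet.{u}) (n : ℕ) : (X _⦋n + 1⦌ →₀ k) →ₗ[k] (X _⦋n⦌ →₀ k) :=
  ∑ i : Fin (n + 2), (-1 : k) ^ (i : ℕ) • Finsupp.lmapDomain k k (X.δ i)

lemma chains_d (X : SSet.{u}) (n : ℕ) :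
    (((chains k).obj X).d (n + 1) n).hom = bd k X n := by
  have : ((chains k).obj X).d (n + 1) n =
    ∑ i : Fin (n + 2), (-1 : ℤ) ^ (i : ℕ) •
      (((SimplicialObject.whiskering _ _).obj (freeMod k)).obj X).δ i :=
    AlternatingFaceMapComplex.obj_d_eq _ _
  rw [this, bd]
  refine (ModuleCat.hom_sum (M := (freeMod k).obj (X _⦋n + 1⦌)) (N := (freeMod k).obj (X _⦋n⦌))
    _ _).trans (Finset.sum_congr rfl fun i _ => ?_)
  refine (ModuleCat.hom_zsmul (M := (freeMod k).obj (X _⦋n + 1⦌)) (N := (freeMod k).obj (X _⦋n⦌))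
    _ _).trans ?_
  rcases neg_one_pow_eq_or ℤ (i : ℕ) with h | h
  · have h' : (-1 : k) ^ (i : ℕ) = 1 := by exact_mod_cast congrArg (Int.cast : ℤ → k) h
    rw [h, h', one_smul, one_smul]; rfl
  · have h' : (-1 : k) ^ (i : ℕ) = -1 := by exact_mod_cast congrArg (Int.cast : ℤ → k) h
    rw [h, h']
    refine ((neg_smul _ _).trans ?_).trans (neg_smul _ _).symm
    exact congrArg Neg.neg ((one_smul _ _).trans (one_smul k _).symm)

/-- A chain is a cycle. In degree zero this is no condition. -/
def IsCyc {X : SSet.{u}} {n : ℕ} : (X _⦋n⦌ →₀ k) → Prop :=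
  match n with
  | 0 => fun _ => True
  | n + 1 => fun x => bd k X n x = 0

variable {k}

lemma isCyc_iff {X : SSet.{u}} {n : ℕ} (x : X _⦋n⦌ →₀ k) :
    IsCyc k x ↔ ((chains k).obj X).d n (n - 1) x = 0 := by
  cases n with
  | zero =>
    have : ((chains k).obj X).d 0 (0 - 1) = 0 := HomologicalComplex.shape _ _ _ (by simp)
    rw [this]
    exact iff_of_true trivial rfl
  | succ n =>
    have := chains_d k X n
    change bd k X n x = 0 ↔ (((chains k).obj X).d (n + 1) n).hom x = 0
    rw [this]
    exact Iff.rfl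

variable (k) in
/-- A map of simplicial sets which induces an isomorphism on homology with coefficients in `k`. -/
def QI {X Y : SSet.{u}} (f : X ⟶ Y) : Prop := QuasiIso ((chains k).map f)

lemma qi_iff {X Y : SSet.{u}} (f : X ⟶ Y) :
    QI k f ↔ ∀ n : ℕ,
      (∀ x : X _⦋n⦌ →₀ k, IsCyc k x → ∀ y : Y _⦋n + 1⦌ →₀ k,
        Finsupp.mapDomain (f.app (op ⦋n⦌)) x = bd k Y n y →
        ∃ w : X _⦋n + 1⦌ →₀ k, bd k X n w = x) ∧
      (∀ y : Y _⦋n⦌ →₀ k, IsCyc k y → ∃ x : X _⦋n⦌ →₀ k, IsCyc k x ∧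
        ∃ w : Y _⦋n + 1⦌ →₀ k, y = Finsupp.mapDomain (f.app (op ⦋n⦌)) x + bd k Y n w) := by
  rw [QI, quasiIso_iff_elementwise]
  refine forall_congr' fun n => ?_
  simp only [isCyc_iff, ← chains_d]
  rfl

lemma QI.comp {X Y Z : SSet.{u}} {f : X ⟶ Y} {g : Y ⟶ Z} (hf : QI k f) (hg : QI k g) :
    QI k (f ≫ g) := by
  unfold QI at *
  rw [Functor.map_comp]
  infer_instance

lemma QI.of_comp_left {X Y Z : SSet.{u}} {f : X ⟶ Y} {g : Y ⟶ Z} (hf : QI k f)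
    (hfg : QI k (f ≫ g)) : QI k g := by
  unfold QI at *
  rw [Functor.map_comp] at hfg
  exact quasiIso_of_comp_left ((chains k).map f) ((chains k).map g)

lemma QI.of_isIso {X Y : SSet.{u}} (f : X ⟶ Y) [IsIso f] : QI k f := by
  unfold QI
  infer_instance

lemma bd_naturality {X Y : SSet.{u}} (f : X ⟶ Y) (n : ℕ) (x : X _⦋n + 1⦌ →₀ k) :
    bd k Y n (Finsupp.mapDomain (f.app (op ⦋n + 1⦌)) x) =
      Finsupp.mapDomain (f.app (op ⦋n⦌)) (bd k X n x) := by
  have := congr($(((chains k).map f).comm (n + 1) n).hom x)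
  rw [ModuleCat.hom_comp, ModuleCat.hom_comp, chains_d, chains_d] at this
  exact this

lemma bd_bd (X : SSet.{u}) (n : ℕ) (x : X _⦋n + 2⦌ →₀ k) : bd k X n (bd k X (n + 1) x) = 0 := by
  have := congr($(((chains k).obj X).d_comp_d (n + 2) (n + 1) n).hom x)
  rw [ModuleCat.hom_comp, chains_d, chains_d] at this
  exact this

lemma isCyc_bd {X : SSet.{u}} {n : ℕ} (x : X _⦋n + 1⦌ →₀ k) : IsCyc k (bd k X n x) := by
  cases n with
  | zero => trivial
  | succ n => exact bd_bd X n x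

lemma IsCyc.map {X Y : SSet.{u}} (f : X ⟶ Y) {n : ℕ} {x : X _⦋n⦌ →₀ k} (hx : IsCyc k x) :
    IsCyc k (Finsupp.mapDomain (f.app (op ⦋n⦌)) x) := by
  cases n with
  | zero => trivial
  | succ n =>
    change bd k Y n _ = 0
    rw [bd_naturality, show bd k X n x = 0 from hx, Finsupp.mapDomain_zero]

lemma bd_single (X : SSet.{u}) (n : ℕ) (x : X _⦋n + 1⦌) :
    bd k X n (Finsupp.single x 1) =
      ∑ i : Fin (n + 2), (-1 : k) ^ (i : ℕ) • Finsupp.single (X.δ i x) 1 := by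
  simp [bd, LinearMap.sum_apply]

end Chains

end CommClassifying

end

noncomputable section

open Simplicial Opposite AlgebraicTopology

namespace CommClassifying

/-! ### The five lemma for the long exact homology sequence. -/

section Sequences

open HomologicalComplex ComposableArrows Abelian

variable {C : Type*} [Category* C] [Abelian C]
  {S₁ S₂ : ShortComplex (ChainComplex C ℕ)} (φ : S₁ ⟶ S₂)

lemma quasiIso_τ₂ (hS₁ : S₁.ShortExact) (hS₂ : S₂.ShortExact) (h₁ : QuasiIso φ.τ₁)
    (h₃ : QuasiIso φ.τ₃) : QuasiIso φ.τ₂ := by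
  rw [quasiIso_iff]
  intro i
  rw [quasiIsoAt_iff_isIso_homologyMap]
  have hm : Mono (homologyMap φ.τ₂ i) := by
    apply mono_of_epi_of_mono_of_mono ((δ₀Functor ⋙ δ₀Functor).map
      (HomologySequence.mapComposableArrows₅ φ hS₁ hS₂ (i + 1) i rfl))
    · exact (HomologySequence.composableArrows₅_exact hS₁ (i + 1) i rfl).δ₀.δ₀
    · exact (HomologySequence.composableArrows₅_exact hS₂ (i + 1) i rfl).δ₀.δ₀
    · exact inferInstanceAs (Epi (homologyMap φ.τ₃ (i + 1)))
    · exact inferInstanceAs (Mono (homologyMap φ.τ₁ i))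
    · exact inferInstanceAs (Mono (homologyMap φ.τ₃ i))
  have he : Epi (homologyMap φ.τ₂ i) := by
    cases i with
    -- The homology sequence ends in degree zero, so the missing term on the right is replaced by
    -- surjectivity of the last map.
    | zero =>
      have := hS₁.epi_g
      apply epi_of_epi_of_epi_of_epi (HomologySequence.mapComposableArrows₂ φ 0)
      · exact HomologySequence.composableArrows₂_exact hS₂ 0
      · exact epi_homologyMap_of_epi_of_not_rel S₁.g 0 (by simp)
      · exact inferInstanceAs (Epi (homologyMap φ.τ₁ 0))
      · exact inferInstanceAs (Epi (homologyMap φ.τ₃ 0))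
    | succ i =>
      apply epi_of_epi_of_epi_of_mono ((δlastFunctor ⋙ δlastFunctor).map
        (HomologySequence.mapComposableArrows₅ φ hS₁ hS₂ (i + 1) i rfl))
      · exact (HomologySequence.composableArrows₅_exact hS₁ (i + 1) i rfl).δlast.δlast
      · exact (HomologySequence.composableArrows₅_exact hS₂ (i + 1) i rfl).δlast.δlast
      · exact inferInstanceAs (Epi (homologyMap φ.τ₁ (i + 1)))
      · exact inferInstanceAs (Epi (homologyMap φ.τ₃ (i + 1)))
      · exact inferInstanceAs (Mono (homologyMap φ.τ₁ i))
  exact isIso_of_mono_of_epi _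

end Sequences

/-! ### Relative homology of pairs of simplicial sets. -/

section Relative

variable (k : Type) [CommRing k]

/-- The relative chains of a map of simplicial sets. -/
abbrev relChains {A B : SSet.{u}} (i : A ⟶ B) : ChainComplex (ModuleCat.{u} k) ℕ :=
  cokernel ((chains k).map i)

/-- The map on relative chains. -/
abbrev relMap {A B A' B' : SSet.{u}} (i : A ⟶ B) (i' : A' ⟶ B') (a : A ⟶ A') (b : B ⟶ B')
    (w : i ≫ b = a ≫ i') : relChains k i ⟶ relChains k i' :=
  cokernel.map _ _ ((chains k).map a) ((chains k).map b)
    (by rw [← Functor.map_comp, ← Functor.map_comp, w])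

/-- A map of pairs which induces an isomorphism on relative homology. -/
def RelQI {A B A' B' : SSet.{u}} (i : A ⟶ B) (i' : A' ⟶ B') (a : A ⟶ A') (b : B ⟶ B') : Prop :=
  ∃ w : i ≫ b = a ≫ i', QuasiIso (relMap k i i' a b w)

instance mono_chains_map {A B : SSet.{u}} (i : A ⟶ B) [Mono i] : Mono ((chains k).map i) := by
  refine HomologicalComplex.mono_of_mono_f _ fun n => ?_
  rw [ModuleCat.mono_iff_injective]
  have : Mono (i.app (op ⦋n⦌)) := inferInstance
  rw [CategoryTheory.mono_iff_injective] at this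
  exact Finsupp.mapDomain_injective this

variable {k}

/-- The short complex of a pair. -/
abbrev pairSC (k : Type) [CommRing k] {A B : SSet.{u}} (i : A ⟶ B) :
    ShortComplex (ChainComplex (ModuleCat.{u} k) ℕ) :=
  ShortComplex.mk ((chains k).map i) (cokernel.π _) (cokernel.condition _)

lemma pairSC_shortExact {A B : SSet.{u}} (i : A ⟶ B) [Mono i] : (pairSC k i).ShortExact where
  exact := ShortComplex.exact_cokernel _
  mono_f := mono_chains_map k i
  epi_g := inferInstanceAs (Epi (cokernel.π _))

/-- The map of short complexes induced by a map of pairs. -/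
abbrev pairSCMap {A B A' B' : SSet.{u}} {i : A ⟶ B} {i' : A' ⟶ B'} {a : A ⟶ A'} {b : B ⟶ B'}
    (w : i ≫ b = a ≫ i') : pairSC k i ⟶ pairSC k i' where
  τ₁ := (chains k).map a
  τ₂ := (chains k).map b
  τ₃ := relMap k i i' a b w
  comm₁₂ := by dsimp only [pairSC]; rw [← Functor.map_comp, ← Functor.map_comp, w]
  comm₂₃ := (cokernel.π_desc _ _ _).symm

lemma RelQI.of_qi {A B A' B' : SSet.{u}} {i : A ⟶ B} {i' : A' ⟶ B'} {a : A ⟶ A'} {b : B ⟶ B'}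
    [Mono i] [Mono i'] (w : i ≫ b = a ≫ i') (ha : QI k a) (hb : QI k b) : RelQI k i i' a b :=
  ⟨w, HomologicalComplex.HomologySequence.quasiIso_τ₃ (pairSCMap w) (pairSC_shortExact i)
    (pairSC_shortExact i') ha hb⟩

lemma RelQI.qi {A B A' B' : SSet.{u}} {i : A ⟶ B} {i' : A' ⟶ B'} {a : A ⟶ A'} {b : B ⟶ B'}
    [Mono i] [Mono i'] (h : RelQI k i i' a b) (ha : QI k a) : QI k b :=
  quasiIso_τ₂ (pairSCMap h.1) (pairSC_shortExact i) (pairSC_shortExact i') ha h.2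

section

variable {A B A' B' A'' B'' : SSet.{u}} {i : A ⟶ B} {i' : A' ⟶ B'} {i'' : A'' ⟶ B''}
  {a : A ⟶ A'} {b : B ⟶ B'} {a' : A' ⟶ A''} {b' : B' ⟶ B''}

lemma relMap_comp (w : i ≫ b = a ≫ i') (w' : i' ≫ b' = a' ≫ i'') :
    relMap k i i' a b w ≫ relMap k i' i'' a' b' w' =
      relMap k i i'' (a ≫ a') (b ≫ b') (by rw [reassoc_of% w, w', Category.assoc]) := by
  rw [← cancel_epi (cokernel.π _)]
  simp [relMap]

lemma RelQI.comp (h : RelQI k i i' a b) (h' : RelQI k i' i'' a' b') :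
    RelQI k i i'' (a ≫ a') (b ≫ b') := by
  obtain ⟨w, h⟩ := h
  obtain ⟨w', h'⟩ := h'
  refine ⟨by rw [reassoc_of% w, w', Category.assoc], ?_⟩
  rw [← relMap_comp w w']
  infer_instance

lemma RelQI.of_comp_left (h : RelQI k i i' a b) (w' : i' ≫ b' = a' ≫ i'')
    (hc : RelQI k i i'' (a ≫ a') (b ≫ b')) : RelQI k i' i'' a' b' := by
  obtain ⟨w, h⟩ := h
  obtain ⟨_, hc⟩ := hc
  refine ⟨w', ?_⟩
  rw [← relMap_comp w w'] at hc
  exact quasiIso_of_comp_left (relMap k i i' a b w) (relMap k i' i'' a' b' w')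

lemma RelQI.of_comp_right (w : i ≫ b = a ≫ i') (h' : RelQI k i' i'' a' b')
    (hc : RelQI k i i'' (a ≫ a') (b ≫ b')) : RelQI k i i' a b := by
  obtain ⟨w', h'⟩ := h'
  obtain ⟨_, hc⟩ := hc
  refine ⟨w, ?_⟩
  rw [← relMap_comp w w'] at hc
  exact quasiIso_of_comp_right (relMap k i i' a b w) (relMap k i' i'' a' b' w')

instance : PreservesColimitsOfShape WalkingSpan (freeMod.{u} k) :=
  preservesColimitsOfShape_of_natIso (freeModIso k)

instance : PreservesColimitsOfShape WalkingSpan (chains.{u} k) :=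
  HomologicalComplex.preservesColimitsOfShape_of_eval _ fun n =>
    inferInstanceAs (PreservesColimitsOfShape WalkingSpan
      ((evaluation SimplexCategoryᵒᵖ (Type u)).obj (op ⦋n⦌) ⋙ freeMod.{u} k))

/-- Free modules preserve pushouts, hence so do chains, and opposite sides of a pushout square of
complexes have isomorphic cokernels. -/
lemma RelQI.of_isPushout (h : IsPushout a i i' b) : RelQI k i i' a b := by
  have : IsIso (relMap k i i' a b h.w.symm) := by
    have hp : IsPushout ((chains k).map a) ((chains k).map i) ((chains k).map i')
        ((chains k).map b) := h.map (chains k)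
    exact isIso_cokernel_map_of_isPushout hp.flip
  exact ⟨h.w.symm, inferInstance⟩

end

end Relative

end CommClassifying

end

noncomputable section

namespace CommClassifying

/-! ### Ordered chains on tuples of points: cones, prisms and subdivision. -/

section Tuples

variable (k : Type*) [CommRing k] {V W : Type*}

/-- The boundary on the free modules on tuples of points. -/
def tbd (V : Type*) (n : ℕ) : ((Fin (n + 2) → V) →₀ k) →ₗ[k] ((Fin (n + 1) → V) →₀ k) :=
  ∑ i : Fin (n + 2), (-1 : k) ^ (i : ℕ) • Finsupp.lmapDomain k k (fun v => v ∘ i.succAbove)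

/-- Adding a point in front of a tuple. -/
def cone (b : V) (n : ℕ) : ((Fin (n + 1) → V) →₀ k) →ₗ[k] ((Fin (n + 2) → V) →₀ k) :=
  Finsupp.lmapDomain k k fun v => (Fin.cons b v : Fin (n + 2) → V)

/-- The map of tuples induced by a map of points. -/
def tmap (g : V → W) (n : ℕ) : ((Fin (n + 1) → V) →₀ k) →ₗ[k] ((Fin (n + 1) → W) →₀ k) :=
  Finsupp.lmapDomain k k (fun v => g ∘ v)

/-- The augmentation. -/
def aug (V : Type*) : ((Fin 1 → V) →₀ k) →ₗ[k] k := Finsupp.linearCombination k fun _ => (1 : k)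

/-- A tuple as a chain. -/
abbrev tup {n : ℕ} (v : Fin (n + 1) → V) : (Fin (n + 1) → V) →₀ k := Finsupp.single v 1

variable {k}

lemma tbd_tup {n : ℕ} (v : Fin (n + 2) → V) :
    tbd k V n (tup k v) = ∑ i : Fin (n + 2), (-1 : k) ^ (i : ℕ) • tup k (v ∘ i.succAbove) := by
  simp [tbd, LinearMap.sum_apply]

@[simp]
lemma cone_tup (b : V) {n : ℕ} (v : Fin (n + 1) → V) :
    cone k b n (tup k v) = tup k (Fin.cons b v : Fin (n + 2) → V) := by
  simp [cone]

@[simp]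
lemma tmap_tup (g : V → W) {n : ℕ} (v : Fin (n + 1) → V) :
    tmap k g n (tup k v) = tup k (g ∘ v) := by
  simp [tmap]

@[simp]
lemma aug_tup (v : Fin 1 → V) : aug k V (tup k v) = 1 := by simp [aug]

lemma tuple_hom_ext {n : ℕ} {M : Type*} [AddCommMonoid M] [Module k M]
    {f g : ((Fin (n + 1) → V) →₀ k) →ₗ[k] M} (h : ∀ v, f (tup k v) = g (tup k v)) : f = g :=
  Finsupp.lhom_ext' fun v => LinearMap.ext_ring (h v)

/-- Deleting the apex returns the tuple; deleting any other point shifts its index by one, whence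
the sign. -/
lemma tbd_cone_tup (b : V) {n : ℕ} (v : Fin (n + 2) → V) :
    tbd k V (n + 1) (cone k b (n + 1) (tup k v)) =
      tup k v - cone k b n (tbd k V n (tup k v)) := by
  rw [cone_tup, tbd_tup, Fin.sum_univ_succ, tbd_tup, map_sum, sub_eq_add_neg,
    ← Finset.sum_neg_distrib]
  congr 1
  · rw [Fin.val_zero, pow_zero, one_smul]
    congr 1
  · refine Finset.sum_congr rfl fun i _ => ?_
    rw [map_smul, cone_tup, Fin.val_succ, pow_succ, mul_neg_one, neg_smul]
    congr 3
    ext j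
    cases j using Fin.cases with
    | zero => simp
    | succ j => simp

lemma tbd_cone (b : V) {n : ℕ} (x : (Fin (n + 2) → V) →₀ k) :
    tbd k V (n + 1) (cone k b (n + 1) x) = x - cone k b n (tbd k V n x) := by
  have : tbd k V (n + 1) ∘ₗ cone k b (n + 1) = LinearMap.id - cone k b n ∘ₗ tbd k V n :=
    tuple_hom_ext fun v => tbd_cone_tup b v
  exact LinearMap.congr_fun this x

lemma tbd_cone_zero_tup (b : V) (v : Fin 1 → V) :
    tbd k V 0 (cone k b 0 (tup k v)) = tup k v - tup k (fun _ => b) := by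
  rw [cone_tup, tbd_tup, Fin.sum_univ_two, Fin.val_zero, Fin.val_one, pow_zero, pow_one, one_smul,
    neg_smul, one_smul, ← sub_eq_add_neg]
  congr 2
  ext j
  obtain rfl : j = 0 := Fin.fin_one_eq_zero j
  rfl

/-- In degree zero, deleting the old point leaves the apex alone, once for each unit of the
augmentation. -/
lemma tbd_cone_zero (b : V) (x : (Fin 1 → V) →₀ k) :
    tbd k V 0 (cone k b 0 x) = x - aug k V x • tup k (fun _ => b) := by
  have : tbd k V 0 ∘ₗ cone k b 0 =
      LinearMap.id - (aug k V).smulRight (tup k (fun _ => b)) := by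
    refine tuple_hom_ext fun v => (tbd_cone_zero_tup b v).trans ?_
    simp
  exact LinearMap.congr_fun this x

lemma aug_tbd (x : (Fin 2 → V) →₀ k) : aug k V (tbd k V 0 x) = 0 := by
  have : aug k V ∘ₗ tbd k V 0 = 0 := tuple_hom_ext fun v => by
    rw [LinearMap.comp_apply, tbd_tup, Fin.sum_univ_two]
    simp
  exact LinearMap.congr_fun this x

lemma tup_eq_cone {n : ℕ} (v : Fin (n + 2) → V) : tup k v = cone k (v 0) n (tup k (Fin.tail v)) := by
  rw [cone_tup, Fin.cons_self_tail]

/-- Every tuple is a cone from its first point, so the cone formula and induction suffice. -/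
lemma tbd_tbd {n : ℕ} (x : (Fin (n + 3) → V) →₀ k) : tbd k V n (tbd k V (n + 1) x) = 0 := by
  suffices h : tbd k V n ∘ₗ tbd k V (n + 1) = 0 from LinearMap.congr_fun h x
  induction n with
  | zero =>
    refine tuple_hom_ext fun v => ?_
    rw [LinearMap.comp_apply, tup_eq_cone, tbd_cone, map_sub, tbd_cone_zero, aug_tbd]
    simp
  | succ n ih =>
    refine tuple_hom_ext fun v => ?_
    rw [LinearMap.comp_apply, tup_eq_cone, tbd_cone, map_sub, tbd_cone,
      show tbd k V n (tbd k V (n + 1) (tup k (Fin.tail v))) = 0 from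
        LinearMap.congr_fun (ih (tup k fun _ => v 0)) _]
    simp

lemma tmap_tbd (g : V → W) {n : ℕ} (x : (Fin (n + 2) → V) →₀ k) :
    tmap k g n (tbd k V n x) = tbd k W n (tmap k g (n + 1) x) := by
  have : tmap k g n ∘ₗ tbd k V n = tbd k W n ∘ₗ tmap k g (n + 1) := tuple_hom_ext fun v => by
    rw [LinearMap.comp_apply, LinearMap.comp_apply, tmap_tup, tbd_tup, tbd_tup, map_sum]
    refine Finset.sum_congr rfl fun i _ => ?_
    rw [map_smul, tmap_tup]
    rfl
  exact LinearMap.congr_fun this x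

lemma tmap_cone (g : V → W) (b : V) {n : ℕ} (x : (Fin (n + 1) → V) →₀ k) :
    tmap k g (n + 1) (cone k b n x) = cone k (g b) n (tmap k g n x) := by
  have : tmap k g (n + 1) ∘ₗ cone k b n = cone k (g b) n ∘ₗ tmap k g n :=
    tuple_hom_ext fun v => by
      rw [LinearMap.comp_apply, LinearMap.comp_apply, cone_tup, tmap_tup, tmap_tup, cone_tup]
      congr 1
      ext j
      cases j using Fin.cases with
      | zero => simp
      | succ j => simp
  exact LinearMap.congr_fun this x

section Prism

variable (k)

/-- The prism homotopy from the identity to the map induced by `r` on tuples. -/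
def prism (r : V → V) : (n : ℕ) → ((Fin (n + 1) → V) →₀ k) →ₗ[k] ((Fin (n + 2) → V) →₀ k)
  | 0 => Finsupp.linearCombination k fun v => cone k (v 0) 0 (tup k (r ∘ v))
  | n + 1 => Finsupp.linearCombination k fun v =>
      cone k (v 0) (n + 1) (tup k (r ∘ v) - prism r n (tup k (Fin.tail v)))

variable {k}

lemma prism_zero (r : V → V) (v : Fin 1 → V) :
    prism k r 0 (tup k v) = cone k (v 0) 0 (tup k (r ∘ v)) := by
  simp [prism]

lemma prism_succ (r : V → V) {n : ℕ} (v : Fin (n + 2) → V) :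
    prism k r (n + 1) (tup k v) =
      cone k (v 0) (n + 1) (tup k (r ∘ v) - prism k r n (tup k (Fin.tail v))) := by
  rw [prism, Finsupp.linearCombination_single, one_smul]

lemma prism_cone_succ (r : V → V) (b : V) {n : ℕ} (x : (Fin (n + 1) → V) →₀ k) :
    prism k r (n + 1) (cone k b n x) =
      cone k b (n + 1) (cone k (r b) n (tmap k r n x) - prism k r n x) := by
  have : prism k r (n + 1) ∘ₗ cone k b n =
      cone k b (n + 1) ∘ₗ (cone k (r b) n ∘ₗ tmap k r n - prism k r n) :=
    tuple_hom_ext fun v => by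
      rw [LinearMap.comp_apply, cone_tup, prism_succ, LinearMap.comp_apply, LinearMap.sub_apply,
        LinearMap.comp_apply, Fin.cons_zero, Fin.tail_cons, ← tmap_tup, ← cone_tup, tmap_cone]
  exact LinearMap.congr_fun this x

lemma tbd_prism_zero (r : V → V) (x : (Fin 1 → V) →₀ k) :
    tbd k V 0 (prism k r 0 x) = tmap k r 0 x - x := by
  have : tbd k V 0 ∘ₗ prism k r 0 = tmap k r 0 - LinearMap.id := tuple_hom_ext fun v => by
    rw [LinearMap.comp_apply, prism_zero, tbd_cone_zero_tup, LinearMap.sub_apply, tmap_tup,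
      LinearMap.id_apply]
    congr 2
    ext j
    obtain rfl : j = 0 := Fin.fin_one_eq_zero j
    rfl
  exact LinearMap.congr_fun this x

/-- The prism is the classical alternating sum of the tuples `(v₀, …, vᵢ, r vᵢ, …, r vₙ)`, organized
as a cone from `v₀`. The homotopy formula is then the cone formula plus induction on the tail. -/
lemma tbd_prism (r : V → V) {n : ℕ} (x : (Fin (n + 2) → V) →₀ k) :
    tbd k V (n + 1) (prism k r (n + 1) x) = tmap k r (n + 1) x - x - prism k r n (tbd k V n x) := by
  suffices h : tbd k V (n + 1) ∘ₗ prism k r (n + 1) =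
      tmap k r (n + 1) - LinearMap.id - prism k r n ∘ₗ tbd k V n from LinearMap.congr_fun h x
  induction n with
  | zero =>
    refine tuple_hom_ext fun v => ?_
    simp only [LinearMap.comp_apply, LinearMap.sub_apply, LinearMap.id_apply]
    rw [tup_eq_cone, prism_cone_succ, tbd_cone, tbd_cone_zero, map_sub (tbd k V 0), tbd_prism_zero,
      tbd_cone_zero, tmap_cone, map_sub (prism k r 0)]
    have h1 : aug k V (tmap k r 0 (tup k (Fin.tail v))) = 1 := by simp
    have h2 : prism k r 0 (tup k fun _ => v 0) = cone k (v 0) 0 (tup k fun _ => r (v 0)) := by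
      rw [prism_zero]; rfl
    rw [h1, aug_tup, one_smul, one_smul, h2]
    simp only [map_sub]
    abel
  | succ n ih =>
    refine tuple_hom_ext fun v => ?_
    simp only [LinearMap.comp_apply, LinearMap.sub_apply, LinearMap.id_apply]
    have ih' := LinearMap.congr_fun (ih (tup k fun _ => v 0)) (tup k (Fin.tail v))
    simp only [LinearMap.comp_apply, LinearMap.sub_apply, LinearMap.id_apply] at ih'
    rw [tup_eq_cone, prism_cone_succ, tbd_cone, tbd_cone, map_sub (tbd k V (n + 1)), ih',
      tbd_cone, tmap_cone, map_sub (prism k r (n + 1)), prism_cone_succ, tmap_tbd]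
    simp only [map_sub]
    abel

/-- Two different self-maps are allowed because a translation of a group will carry one to another.
-/
lemma tmap_prism (g : V → W) {r : V → V} {r' : W → W} (h : ∀ v, r' (g v) = g (r v)) {n : ℕ}
    (x : (Fin (n + 1) → V) →₀ k) :
    tmap k g (n + 1) (prism k r n x) = prism k r' n (tmap k g n x) := by
  suffices e : tmap k g (n + 1) ∘ₗ prism k r n = prism k r' n ∘ₗ tmap k g n from
    LinearMap.congr_fun e x
  have hc (m : ℕ) (v : Fin m → V) : g ∘ r ∘ v = r' ∘ g ∘ v := funext fun i => (h (v i)).symm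
  induction n with
  | zero =>
    refine tuple_hom_ext fun v => ?_
    rw [LinearMap.comp_apply, LinearMap.comp_apply, tmap_tup, prism_zero, prism_zero, tmap_cone,
      tmap_tup, hc]
    rfl
  | succ n ih =>
    refine tuple_hom_ext fun v => ?_
    have ih' := LinearMap.congr_fun (ih (tup k fun _ => v 0)) (tup k (Fin.tail v))
    simp only [LinearMap.comp_apply] at ih'
    rw [LinearMap.comp_apply, LinearMap.comp_apply, tmap_tup, prism_succ, prism_succ, tmap_cone,
      map_sub, tmap_tup, hc, ih', tmap_tup]
    rfl

end Prism

section Subdivision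

variable (k)

/-- The subdivision of tuples, for a choice `β` of a centre of each tuple. -/
def sd (β : ∀ n : ℕ, (Fin (n + 1) → V) → V) :
    (n : ℕ) → ((Fin (n + 1) → V) →₀ k) →ₗ[k] ((Fin (n + 1) → V) →₀ k)
  | 0 => LinearMap.id
  | n + 1 => Finsupp.linearCombination k fun v =>
      cone k (β (n + 1) v) n (sd β n (tbd k V n (tup k v)))

/-- The homotopy from the subdivision of tuples to the identity. -/
def sdH (β : ∀ n : ℕ, (Fin (n + 1) → V) → V) :
    (n : ℕ) → ((Fin (n + 1) → V) →₀ k) →ₗ[k] ((Fin (n + 2) → V) →₀ k)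
  | 0 => 0
  | n + 1 => Finsupp.linearCombination k fun v =>
      cone k (β (n + 1) v) (n + 1) (tup k v - sdH β n (tbd k V n (tup k v)))

variable {k} (β : ∀ n : ℕ, (Fin (n + 1) → V) → V)

lemma sd_succ {n : ℕ} (v : Fin (n + 2) → V) :
    sd k β (n + 1) (tup k v) = cone k (β (n + 1) v) n (sd k β n (tbd k V n (tup k v))) := by
  rw [sd, Finsupp.linearCombination_single, one_smul]

lemma sdH_succ {n : ℕ} (v : Fin (n + 2) → V) :
    sdH k β (n + 1) (tup k v) =
      cone k (β (n + 1) v) (n + 1) (tup k v - sdH k β n (tbd k V n (tup k v))) := by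
  rw [sdH, Finsupp.linearCombination_single, one_smul]

/-- A subdivided tuple is the cone on its subdivided boundary. Its boundary is therefore that
subdivided boundary, up to a term containing the boundary of a boundary. -/
lemma tbd_sd {n : ℕ} (x : (Fin (n + 2) → V) →₀ k) :
    tbd k V n (sd k β (n + 1) x) = sd k β n (tbd k V n x) := by
  suffices e : tbd k V n ∘ₗ sd k β (n + 1) = sd k β n ∘ₗ tbd k V n from LinearMap.congr_fun e x
  induction n with
  | zero =>
    refine tuple_hom_ext fun v => ?_
    rw [LinearMap.comp_apply, LinearMap.comp_apply, sd_succ, tbd_cone_zero]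
    simp only [sd, LinearMap.id_apply]
    rw [aug_tbd, zero_smul, sub_zero]
  | succ n ih =>
    refine tuple_hom_ext fun v => ?_
    rw [LinearMap.comp_apply, LinearMap.comp_apply, sd_succ, tbd_cone,
      show tbd k V n (sd k β (n + 1) (tbd k V (n + 1) (tup k v))) = _ from
        LinearMap.congr_fun (ih (tup k fun _ => v 0)) _, LinearMap.comp_apply, tbd_tbd]
    simp

lemma tbd_sdH {n : ℕ} (x : (Fin (n + 2) → V) →₀ k) :
    tbd k V (n + 1) (sdH k β (n + 1) x) = x - sd k β (n + 1) x - sdH k β n (tbd k V n x) := by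
  suffices e : tbd k V (n + 1) ∘ₗ sdH k β (n + 1) =
      LinearMap.id - sd k β (n + 1) - sdH k β n ∘ₗ tbd k V n from LinearMap.congr_fun e x
  induction n with
  | zero =>
    refine tuple_hom_ext fun v => ?_
    simp only [LinearMap.comp_apply, LinearMap.sub_apply, LinearMap.id_apply]
    rw [sdH_succ, tbd_cone, sd_succ]
    simp [sd, sdH]
  | succ n ih =>
    refine tuple_hom_ext fun v => ?_
    have ih' := LinearMap.congr_fun (ih (tup k fun _ => v 0)) (tbd k V (n + 1) (tup k v))
    simp only [LinearMap.comp_apply, LinearMap.sub_apply, LinearMap.id_apply] at ih' ⊢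
    rw [sdH_succ, tbd_cone, sd_succ, map_sub (tbd k V (n + 1)), ih', tbd_tbd]
    simp only [map_sub, map_zero, sub_zero]
    abel

variable {β' : ∀ n : ℕ, (Fin (n + 1) → W) → W}

lemma tmap_sd {g : V → W} (h : ∀ n v, β' n (g ∘ v) = g (β n v)) {n : ℕ}
    (x : (Fin (n + 1) → V) →₀ k) :
    tmap k g n (sd k β n x) = sd k β' n (tmap k g n x) := by
  suffices e : tmap k g n ∘ₗ sd k β n = sd k β' n ∘ₗ tmap k g n from LinearMap.congr_fun e x
  induction n with
  | zero => rfl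
  | succ n ih =>
    refine tuple_hom_ext fun v => ?_
    rw [LinearMap.comp_apply, LinearMap.comp_apply, tmap_tup, sd_succ, sd_succ, tmap_cone,
      show tmap k g n (sd k β n (tbd k V n (tup k v))) = _ from
        LinearMap.congr_fun (ih (tup k fun _ => v 0)) _, LinearMap.comp_apply, tmap_tbd, tmap_tup, h]

lemma tmap_sdH {g : V → W} (h : ∀ n v, β' n (g ∘ v) = g (β n v)) {n : ℕ}
    (x : (Fin (n + 1) → V) →₀ k) :
    tmap k g (n + 1) (sdH k β n x) = sdH k β' n (tmap k g n x) := by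
  suffices e : tmap k g (n + 1) ∘ₗ sdH k β n = sdH k β' n ∘ₗ tmap k g n from
    LinearMap.congr_fun e x
  induction n with
  | zero => simp [sdH]
  | succ n ih =>
    refine tuple_hom_ext fun v => ?_
    rw [LinearMap.comp_apply, LinearMap.comp_apply, tmap_tup, sdH_succ, sdH_succ, tmap_cone,
      map_sub, show tmap k g (n + 1) (sdH k β n (tbd k V n (tup k v))) = _ from
        LinearMap.congr_fun (ih (tup k fun _ => v 0)) _, LinearMap.comp_apply, tmap_tbd, tmap_tup, h]

end Subdivision

end Tuples

end CommClassifying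

end

noncomputable section

namespace CommClassifying

/-! ### Affine simplices, barycentres, and the mesh of subdivisions. -/

section Affine

/-- The affine map of standard simplices given by the images of the vertices. -/
def aff {m n : ℕ} (v : Fin (m + 1) → stdSimplex ℝ (Fin (n + 1))) :
    C(stdSimplex ℝ (Fin (m + 1)), stdSimplex ℝ (Fin (n + 1))) where
  toFun t := ⟨∑ i, t.1 i • (v i).1,
    (convex_stdSimplex ℝ _).sum_mem (fun i _ => t.2.1 i) t.2.2 fun i _ => (v i).2⟩
  continuous_toFun := by
    refine Continuous.subtype_mk (continuous_finsetSum _ fun i _ => ?_) _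
    exact ((continuous_apply i).comp continuous_subtype_val).smul continuous_const

lemma aff_coe {m n : ℕ} (v : Fin (m + 1) → stdSimplex ℝ (Fin (n + 1)))
    (t : stdSimplex ℝ (Fin (m + 1))) :
    (aff v t).1 = ∑ i, t.1 i • (v i).1 := rfl

lemma aff_comp {m n p : ℕ} (w : Fin (n + 1) → stdSimplex ℝ (Fin (p + 1)))
    (v : Fin (m + 1) → stdSimplex ℝ (Fin (n + 1))) : aff (aff w ∘ v) = (aff w).comp (aff v) := by
  ext t : 1
  refine Subtype.ext ?_
  rw [ContinuousMap.comp_apply, aff_coe, aff_coe]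
  simp only [Function.comp_apply, aff_coe, Finset.smul_sum]
  rw [Finset.sum_comm]
  refine Finset.sum_congr rfl fun j _ => ?_
  rw [Finset.sum_apply, Finset.sum_smul]
  exact Finset.sum_congr rfl fun i _ => smul_smul _ _ _

/-- The tuple of vertices of the standard simplex. -/
def verts (n : ℕ) : Fin (n + 1) → stdSimplex ℝ (Fin (n + 1)) := fun i => stdSimplex.vertex i

lemma aff_verts (n : ℕ) : aff (verts n) = ContinuousMap.id _ := by
  ext t : 1
  refine Subtype.ext ?_
  rw [aff_coe]
  ext j
  simp [verts, Finset.sum_apply, Pi.single_apply]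

lemma aff_vert {m n : ℕ} (v : Fin (m + 1) → stdSimplex ℝ (Fin (n + 1))) : aff v ∘ verts m = v := by
  ext j : 1
  refine Subtype.ext ?_
  rw [Function.comp_apply, aff_coe]
  simp [verts, Pi.single_apply]

lemma aff_map {l m n : ℕ} (v : Fin (m + 1) → stdSimplex ℝ (Fin (n + 1)))
    (f : Fin (l + 1) → Fin (m + 1)) (t : stdSimplex ℝ (Fin (l + 1))) :
    aff v (stdSimplex.map f t) = aff (v ∘ f) t := by
  refine Subtype.ext ?_
  rw [aff_coe, aff_coe]
  have hc (j) : (stdSimplex.map f t).1 j = ∑ i with f i = j, t.1 i :=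
    FunOnFinite.linearMap_apply_apply ..
  simp only [hc, Finset.sum_smul]
  rw [← Finset.sum_fiberwise Finset.univ f (fun i => t.1 i • ((v ∘ f) i).1)]
  refine Finset.sum_congr rfl fun j _ => Finset.sum_congr rfl fun i hi => ?_
  rw [Function.comp_apply, (Finset.mem_filter.1 hi).2]

/-- The barycentre of a tuple of points of a simplex. -/
def bary {n : ℕ} (m : ℕ) (v : Fin (m + 1) → stdSimplex ℝ (Fin (n + 1))) :
    stdSimplex ℝ (Fin (n + 1)) := aff v stdSimplex.barycenter

lemma bary_aff {n p : ℕ} (w : Fin (n + 1) → stdSimplex ℝ (Fin (p + 1))) (m : ℕ)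
    (v : Fin (m + 1) → stdSimplex ℝ (Fin (n + 1))) : bary m (aff w ∘ v) = aff w (bary m v) := by
  rw [bary, aff_comp]; rfl

lemma dist_aff_le {m n : ℕ} (v : Fin (m + 1) → stdSimplex ℝ (Fin (n + 1)))
    (t : stdSimplex ℝ (Fin (m + 1))) (p : stdSimplex ℝ (Fin (n + 1))) {d : ℝ}
    (h : ∀ i, dist (v i) p ≤ d) : dist (aff v t) p ≤ d := by
  have : (aff v t).1 ∈ Metric.closedBall p.1 d :=
    (convex_closedBall _ _).sum_mem (fun i _ => t.2.1 i) t.2.2 fun i _ => h i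
  exact this

/-- The difference is the average of the `m + 1` vectors `v i - v j`, one of which vanishes. -/
lemma dist_bary_le {m n : ℕ} (v : Fin (m + 1) → stdSimplex ℝ (Fin (n + 1))) {d : ℝ}
    (h : ∀ i j, dist (v i) (v j) ≤ d) (j : Fin (m + 1)) :
    dist (v j) (bary m v) ≤ m / (m + 1) * d := by
  rw [dist_comm, Subtype.dist_eq, dist_eq_norm, bary, aff_coe]
  have hm : (0 : ℝ) < m + 1 := by positivity
  have hb (i : Fin (m + 1)) : (stdSimplex.barycenter : stdSimplex ℝ (Fin (m + 1))).1 i =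
      ((m : ℝ) + 1)⁻¹ := by
    have := stdSimplex.barycenter_apply (𝕜 := ℝ) i
    rw [Fintype.card_fin] at this
    push_cast at this
    exact this
  have h1 : ∑ i, (stdSimplex.barycenter : stdSimplex ℝ (Fin (m + 1))).1 i •
      (v i).1 - (v j).1 =
      ((m : ℝ) + 1)⁻¹ • ∑ i, ((v i).1 - (v j).1) := by
    simp only [hb]
    rw [← Finset.smul_sum, Finset.sum_sub_distrib, smul_sub, Finset.sum_const, Finset.card_univ,
      Fintype.card_fin, ← Nat.cast_smul_eq_nsmul ℝ, smul_smul]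
    push_cast
    rw [inv_mul_cancel₀ hm.ne', one_smul]
  rw [h1, norm_smul, norm_inv, Real.norm_of_nonneg hm.le]
  have h2 : ‖∑ i, ((v i).1 - (v j).1)‖ ≤ m * d := by
    rw [← Finset.add_sum_erase _ _ (Finset.mem_univ j), sub_self, zero_add]
    refine (norm_sum_le_of_le _ (f := fun i => (v i).1 - (v j).1)
      (n := fun _ => d) fun i _ => ?_).trans ?_
    · rw [← dist_eq_norm]; exact h i j
    · simp
  calc ((m : ℝ) + 1)⁻¹ * ‖∑ i, ((v i).1 - (v j).1)‖ ≤ ((m : ℝ) + 1)⁻¹ * (m * d) := by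
        gcongr
    _ = m / (m + 1) * d := by ring

end Affine

section Mesh

variable {k : Type*} [CommRing k]

/-- The tuples in the convex hull of `v` whose points have distance at most `d`. -/
def meshSet {m n : ℕ} (v : Fin (m + 1) → stdSimplex ℝ (Fin (n + 1))) (l : ℕ) (d : ℝ) :
    Set (Fin (l + 1) → stdSimplex ℝ (Fin (n + 1))) :=
  {w | (∀ i, ∃ t, w i = aff v t) ∧ ∀ i j, dist (w i) (w j) ≤ d}

lemma cone_mem_supported {V : Type*} (b : V) {n : ℕ} {S : Set (Fin (n + 1) → V)}
    {S' : Set (Fin (n + 2) → V)} (h : ∀ v ∈ S, (Fin.cons b v : Fin (n + 2) → V) ∈ S')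
    {x : (Fin (n + 1) → V) →₀ k} (hx : x ∈ Finsupp.supported k k S) :
    cone k b n x ∈ Finsupp.supported k k S' := by
  have h1 : cone k b n x ∈ (Finsupp.supported k k S).map (cone k b n) := ⟨x, hx, rfl⟩
  rw [cone, Finsupp.lmapDomain_supported] at h1
  exact Finsupp.supported_mono (by rintro _ ⟨v, hv, rfl⟩; exact h v hv) h1

/-- A simplex of the subdivision joins the barycentre of `v` to a simplex subdividing a face.
Distances inside the face are small by induction, as `m / (m + 1)` increases with `m`; distances to
the barycentre are bounded on the convex hull by their values at the vertices. This is why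
membership in the hull is part of the induction. -/
lemma sd_mem_meshSet {m n : ℕ} (v : Fin (m + 1) → stdSimplex ℝ (Fin (n + 1))) {d : ℝ}
    (h : ∀ i j, dist (v i) (v j) ≤ d) :
    sd k bary m (tup k v) ∈ Finsupp.supported k k (meshSet v m (m / (m + 1) * d)) := by
  have hd : 0 ≤ d := dist_nonneg.trans (h 0 0)
  induction m with
  | zero =>
    refine Finsupp.single_mem_supported k _ ⟨fun i => ⟨verts 0 i, ?_⟩, fun i j => ?_⟩
    · exact (congrFun (aff_vert v) i).symm
    · rw [Fin.fin_one_eq_zero i, Fin.fin_one_eq_zero j]; simp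
  | succ m ih =>
    rw [sd_succ, tbd_tup, map_sum, map_sum]
    refine Submodule.sum_mem _ fun i _ => ?_
    rw [map_smul, map_smul]
    refine Submodule.smul_mem _ _ (cone_mem_supported _ ?_
      (ih (v ∘ i.succAbove) fun a b => h _ _))
    have hw (w : Fin (m + 1) → stdSimplex ℝ (Fin (n + 1)))
        (hw : w ∈ meshSet (v ∘ i.succAbove) m (m / (m + 1) * d)) (j : Fin (m + 1)) :
        dist (w j) (bary (m + 1) v) ≤ ((m + 1 : ℕ) : ℝ) / ((m + 1 : ℕ) + 1) * d := by
      obtain ⟨t, ht⟩ := hw.1 j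
      rw [ht]
      exact dist_aff_le _ _ _ fun a => dist_bary_le v h _
    rintro w hw'
    refine ⟨fun j => ?_, fun a b => ?_⟩
    · cases j using Fin.cases with
      | zero => exact ⟨stdSimplex.barycenter, rfl⟩
      | succ j =>
        obtain ⟨t, ht⟩ := hw'.1 j
        exact ⟨stdSimplex.map i.succAbove t, by rw [Fin.cons_succ, ht, aff_map]⟩
    · cases a using Fin.cases with
      | zero =>
        cases b using Fin.cases with
        | zero => rw [dist_self]; positivity
        | succ b => rw [Fin.cons_zero, Fin.cons_succ, dist_comm]; exact hw w hw' b
      | succ a =>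
        cases b using Fin.cases with
        | zero => rw [Fin.cons_zero, Fin.cons_succ]; exact hw w hw' a
        | succ b =>
          rw [Fin.cons_succ, Fin.cons_succ]
          refine (hw'.2 a b).trans (mul_le_mul_of_nonneg_right ?_ hd)
          rw [div_le_div_iff₀ (by positivity) (by positivity)]
          push_cast
          nlinarith

lemma sd_mem_mesh {m n : ℕ} {d : ℝ} {x : (Fin (m + 1) → stdSimplex ℝ (Fin (n + 1))) →₀ k}
    (hx : x ∈ Finsupp.supported k k {v | ∀ i j, dist (v i) (v j) ≤ d}) :
    sd k bary m x ∈ Finsupp.supported k k {v | ∀ i j, dist (v i) (v j) ≤ m / (m + 1) * d} := by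
  rw [Finsupp.supported_eq_span_single] at hx
  induction hx using Submodule.span_induction with
  | mem x hx =>
    obtain ⟨v, hv, rfl⟩ := hx
    exact Finsupp.supported_mono (fun w hw => hw.2) (sd_mem_meshSet v hv)
  | zero => rw [map_zero]; exact Submodule.zero_mem _
  | add x y _ _ hx hy => rw [map_add]; exact Submodule.add_mem _ hx hy
  | smul a x _ hx => rw [map_smul]; exact Submodule.smul_mem _ _ hx

lemma sd_iterate_mem_mesh {m n : ℕ} {d : ℝ} (N : ℕ)
    {x : (Fin (m + 1) → stdSimplex ℝ (Fin (n + 1))) →₀ k}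
    (hx : x ∈ Finsupp.supported k k {v | ∀ i j, dist (v i) (v j) ≤ d}) :
    (sd k bary m)^[N] x ∈
      Finsupp.supported k k {v | ∀ i j, dist (v i) (v j) ≤ ((m : ℝ) / (m + 1)) ^ N * d} := by
  induction N with
  | zero => simpa using hx
  | succ N ih =>
    rw [Function.iterate_succ_apply', pow_succ', mul_assoc]
    exact sd_mem_mesh ih

lemma exists_sd_iterate_mem_mesh {m n : ℕ} (v : Fin (m + 1) → stdSimplex ℝ (Fin (n + 1))) {ε : ℝ}
    (hε : 0 < ε) : ∃ N : ℕ, (sd k bary m)^[N] (tup k v) ∈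
      Finsupp.supported k k {v | ∀ i j, dist (v i) (v j) < ε} := by
  have h : Filter.Tendsto (fun N : ℕ => ((m : ℝ) / (m + 1)) ^ N *
      Metric.diam (Set.univ : Set (stdSimplex ℝ (Fin (n + 1))))) Filter.atTop (nhds 0) := by
    rw [← zero_mul (Metric.diam (Set.univ : Set (stdSimplex ℝ (Fin (n + 1)))))]
    refine (tendsto_pow_atTop_nhds_zero_of_lt_one (by positivity) ?_).mul_const _
    rw [div_lt_one (by positivity)]
    linarith
  obtain ⟨N, hN⟩ := (h.eventually (gt_mem_nhds hε)).exists
  refine ⟨N, Finsupp.supported_mono (fun w hw i j => (hw i j).trans_lt hN)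
    (sd_iterate_mem_mesh N (Finsupp.single_mem_supported k _ fun i j => ?_))⟩
  exact Metric.dist_le_diam_of_mem isCompact_univ.isBounded (Set.mem_univ _) (Set.mem_univ _)

end Mesh

end CommClassifying

end

noncomputable section

open Simplicial Opposite AlgebraicTopology

namespace CommClassifying

variable {k : Type} [CommRing k]

/-! ### Relative cycles and inclusions of subcomplexes. -/

section Subcomplexes

lemma mapDomain_mem_supported_iff {α β : Type*} {f : α → β} (hf : Function.Injective f)
    (y : β →₀ k) : y ∈ Finsupp.supported k k (Set.range f) ↔ ∃ x, Finsupp.mapDomain f x = y := by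
  constructor
  · intro h
    exact ⟨_, Finsupp.mapDomain_comapDomain f hf y h⟩
  · rintro ⟨x, rfl⟩
    have : Finsupp.lmapDomain k k f x ∈ (Finsupp.supported k k Set.univ).map
      (Finsupp.lmapDomain k k f) := ⟨x, by simp, rfl⟩
    rw [Finsupp.lmapDomain_supported, Set.image_univ] at this
    exact this

/-- A chain whose boundary lies in the given submodules. In degree zero this is no condition. -/
def IsRelCyc {Y : SSet.{u}} (S : ∀ n : ℕ, Set (Y _⦋n⦌)) {n : ℕ} (x : Y _⦋n⦌ →₀ k) : Prop :=
  ∀ m (h : m + 1 = n), bd k Y m (by rw [← h] at x; exact x) ∈ Finsupp.supported k k (S m)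

lemma isRelCyc_succ {Y : SSet.{u}} {S : ∀ n : ℕ, Set (Y _⦋n⦌)} {n : ℕ} {x : Y _⦋n + 1⦌ →₀ k} :
    IsRelCyc S x ↔ bd k Y n x ∈ Finsupp.supported k k (S n) := by
  constructor
  · intro h; exact h n rfl
  · rintro h m hm
    obtain rfl : m = n := by omega
    exact h

lemma isRelCyc_zero {Y : SSet.{u}} {S : ∀ n : ℕ, Set (Y _⦋n⦌)} (x : Y _⦋0⦌ →₀ k) :
    IsRelCyc S x := fun m hm => by omega

/-- The hypothesis is the vanishing of relative homology. In degree `n + 1`, applied to a chain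
bounding the image of a cycle, it gives injectivity; in degree `n`, applied to a cycle, it gives
surjectivity. -/
lemma qi_of_relative {X Y : SSet.{u}} (i : X ⟶ Y)
    (hi : ∀ n : ℕ, Function.Injective (i.app (op ⦋n⦌)))
    (h : ∀ (n : ℕ) (x : Y _⦋n⦌ →₀ k), IsRelCyc (fun n => Set.range (i.app (op ⦋n⦌))) x →
      ∃ w, x - bd k Y n w ∈ Finsupp.supported k k (Set.range (i.app (op ⦋n⦌)))) : QI k i := by
  rw [qi_iff]
  intro n
  constructor
  · intro x hx y hxy
    obtain ⟨w, hw⟩ := h (n + 1) y (isRelCyc_succ.2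
      ((mapDomain_mem_supported_iff (hi n) _).2 ⟨x, hxy⟩))
    obtain ⟨v, hv⟩ := (mapDomain_mem_supported_iff (hi (n + 1)) _).1 hw
    refine ⟨v, Finsupp.mapDomain_injective (hi n) ?_⟩
    rw [← bd_naturality, hv, map_sub, bd_bd, sub_zero, hxy]
  · intro y hy
    obtain ⟨w, hw⟩ := h n y (by
      cases n with
      | zero => exact isRelCyc_zero _
      | succ n =>
        rw [isRelCyc_succ, show bd k Y n y = 0 from hy]
        exact Submodule.zero_mem _)
    obtain ⟨v, hv⟩ := (mapDomain_mem_supported_iff (hi n) _).1 hw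
    refine ⟨v, ?_, w, by rw [hv]; abel⟩
    cases n with
    | zero => trivial
    | succ n =>
      refine Finsupp.mapDomain_injective (hi n) ?_
      rw [← bd_naturality, hv, map_sub, bd_bd, show bd k Y n y = 0 from hy]
      simp

end Subcomplexes

/-! ### Barycentric subdivision of singular chains and small simplices. -/

section Singular

variable {X : TopCat.{u}}

/-- A singular simplex as a continuous map. -/
def asMap {n : ℕ} : (TopCat.toSSet.obj X) _⦋n⦌ ≃ C(stdSimplex ℝ (Fin (n + 1)), X) :=
  X.toSSetObjEquiv (op ⦋n⦌)

lemma asMap_δ {n : ℕ} (i : Fin (n + 2)) (σ : (TopCat.toSSet.obj X) _⦋n + 1⦌)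
    (t : stdSimplex ℝ (Fin (n + 1))) :
    asMap ((TopCat.toSSet.obj X).δ i σ) t = asMap σ (stdSimplex.map i.succAbove t) := rfl

/-- The restriction of a singular simplex to an affine simplex. -/
def restr {n m : ℕ} (σ : (TopCat.toSSet.obj X) _⦋n⦌)
    (v : Fin (m + 1) → stdSimplex ℝ (Fin (n + 1))) : (TopCat.toSSet.obj X) _⦋m⦌ :=
  asMap.symm ((asMap σ).comp (aff v))

lemma asMap_restr {n m : ℕ} (σ : (TopCat.toSSet.obj X) _⦋n⦌)
    (v : Fin (m + 1) → stdSimplex ℝ (Fin (n + 1))) :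
    asMap (restr σ v) = (asMap σ).comp (aff v) := asMap.apply_symm_apply _

lemma restr_restr {n m l : ℕ} (σ : (TopCat.toSSet.obj X) _⦋n⦌)
    (v : Fin (m + 1) → stdSimplex ℝ (Fin (n + 1)))
    (w : Fin (l + 1) → stdSimplex ℝ (Fin (m + 1))) :
    restr (restr σ v) w = restr σ (aff v ∘ w) := by
  refine asMap.injective ?_
  rw [asMap_restr, asMap_restr, asMap_restr, aff_comp, ContinuousMap.comp_assoc]

lemma restr_verts {n : ℕ} (σ : (TopCat.toSSet.obj X) _⦋n⦌) : restr σ (verts n) = σ := by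
  refine asMap.injective ?_
  rw [asMap_restr, aff_verts, ContinuousMap.comp_id]

lemma δ_restr {n m : ℕ} (σ : (TopCat.toSSet.obj X) _⦋n⦌)
    (v : Fin (m + 2) → stdSimplex ℝ (Fin (n + 1))) (i : Fin (m + 2)) :
    (TopCat.toSSet.obj X).δ i (restr σ v) = restr σ (v ∘ i.succAbove) := by
  refine asMap.injective (ContinuousMap.ext fun t => ?_)
  rw [asMap_δ, asMap_restr, asMap_restr, ContinuousMap.comp_apply, ContinuousMap.comp_apply,
    aff_map]

variable (k) in
/-- The chain map from affine chains in a simplex to singular chains. -/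
def pushAff {n : ℕ} (σ : (TopCat.toSSet.obj X) _⦋n⦌) (m : ℕ) :
    ((Fin (m + 1) → stdSimplex ℝ (Fin (n + 1))) →₀ k) →ₗ[k] ((TopCat.toSSet.obj X) _⦋m⦌ →₀ k) :=
  Finsupp.lmapDomain k k (restr σ)

lemma pushAff_tup {n m : ℕ} (σ : (TopCat.toSSet.obj X) _⦋n⦌)
    (v : Fin (m + 1) → stdSimplex ℝ (Fin (n + 1))) :
    pushAff k σ m (tup k v) = Finsupp.single (restr σ v) 1 := by
  simp [pushAff]

lemma bd_pushAff {n m : ℕ} (σ : (TopCat.toSSet.obj X) _⦋n⦌)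
    (x : (Fin (m + 2) → stdSimplex ℝ (Fin (n + 1))) →₀ k) :
    bd k _ m (pushAff k σ (m + 1) x) = pushAff k σ m (tbd k _ m x) := by
  have : bd k _ m ∘ₗ pushAff k σ (m + 1) = pushAff k σ m ∘ₗ tbd k _ m := tuple_hom_ext fun v => by
    rw [LinearMap.comp_apply, LinearMap.comp_apply, pushAff_tup, bd_single, tbd_tup, map_sum]
    refine Finset.sum_congr rfl fun i _ => ?_
    rw [map_smul, pushAff_tup, δ_restr]
  exact LinearMap.congr_fun this x

lemma pushAff_restr {n m l : ℕ} (σ : (TopCat.toSSet.obj X) _⦋n⦌)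
    (v : Fin (m + 1) → stdSimplex ℝ (Fin (n + 1)))
    (x : (Fin (l + 1) → stdSimplex ℝ (Fin (m + 1))) →₀ k) :
    pushAff k (restr σ v) l x = pushAff k σ l (tmap k (aff v) l x) := by
  have : pushAff k (restr σ v) l = pushAff k σ l ∘ₗ tmap k (aff v) l := tuple_hom_ext fun w => by
    rw [LinearMap.comp_apply, pushAff_tup, tmap_tup, pushAff_tup, restr_restr]
  exact LinearMap.congr_fun this x

variable (k X) in
/-- The barycentric subdivision of singular chains. -/
def singSd (n : ℕ) :
    ((TopCat.toSSet.obj X) _⦋n⦌ →₀ k) →ₗ[k] ((TopCat.toSSet.obj X) _⦋n⦌ →₀ k) :=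
  Finsupp.linearCombination k fun σ => pushAff k σ n (sd k bary n (tup k (verts n)))

variable (k X) in
/-- The homotopy between the barycentric subdivision and the identity. -/
def singSdH (n : ℕ) :
    ((TopCat.toSSet.obj X) _⦋n⦌ →₀ k) →ₗ[k] ((TopCat.toSSet.obj X) _⦋n + 1⦌ →₀ k) :=
  Finsupp.linearCombination k fun σ => pushAff k σ (n + 1) (sdH k bary n (tup k (verts n)))

/-- Affine maps preserve barycentres, so an affine simplex may be subdivided inside its ambient
simplex before mapping to `X`. This transfers the identities for tuples to singular chains. -/
lemma singSd_pushAff {n m : ℕ} (σ : (TopCat.toSSet.obj X) _⦋n⦌)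
    (x : (Fin (m + 1) → stdSimplex ℝ (Fin (n + 1))) →₀ k) :
    singSd k X m (pushAff k σ m x) = pushAff k σ m (sd k bary m x) := by
  have : singSd k X m ∘ₗ pushAff k σ m = pushAff k σ m ∘ₗ sd k bary m := tuple_hom_ext fun v => by
    rw [LinearMap.comp_apply, LinearMap.comp_apply, pushAff_tup, singSd,
      Finsupp.linearCombination_single, one_smul, pushAff_restr, tmap_sd _ (bary_aff v), tmap_tup,
      aff_vert]
  exact LinearMap.congr_fun this x

lemma singSdH_pushAff {n m : ℕ} (σ : (TopCat.toSSet.obj X) _⦋n⦌)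
    (x : (Fin (m + 1) → stdSimplex ℝ (Fin (n + 1))) →₀ k) :
    singSdH k X m (pushAff k σ m x) = pushAff k σ (m + 1) (sdH k bary m x) := by
  have : singSdH k X m ∘ₗ pushAff k σ m = pushAff k σ (m + 1) ∘ₗ sdH k bary m :=
    tuple_hom_ext fun v => by
      rw [LinearMap.comp_apply, LinearMap.comp_apply, pushAff_tup, singSdH,
        Finsupp.linearCombination_single, one_smul, pushAff_restr, tmap_sdH _ (bary_aff v),
        tmap_tup, aff_vert]
  exact LinearMap.congr_fun this x

lemma single_eq_pushAff {n : ℕ} (σ : (TopCat.toSSet.obj X) _⦋n⦌) :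
    (Finsupp.single σ 1 : _ →₀ k) = pushAff k σ n (tup k (verts n)) := by
  rw [pushAff_tup, restr_verts]

lemma bd_singSd {n : ℕ} (x : (TopCat.toSSet.obj X) _⦋n + 1⦌ →₀ k) :
    bd k _ n (singSd k X (n + 1) x) = singSd k X n (bd k _ n x) := by
  have : bd k _ n ∘ₗ singSd k X (n + 1) = singSd k X n ∘ₗ bd k _ n :=
    Finsupp.lhom_ext' fun σ => LinearMap.ext_ring <| by
      change bd k _ n (singSd k X (n + 1) (Finsupp.single σ 1)) =
        singSd k X n (bd k _ n (Finsupp.single σ 1))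
      rw [single_eq_pushAff, singSd_pushAff, bd_pushAff, bd_pushAff, tbd_sd, singSd_pushAff]
  exact LinearMap.congr_fun this x

lemma bd_singSdH {n : ℕ} (x : (TopCat.toSSet.obj X) _⦋n + 1⦌ →₀ k) :
    bd k _ (n + 1) (singSdH k X (n + 1) x) =
      x - singSd k X (n + 1) x - singSdH k X n (bd k _ n x) := by
  have : bd k _ (n + 1) ∘ₗ singSdH k X (n + 1) =
      LinearMap.id - singSd k X (n + 1) - singSdH k X n ∘ₗ bd k _ n :=
    Finsupp.lhom_ext' fun σ => LinearMap.ext_ring <| by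
      change bd k _ (n + 1) (singSdH k X (n + 1) (Finsupp.single σ 1)) =
        Finsupp.single σ 1 - singSd k X (n + 1) (Finsupp.single σ 1) -
          singSdH k X n (bd k _ n (Finsupp.single σ 1))
      rw [single_eq_pushAff, singSd_pushAff, singSdH_pushAff, bd_pushAff, bd_pushAff, tbd_sdH,
        singSdH_pushAff, map_sub, map_sub]
  exact LinearMap.congr_fun this x

lemma singSd_zero (x : (TopCat.toSSet.obj X) _⦋0⦌ →₀ k) : singSd k X 0 x = x := by
  have : singSd k X 0 = LinearMap.id :=
    Finsupp.lhom_ext' fun σ => LinearMap.ext_ring <| by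
      change singSd k X 0 (Finsupp.single σ 1) = Finsupp.single σ 1
      rw [single_eq_pushAff, singSd_pushAff]
      rfl
  exact LinearMap.congr_fun this x

variable {ι : Type*} (U : ι → Set X)

/-- The singular simplices which lie in a member of a family of subsets. -/
def smallSet (n : ℕ) : Set ((TopCat.toSSet.obj X) _⦋n⦌) := {σ | ∃ i, ∀ t, asMap σ t ∈ U i}

variable {U}

lemma pushAff_mem_small {n m : ℕ} {σ : (TopCat.toSSet.obj X) _⦋n⦌} (hσ : σ ∈ smallSet U n)
    (x : (Fin (m + 1) → stdSimplex ℝ (Fin (n + 1))) →₀ k) :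
    pushAff k σ m x ∈ Finsupp.supported k k (smallSet U m) := by
  obtain ⟨i, hi⟩ := hσ
  have h1 : pushAff k σ m x ∈ (Finsupp.supported k k Set.univ).map (pushAff k σ m) :=
    ⟨x, by simp, rfl⟩
  rw [pushAff, Finsupp.lmapDomain_supported] at h1
  refine Finsupp.supported_mono ?_ h1
  rintro _ ⟨v, -, rfl⟩
  exact ⟨i, fun t => by rw [asMap_restr]; exact hi _⟩

lemma linearCombination_mem_small {n m : ℕ}
    {f : (TopCat.toSSet.obj X) _⦋n⦌ → ((TopCat.toSSet.obj X) _⦋m⦌ →₀ k)}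
    (hf : ∀ σ ∈ smallSet U n, f σ ∈ Finsupp.supported k k (smallSet U m))
    {x : (TopCat.toSSet.obj X) _⦋n⦌ →₀ k} (hx : x ∈ Finsupp.supported k k (smallSet U n)) :
    Finsupp.linearCombination k f x ∈ Finsupp.supported k k (smallSet U m) := by
  rw [Finsupp.linearCombination_apply]
  refine Submodule.sum_mem _ fun σ hσ => Submodule.smul_mem _ _ (hf σ (hx hσ))

lemma singSd_mem_small {n : ℕ} {x : (TopCat.toSSet.obj X) _⦋n⦌ →₀ k}
    (hx : x ∈ Finsupp.supported k k (smallSet U n)) :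
    singSd k X n x ∈ Finsupp.supported k k (smallSet U n) :=
  linearCombination_mem_small (fun _ hσ => pushAff_mem_small hσ _) hx

lemma singSdH_mem_small {n : ℕ} {x : (TopCat.toSSet.obj X) _⦋n⦌ →₀ k}
    (hx : x ∈ Finsupp.supported k k (smallSet U n)) :
    singSdH k X n x ∈ Finsupp.supported k k (smallSet U (n + 1)) :=
  linearCombination_mem_small (fun _ hσ => pushAff_mem_small hσ _) hx

lemma singSd_iterate_mem_small {n : ℕ} {x : (TopCat.toSSet.obj X) _⦋n⦌ →₀ k}
    (hx : x ∈ Finsupp.supported k k (smallSet U n)) (N : ℕ) :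
    (singSd k X n)^[N] x ∈ Finsupp.supported k k (smallSet U n) := by
  induction N with
  | zero => exact hx
  | succ N ih => rw [Function.iterate_succ_apply']; exact singSd_mem_small ih

lemma singSd_iterate_single {n : ℕ} (σ : (TopCat.toSSet.obj X) _⦋n⦌) (N : ℕ) :
    (singSd k X n)^[N] (Finsupp.single σ 1) =
      pushAff k σ n ((sd k bary n)^[N] (tup k (verts n))) := by
  induction N with
  | zero => exact single_eq_pushAff σ
  | succ N ih => rw [Function.iterate_succ_apply', ih, singSd_pushAff, Function.iterate_succ_apply']

lemma exists_singSd_single_mem_small (hU : ∀ i, IsOpen (U i)) (hc : ∀ x, ∃ i, x ∈ U i) {n : ℕ}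
    (σ : (TopCat.toSSet.obj X) _⦋n⦌) :
    ∃ N, (singSd k X n)^[N] (Finsupp.single σ 1) ∈ Finsupp.supported k k (smallSet U n) := by
  obtain ⟨δ, hδ, h⟩ := lebesgue_number_lemma_of_metric (s := Set.univ)
    (c := fun i => asMap σ ⁻¹' U i) isCompact_univ
    (fun i => (hU i).preimage (asMap σ).continuous) (fun t _ => by
      obtain ⟨i, hi⟩ := hc (asMap σ t)
      exact Set.mem_iUnion.2 ⟨i, hi⟩)
  -- With vertices within `δ / 2` of `v 0`, the whole affine simplex lies in the open `δ`-ball about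
  -- `v 0`.
  obtain ⟨N, hN⟩ := exists_sd_iterate_mem_mesh (k := k) (verts n) (half_pos hδ)
  refine ⟨N, ?_⟩
  rw [singSd_iterate_single]
  have h1 : pushAff k σ n ((sd k bary n)^[N] (tup k (verts n))) ∈
    (Finsupp.supported k k _).map (pushAff k σ n) := ⟨_, hN, rfl⟩
  rw [pushAff, Finsupp.lmapDomain_supported] at h1
  refine Finsupp.supported_mono ?_ h1
  rintro _ ⟨v, hv, rfl⟩
  obtain ⟨i, hi⟩ := h (v 0) (Set.mem_univ _)
  refine ⟨i, fun t => ?_⟩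
  rw [asMap_restr]
  refine hi ?_
  rw [Metric.mem_ball]
  exact (dist_aff_le v t (v 0) fun j => (hv j 0).le).trans_lt (half_lt_self hδ)

lemma exists_singSd_mem_small (hU : ∀ i, IsOpen (U i)) (hc : ∀ x, ∃ i, x ∈ U i) {n : ℕ}
    (x : (TopCat.toSSet.obj X) _⦋n⦌ →₀ k) :
    ∃ N, (singSd k X n)^[N] x ∈ Finsupp.supported k k (smallSet U n) := by
  have hadd (N : ℕ) (x y : (TopCat.toSSet.obj X) _⦋n⦌ →₀ k) :
      (singSd k X n)^[N] (x + y) = (singSd k X n)^[N] x + (singSd k X n)^[N] y :=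
    iterate_map_add (singSd k X n) N x y
  induction x using Finsupp.induction_linear with
  | zero => exact ⟨0, Submodule.zero_mem _⟩
  | add x y hx hy =>
    obtain ⟨N, hN⟩ := hx
    obtain ⟨M, hM⟩ := hy
    -- Small chains stay small under further subdivision, so the sum of the exponents serves both
    -- summands.
    refine ⟨N + M, ?_⟩
    rw [hadd]
    refine Submodule.add_mem _ ?_ ?_
    · rw [add_comm, Function.iterate_add_apply]
      exact singSd_iterate_mem_small hN M
    · rw [Function.iterate_add_apply]
      exact singSd_iterate_mem_small hM N
  | single σ a =>
    obtain ⟨N, hN⟩ := exists_singSd_single_mem_small (k := k) hU hc σ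
    refine ⟨N, ?_⟩
    have : (singSd k X n)^[N] (Finsupp.single σ a) =
        a • (singSd k X n)^[N] (Finsupp.single σ 1) := by
      rw [← Module.End.coe_pow, ← map_smul, Finsupp.smul_single_one]
    rw [this]
    exact Submodule.smul_mem _ _ hN

/-- The subdivision homotopies add up. The error terms apply the homotopy to a boundary that is
already small, and the homotopy preserves smallness. -/
lemma exists_sub_singSd_iterate {n : ℕ} (x : (TopCat.toSSet.obj X) _⦋n⦌ →₀ k)
    (hx : IsRelCyc (smallSet U) x) (N : ℕ) :
    IsRelCyc (smallSet U) ((singSd k X n)^[N] x) ∧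
      ∃ w, x - (singSd k X n)^[N] x - bd k _ n w ∈ Finsupp.supported k k (smallSet U n) := by
  induction N with
  | zero => exact ⟨hx, 0, by simp⟩
  | succ N ih =>
    obtain ⟨h1, w, hw⟩ := ih
    rw [Function.iterate_succ_apply']
    generalize (singSd k X n)^[N] x = y at *
    cases n with
    | zero => exact ⟨isRelCyc_zero _, w, by rwa [singSd_zero]⟩
    | succ n =>
      rw [isRelCyc_succ] at h1 ⊢
      refine ⟨by rw [bd_singSd]; exact singSd_mem_small h1, w + singSdH k X _ y, ?_⟩
      rw [map_add, bd_singSdH]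
      have := Submodule.add_mem _ hw (singSdH_mem_small h1)
      convert this using 1
      abel

/-- Small simplices compute singular homology. -/
theorem qi_small (hU : ∀ i, IsOpen (U i)) (hc : ∀ x, ∃ i, x ∈ U i) {S : SSet.{u}}
    (j : S ⟶ TopCat.toSSet.obj X) (hj : ∀ n : ℕ, Function.Injective (j.app (op ⦋n⦌)))
    (hr : ∀ n : ℕ, Set.range (j.app (op ⦋n⦌)) = smallSet U n) : QI k j := by
  refine qi_of_relative j hj fun n x hx => ?_
  simp only [hr] at hx ⊢
  obtain ⟨N, hN⟩ := exists_singSd_mem_small hU hc x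
  obtain ⟨-, w, hw⟩ := exists_sub_singSd_iterate x hx N
  refine ⟨w, ?_⟩
  have := Submodule.add_mem _ hN hw
  convert this using 1
  abel

end Singular

end CommClassifying

end

/-! ### Points and topology of the geometric realization. -/

noncomputable section

open Simplicial Opposite AlgebraicTopology

namespace CommClassifying

variable {Y Z : SSet.{u}}

/-- The characteristic map `Δⁿ → |Y|` of an `n`-simplex `y`. -/
def real {n : ℕ} (y : Y _⦋n⦌) : C(stdSimplex ℝ (Fin (n + 1)), SSet.toTop.obj Y) :=
  asMap ((sSetTopAdj.unit.app Y).app (op ⦋n⦌) y)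

lemma real_map {n m : ℕ} (f : ⦋m⦌ ⟶ ⦋n⦌) (y : Y _⦋n⦌) (t : stdSimplex ℝ (Fin (m + 1))) :
    real (Y.map f.op y) t = real y (stdSimplex.map f t) := by
  have h := ConcreteCategory.congr_hom ((sSetTopAdj.unit.app Y).naturality f.op) y
  have h' : (sSetTopAdj.unit.app Y).app (op ⦋m⦌) (Y.map f.op y) =
    (TopCat.toSSet.obj (SSet.toTop.obj Y)).map f.op ((sSetTopAdj.unit.app Y).app (op ⦋n⦌) y) := h
  show asMap ((sSetTopAdj.unit.app Y).app (op ⦋m⦌) (Y.map f.op y)) t = _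
  rw [h']
  rfl

lemma toTop_map_real (f : Y ⟶ Z) {n : ℕ} (y : Y _⦋n⦌) (t : stdSimplex ℝ (Fin (n + 1))) :
    SSet.toTop.map f (real y t) = real (f.app (op ⦋n⦌) y) t := by
  have h := ConcreteCategory.congr_hom (NatTrans.congr_app (sSetTopAdj.unit.naturality f) (op ⦋n⦌)) y
  have h' : (sSetTopAdj.unit.app Z).app (op ⦋n⦌) (f.app (op ⦋n⦌) y) =
    (TopCat.toSSet.map (SSet.toTop.map f)).app (op ⦋n⦌)
      ((sSetTopAdj.unit.app Y).app (op ⦋n⦌) y) := h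
  show _ = asMap ((sSetTopAdj.unit.app Z).app (op ⦋n⦌) (f.app (op ⦋n⦌) y)) t
  rw [h']
  rfl

lemma toTop_hom_ext {T : TopCat.{u}} {f g : SSet.toTop.obj Y ⟶ T}
    (h : ∀ (n : ℕ) (y : Y _⦋n⦌) (t : stdSimplex ℝ (Fin (n + 1))), f (real y t) = g (real y t)) :
    f = g := by
  apply (sSetTopAdj.homEquiv _ _).injective
  ext ⟨Δ⟩ y
  induction Δ using SimplexCategory.rec with | _ n => ?_
  rw [Adjunction.homEquiv_unit, Adjunction.homEquiv_unit]
  exact asMap.injective (ContinuousMap.ext (h n y))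

/-- The adjunction with singular simplices, in the form of a description of `|Y|` as a quotient of a
sum of simplices. The points and the topology of `|Y|` are extracted from it by mapping to suitable
test spaces. -/
lemma exists_toTop_desc (T : TopCat.{u})
    (F : ∀ n, Y _⦋n⦌ → C(stdSimplex ℝ (Fin (n + 1)), T))
    (nat : ∀ (n m : ℕ) (f : ⦋m⦌ ⟶ ⦋n⦌) (y : Y _⦋n⦌) (t), F m (Y.map f.op y) t =
      F n y (stdSimplex.map f t)) :
    ∃ g : SSet.toTop.obj Y ⟶ T, ∀ n (y : Y _⦋n⦌) t, g (real y t) = F n y t := by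
  let φ : Y ⟶ TopCat.toSSet.obj T :=
    { app := fun Δ => TypeCat.ofHom fun y => (asMap (n := Δ.unop.len)).symm (F Δ.unop.len y)
      naturality := by
        rintro ⟨Δ⟩ ⟨Δ'⟩ f
        induction Δ using SimplexCategory.rec with | _ n => ?_
        induction Δ' using SimplexCategory.rec with | _ m => ?_
        ext y
        refine asMap.injective (ContinuousMap.ext fun t => ?_)
        exact nat n m f.unop y t }
  refine ⟨(sSetTopAdj.homEquiv _ _).symm φ, fun n y t => ?_⟩
  have h := (sSetTopAdj.homEquiv _ _).apply_symm_apply φ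
  rw [Adjunction.homEquiv_unit] at h
  have h2 := ConcreteCategory.congr_hom (NatTrans.congr_app h (op ⦋n⦌)) y
  exact congrArg (fun σ => asMap σ t) h2

/-- Functions on `|Y|` are compatible families of functions on the simplices. -/
lemma exists_pred (P : ∀ n, Y _⦋n⦌ → stdSimplex ℝ (Fin (n + 1)) → Prop)
    (nat : ∀ (n m : ℕ) (f : ⦋m⦌ ⟶ ⦋n⦌) (y : Y _⦋n⦌) (t), P m (Y.map f.op y) t ↔
      P n y (stdSimplex.map f t)) :
    ∃ Q : SSet.toTop.obj Y → Prop, ∀ n (y : Y _⦋n⦌) t, Q (real y t) ↔ P n y t := by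
  -- Every function to an indiscrete space is continuous, so the universal property also governs
  -- bare predicates.
  let _ : TopologicalSpace (ULift.{u} Prop) := ⊤
  obtain ⟨g, hg⟩ := exists_toTop_desc (Y := Y) (TopCat.of (ULift.{u} Prop))
    (fun n y => ⟨fun t => ULift.up (P n y t), continuous_top⟩)
    (fun n m f y t => ULift.ext _ _ (propext (nat n m f y t)))
  exact ⟨fun x => (g x).down, fun n y t => iff_of_eq (congrArg ULift.down (hg n y t))⟩

/-- The indicator of the union of all closed cells and the constant `True` agree on each cell, so
they agree as maps to an indiscrete space. -/
lemma exists_real (x : SSet.toTop.obj Y) :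
    ∃ (n : ℕ) (y : Y _⦋n⦌) (t : stdSimplex ℝ (Fin (n + 1))), real y t = x := by
  let _ : TopologicalSpace (ULift.{u} Prop) := ⊤
  let f : SSet.toTop.obj Y ⟶ TopCat.of (ULift.{u} Prop) :=
    TopCat.ofHom ⟨fun x => ULift.up (∃ (n : ℕ) (y : Y _⦋n⦌) (t : stdSimplex ℝ (Fin (n + 1))),
      real y t = x), continuous_top⟩
  let g : SSet.toTop.obj Y ⟶ TopCat.of (ULift.{u} Prop) :=
    TopCat.ofHom ⟨fun x => ULift.up True, continuous_top⟩
  have h : f = g := toTop_hom_ext fun n y t =>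
    ULift.ext _ _ (propext ⟨fun _ => trivial, fun _ => ⟨n, y, t, rfl⟩⟩)
  have h' : ULift.down (f x) := by rw [h]; trivial
  exact h'

/-- Open subsets are continuous maps to the Sierpiński space `Prop`. -/
lemma isOpen_toTop_iff (U : Set (SSet.toTop.obj Y)) :
    IsOpen U ↔ ∀ n (y : Y _⦋n⦌), IsOpen (real y ⁻¹' U) := by
  refine ⟨fun h n y => h.preimage (real y).continuous, fun h => ?_⟩
  obtain ⟨g, hg⟩ := exists_toTop_desc (Y := Y) (TopCat.of (ULift.{u} Prop))
    (fun n y => ⟨fun t => ULift.up (real y t ∈ U),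
      continuous_uliftUp.comp (continuous_Prop.2 (h n y))⟩)
    (fun n m f y t => by
      show ULift.up (real (Y.map f.op y) t ∈ U) = ULift.up _
      rw [real_map])
  have hU : U = {x | (g x).down} := by
    ext x
    obtain ⟨n, y, t, rfl⟩ := exists_real x
    exact (iff_of_eq (congrArg ULift.down (hg n y t))).symm
  rw [hU]
  exact continuous_Prop.1 (continuous_uliftDown.comp g.hom.continuous)

lemma isClosed_toTop_iff (U : Set (SSet.toTop.obj Y)) :
    IsClosed U ↔ ∀ n (y : Y _⦋n⦌), IsClosed (real y ⁻¹' U) := by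
  simp only [← isOpen_compl_iff, isOpen_toTop_iff, Set.preimage_compl]

end CommClassifying

end

noncomputable section

open Simplicial Opposite AlgebraicTopology

namespace CommClassifying

/-! ### Faces and interior points of the topological simplex. -/

section Faces

lemma map_val {n m : ℕ} (f : Fin (n + 1) → Fin (m + 1)) (t : stdSimplex ℝ (Fin (n + 1)))
    (j : Fin (m + 1)) : (stdSimplex.map f t).1 j = ∑ i with f i = j, t.1 i :=
  FunOnFinite.linearMap_apply_apply ℝ ℝ f t.1 j

lemma map_comp_hom {n m p : ℕ} (f : ⦋n⦌ ⟶ ⦋m⦌) (g : ⦋m⦌ ⟶ ⦋p⦌)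
    (t : stdSimplex ℝ (Fin (n + 1))) :
    stdSimplex.map (f ≫ g) t = stdSimplex.map g (stdSimplex.map f t) :=
  (stdSimplex.map_comp_apply (fun i : Fin (n + 1) => f i) (fun i : Fin (m + 1) => g i) t).symm

lemma map_id_hom {n : ℕ} (t : stdSimplex ℝ (Fin (n + 1))) :
    stdSimplex.map (𝟙 ⦋n⦌ : ⦋n⦌ ⟶ ⦋n⦌) t = t := stdSimplex.map_id_apply t

/-- The points of the open simplex. -/
def Interior {n : ℕ} (t : stdSimplex ℝ (Fin (n + 1))) : Prop := ∀ i, 0 < t.1 i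

lemma map_val_pos_iff {n m : ℕ} (f : Fin (n + 1) → Fin (m + 1)) {t : stdSimplex ℝ (Fin (n + 1))}
    (ht : Interior t) (j : Fin (m + 1)) : 0 < (stdSimplex.map f t).1 j ↔ j ∈ Set.range f := by
  rw [map_val]
  constructor
  · intro h
    obtain ⟨i, hi, -⟩ := Finset.exists_ne_zero_of_sum_ne_zero h.ne'
    exact ⟨i, (Finset.mem_filter.1 hi).2⟩
  · rintro ⟨i, rfl⟩
    exact Finset.sum_pos (fun i _ => ht i) ⟨i, by simp⟩

lemma surjective_of_interior_map {n m : ℕ} {f : Fin (n + 1) → Fin (m + 1)}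
    {t : stdSimplex ℝ (Fin (n + 1))} (h : Interior (stdSimplex.map f t)) :
    Function.Surjective f := by
  intro j
  have h1 := h j
  rw [map_val] at h1
  obtain ⟨i, hi, -⟩ := Finset.exists_ne_zero_of_sum_ne_zero h1.ne'
  exact ⟨i, (Finset.mem_filter.1 hi).2⟩

lemma epi_of_interior_map {n m : ℕ} {f : ⦋n⦌ ⟶ ⦋m⦌}
    {t : stdSimplex ℝ (Fin (n + 1))} (h : Interior (stdSimplex.map f t)) : Epi f :=
  SimplexCategory.epi_iff_surjective.2 (surjective_of_interior_map h)

lemma Interior.map {n m : ℕ} {t : stdSimplex ℝ (Fin (n + 1))} (ht : Interior t)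
    (f : ⦋n⦌ ⟶ ⦋m⦌) [Epi f] : Interior (stdSimplex.map f t) := fun j =>
  (map_val_pos_iff _ ht j).2 (SimplexCategory.epi_iff_surjective.1 ‹_› j)

lemma map_val_injective {n m : ℕ} {f : Fin (n + 1) → Fin (m + 1)} (hf : Function.Injective f)
    (t : stdSimplex ℝ (Fin (n + 1))) (i : Fin (n + 1)) :
    (stdSimplex.map f t).1 (f i) = t.1 i := by
  rw [map_val, Finset.sum_eq_single i]
  · intro b hb hne
    exact absurd (hf (Finset.mem_filter.1 hb).2) hne
  · simp

/-- The face is spanned by the vertices with nonzero coordinate. -/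
lemma exists_face {n : ℕ} (t : stdSimplex ℝ (Fin (n + 1))) :
    ∃ (r : ℕ) (k : ⦋r⦌ ⟶ ⦋n⦌) (t₀ : stdSimplex ℝ (Fin (r + 1))), Mono k ∧ Interior t₀ ∧
      stdSimplex.map k t₀ = t := by
  classical
  let s : Finset (Fin (n + 1)) := Finset.univ.filter fun i => t.1 i ≠ 0
  have hs : s.card ≠ 0 := by
    intro h
    rw [Finset.card_eq_zero] at h
    have h1 := t.2.2
    rw [Finset.sum_eq_zero] at h1
    · exact zero_ne_one h1
    · intro i _
      by_contra hi
      have : i ∈ s := Finset.mem_filter.2 ⟨Finset.mem_univ _, hi⟩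
      simp [h] at this
  obtain ⟨r, hr⟩ := Nat.exists_eq_succ_of_ne_zero hs
  let e := s.orderEmbOfFin hr
  have he : Function.Injective e := e.injective
  have hsum : ∑ i, t.1 (e i) = 1 := by
    rw [← t.2.2, ← Finset.sum_subset (Finset.subset_univ s) (fun i _ hi => by
      by_contra h; exact hi (Finset.mem_filter.2 ⟨Finset.mem_univ _, h⟩)),
      ← Finset.sum_image (f := fun i => t.1 i) (g := e) (s := Finset.univ) he.injOn]
    congr 1
    ext i
    have := Finset.range_orderEmbOfFin s hr
    constructor
    · intro hi
      obtain ⟨j, -, rfl⟩ := Finset.mem_image.1 hi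
      exact Finset.orderEmbOfFin_mem s hr j
    · intro hi
      have : i ∈ Set.range e := by rw [this]; exact hi
      obtain ⟨j, rfl⟩ := this
      exact Finset.mem_image_of_mem _ (Finset.mem_univ _)
  let t₀ : stdSimplex ℝ (Fin (r + 1)) := ⟨fun i => t.1 (e i), fun i => t.2.1 _, hsum⟩
  refine ⟨r, SimplexCategory.mkHom e.toOrderHom, t₀, ?_, ?_, ?_⟩
  · exact SimplexCategory.mono_iff_injective.2 he
  · intro i
    exact lt_of_le_of_ne (t.2.1 _) (Ne.symm (Finset.mem_filter.1 (Finset.orderEmbOfFin_mem s hr i)).2)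
  · refine Subtype.ext (funext fun j => ?_)
    by_cases hj : j ∈ Set.range e
    · obtain ⟨i, rfl⟩ := hj
      exact map_val_injective he t₀ i
    · have h0 : t.1 j = 0 := by
        by_contra h
        exact hj (by rw [Finset.range_orderEmbOfFin s hr]; exact Finset.mem_filter.2 ⟨Finset.mem_univ _, h⟩)
      rw [h0]
      refine (map_val _ _ _).trans (Finset.sum_eq_zero fun i hi => ?_)
      exact absurd ⟨i, (Finset.mem_filter.1 hi).2⟩ hj

lemma map_mono_injective {n m : ℕ} (k : ⦋n⦌ ⟶ ⦋m⦌) [Mono k] {s t : stdSimplex ℝ (Fin (n + 1))}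
    (h : stdSimplex.map k s = stdSimplex.map k t) : s = t := by
  have hk := SimplexCategory.mono_iff_injective.1 ‹Mono k›
  refine Subtype.ext (funext fun i => ?_)
  exact ((map_val_injective hk s i).symm.trans (congrArg (fun x => x.1 (k i)) h)).trans
    (map_val_injective hk t i)

lemma exists_factor {q r n : ℕ} (m : ⦋q⦌ ⟶ ⦋n⦌) (k : ⦋r⦌ ⟶ ⦋n⦌) [Mono k]
    (h : Set.range m ⊆ Set.range k) : ∃ e : ⦋q⦌ ⟶ ⦋r⦌, e ≫ k = m := by
  have hk : StrictMono k := k.toOrderHom.monotone.strictMono_of_injective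
    (SimplexCategory.mono_iff_injective.1 ‹Mono k›)
  choose e he using fun i => h (Set.mem_range_self i)
  refine ⟨SimplexCategory.mkHom ⟨e, fun i j hij => ?_⟩, ?_⟩
  · rw [← hk.le_iff_le, he, he]
    exact m.toOrderHom.monotone hij
  · ext i : 3
    exact he i

end Faces

/-! ### Normal forms of points, and realizations of monomorphisms. -/

section NormalForm

variable {Y Z : SSet.{u}}

lemma map_comp_simplex {a b c : ℕ} (f : ⦋a⦌ ⟶ ⦋b⦌) (g : ⦋b⦌ ⟶ ⦋c⦌) (y : Y _⦋c⦌) :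
    Y.map (f ≫ g).op y = Y.map f.op (Y.map g.op y) := by
  rw [op_comp, Functor.map_comp]; rfl

/-- On the face carrying `t'` in its interior, one simplex of `Y` is presented both as a degeneracy
of `z` and as a degeneracy of the nondegenerate root of the face `k` of `y`. Uniqueness in the
Eilenberg–Zilber lemma identifies the two. -/
lemma exists_epi_of_map_eq {n q d r : ℕ} (y : Y _⦋n⦌) (z : Y _⦋d⦌) (hz : z ∈ Y.nonDegenerate d)
    {s : stdSimplex ℝ (Fin (d + 1))} (hs : Interior s) (m : ⦋q⦌ ⟶ ⦋n⦌) (τ : ⦋q⦌ ⟶ ⦋d⦌)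
    (t' : stdSimplex ℝ (Fin (q + 1))) (h : Y.map m.op y = Y.map τ.op z)
    (ht : stdSimplex.map τ t' = s) (k : ⦋r⦌ ⟶ ⦋n⦌) [Mono k] (t₀ : stdSimplex ℝ (Fin (r + 1)))
    (h₀ : Interior t₀) (hk : stdSimplex.map k t₀ = stdSimplex.map m t') :
    ∃ τ₀ : ⦋r⦌ ⟶ ⦋d⦌, Epi τ₀ ∧ Y.map k.op y = Y.map τ₀.op z ∧ stdSimplex.map τ₀ t₀ = s := by
  obtain ⟨p, a, t'', ha, hi, rfl⟩ := exists_face t'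
  rw [← map_comp_hom] at hk ht
  have hr : Set.range (a ≫ m) = Set.range k := by
    ext j
    rw [← map_val_pos_iff _ hi j, ← map_val_pos_iff _ h₀ j]
    exact (iff_of_eq (congrArg (fun x => 0 < x.1 j) hk)).symm
  obtain ⟨e, he⟩ := exists_factor (a ≫ m) k hr.le
  have he0 : stdSimplex.map e t'' = t₀ := by
    apply map_mono_injective k
    rw [← map_comp_hom, he, hk]
  have hepi : Epi e := epi_of_interior_map (by rw [he0]; exact h₀)
  have hepi' : Epi (a ≫ τ) := epi_of_interior_map (by rw [ht]; exact hs)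
  obtain ⟨d', τ', hτ', w, hw⟩ := Y.exists_nonDegenerate (Y.map k.op y)
  have h1 : Y.map (a ≫ m).op y = Y.map (e ≫ τ').op w := by
    rw [← he, map_comp_simplex, map_comp_simplex, hw]
  have h2 : Y.map (a ≫ m).op y = Y.map (a ≫ τ).op z := by
    rw [map_comp_simplex, map_comp_simplex, h]
  have hd := Y.unique_nonDegenerate_dim _ (e ≫ τ') w h1 (a ≫ τ) ⟨z, hz⟩ h2
  subst hd
  have hwz := Y.unique_nonDegenerate_simplex _ (e ≫ τ') w h1 (a ≫ τ) ⟨z, hz⟩ h2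
  have hm := Y.unique_nonDegenerate_map _ (e ≫ τ') w h1 (a ≫ τ) ⟨z, hz⟩ h2
  refine ⟨τ', hτ', by rw [hw, hwz], ?_⟩
  rw [← he0, ← map_comp_hom, hm, ht]

/-- If a point of `|Y|` lies in the open simplex of the nondegenerate `z`, then its expression in
any other simplex reduces to this one. -/
lemma exists_epi_of_real_eq {n d r : ℕ} {y : Y _⦋n⦌} {z : Y _⦋d⦌} (hz : z ∈ Y.nonDegenerate d)
    {s : stdSimplex ℝ (Fin (d + 1))} (hs : Interior s) (k : ⦋r⦌ ⟶ ⦋n⦌) [Mono k]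
    (t₀ : stdSimplex ℝ (Fin (r + 1))) (h₀ : Interior t₀)
    (h : real y (stdSimplex.map k t₀) = real z s) :
    ∃ τ₀ : ⦋r⦌ ⟶ ⦋d⦌, Epi τ₀ ∧ Y.map k.op y = Y.map τ₀.op z ∧ stdSimplex.map τ₀ t₀ = s := by
  -- Being linked to `(z, s)` through a common simplex is compatible with the simplicial operators,
  -- hence descends to a predicate on `|Y|`. It holds at the point `real z s`, so it holds for every
  -- expression of that point.
  obtain ⟨Q, hQ⟩ := exists_pred (Y := Y) (fun n y t => ∃ (q : ℕ) (m : ⦋q⦌ ⟶ ⦋n⦌) (τ : ⦋q⦌ ⟶ ⦋d⦌)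
    (t' : stdSimplex ℝ (Fin (q + 1))), stdSimplex.map m t' = t ∧ stdSimplex.map τ t' = s ∧
      Y.map m.op y = Y.map τ.op z) (by
    intro n m f y t
    constructor
    · rintro ⟨q, m', τ, t', rfl, h1, h2⟩
      exact ⟨q, m' ≫ f, τ, t', map_comp_hom _ _ _, h1, by rw [map_comp_simplex, h2]⟩
    · rintro ⟨q, m', τ, t', h0, h1, h2⟩
      obtain ⟨p, a, t'', ha, hi, rfl⟩ := exists_face t
      obtain ⟨b, k, x, hk, hx, hb⟩ := exists_face (stdSimplex.map f (stdSimplex.map a t''))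
      obtain ⟨τ₀, -, h3, h4⟩ := exists_epi_of_map_eq y z hz hs m' τ t' h2 h1 k x hx (hb.trans h0.symm)
      rw [← map_comp_hom] at hb
      have hr : Set.range (a ≫ f) ⊆ Set.range k := by
        intro j hj
        rw [← map_val_pos_iff _ hx j]
        rw [← map_val_pos_iff _ hi j] at hj
        exact hj.trans_eq (congrArg (fun x => x.1 j) hb).symm
      obtain ⟨e, he⟩ := exists_factor (a ≫ f) k hr
      have he0 : stdSimplex.map e t'' = x := by
        apply map_mono_injective k
        rw [← map_comp_hom, he, hb]
      refine ⟨p, a, e ≫ τ₀, t'', rfl, by rw [map_comp_hom, he0, h4], ?_⟩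
      rw [← map_comp_simplex, ← he, map_comp_simplex, h3, map_comp_simplex])
  have hq : Q (real z s) := (hQ _ z s).2 ⟨d, 𝟙 _, 𝟙 _, s, map_id_hom s, map_id_hom s, rfl⟩
  rw [← h, hQ] at hq
  obtain ⟨q, m, τ, t', h1, h2, h3⟩ := hq
  exact exists_epi_of_map_eq y z hz hs m τ t' h3 h2 k t₀ h₀ h1.symm

lemma exists_normalForm (x : SSet.toTop.obj Y) : ∃ (d : ℕ) (z : Y _⦋d⦌)
    (s : stdSimplex ℝ (Fin (d + 1))), z ∈ Y.nonDegenerate d ∧ Interior s ∧ real z s = x := by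
  obtain ⟨n, y, t, rfl⟩ := exists_real x
  obtain ⟨r, k, t₀, hk, h₀, rfl⟩ := exists_face t
  obtain ⟨d, τ, hτ, z, hz⟩ := Y.exists_nonDegenerate (Y.map k.op y)
  refine ⟨d, z, stdSimplex.map τ t₀, z.2, h₀.map τ, ?_⟩
  rw [← real_map, ← real_map, hz]

lemma normalForm_unique {d d' : ℕ} {z : Y _⦋d⦌} {z' : Y _⦋d'⦌} (hz : z ∈ Y.nonDegenerate d)
    (hz' : z' ∈ Y.nonDegenerate d') {s : stdSimplex ℝ (Fin (d + 1))}
    {s' : stdSimplex ℝ (Fin (d' + 1))} (hs : Interior s) (hs' : Interior s')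
    (h : real z s = real z' s') : ∃ e : d' = d, e ▸ z' = z := by
  obtain ⟨τ, hτ, h1, h2⟩ := exists_epi_of_real_eq (y := z') hz hs (𝟙 _) s' hs'
    (by rw [map_id_hom, h])
  have h3 : z' = Y.map (𝟙 ⦋d'⦌ : ⦋d'⦌ ⟶ ⦋d'⦌).op z' := by simp
  have e := Y.unique_nonDegenerate_dim _ (𝟙 ⦋d'⦌) ⟨z', hz'⟩ rfl τ ⟨z, hz⟩ h1
  subst e
  exact ⟨rfl, congrArg Subtype.val
    (Y.unique_nonDegenerate_simplex _ (𝟙 ⦋d'⦌) ⟨z', hz'⟩ rfl τ ⟨z, hz⟩ h1)⟩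

/-- A monomorphism preserves nondegenerate simplices, so it carries normal forms to normal forms. -/
lemma toTop_map_injective (i : Y ⟶ Z) [Mono i] : Function.Injective (SSet.toTop.map i) := by
  intro a b hab
  have hi : ∀ n, Function.Injective (i.app (op ⦋n⦌)) := fun n =>
    (mono_iff_injective _).1 inferInstance
  obtain ⟨d, z, s, hz, hs, rfl⟩ := exists_normalForm a
  obtain ⟨n, y, t, rfl⟩ := exists_real b
  rw [toTop_map_real, toTop_map_real] at hab
  obtain ⟨r, k, t₀, hk, h₀, rfl⟩ := exists_face t
  obtain ⟨τ, hτ, h1, h2⟩ := exists_epi_of_real_eq ((SSet.nonDegenerate_iff_of_mono i z).2 hz) hs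
    k t₀ h₀ hab.symm
  have h3 : Y.map k.op y = Y.map τ.op z := by
    apply hi r
    refine (NatTrans.naturality_apply i k.op y).trans (Eq.trans ?_
      (NatTrans.naturality_apply i τ.op z).symm)
    exact h1
  rw [← real_map, h3, real_map, h2]

/-- Closedness is tested on a simplex `b` of `Z`. There the image of `C` is a finite union of
compact sets, indexed by the simplicial operators from dimension at most `n` that carry `b` into
`Y`. -/
lemma toTop_map_isClosedEmbedding (i : Y ⟶ Z) [Mono i] :
    Topology.IsClosedEmbedding (SSet.toTop.map i) := by
  refine .of_continuous_injective_isClosedMap (SSet.toTop.map i).hom.continuous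
    (toTop_map_injective i) fun C hC => ?_
  rw [isClosed_toTop_iff]
  intro n b
  have key : real b ⁻¹' (SSet.toTop.map i '' C) = ⋃ p : Σ r : Fin (n + 1), (⦋(r : ℕ)⦌ ⟶ ⦋n⦌),
      ⋃ (a : {a : Y _⦋(p.1 : ℕ)⦌ // i.app _ a = Z.map p.2.op b}),
        (stdSimplex.map p.2) '' (real a.1 ⁻¹' C) := by
    ext t
    simp only [Set.mem_iUnion, Set.mem_preimage, Set.mem_image]
    constructor
    · rintro ⟨c, hc, hct⟩
      obtain ⟨d, z, s, hz, hs, rfl⟩ := exists_normalForm c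
      rw [toTop_map_real] at hct
      obtain ⟨r, k, t₀, hk, h₀, rfl⟩ := exists_face t
      obtain ⟨τ, hτ, h1, h2⟩ := exists_epi_of_real_eq ((SSet.nonDegenerate_iff_of_mono i z).2 hz) hs
        k t₀ h₀ hct.symm
      have hr : r < n + 1 := Nat.lt_succ_of_le (SimplexCategory.len_le_of_mono k)
      refine ⟨⟨⟨r, hr⟩, k⟩, ⟨Y.map τ.op z, ?_⟩, t₀, ?_, rfl⟩
      · exact (NatTrans.naturality_apply i τ.op z).trans h1.symm
      · rw [real_map, h2]; exact hc
    · rintro ⟨⟨r, k⟩, ⟨a, ha⟩, t', ht', rfl⟩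
      refine ⟨real a t', ht', ?_⟩
      rw [toTop_map_real, ha, real_map]
  rw [key]
  have (r : Fin (n + 1)) : Finite (⦋(r : ℕ)⦌ ⟶ ⦋n⦌) :=
    Finite.of_injective (fun f => (f : Fin ((r : ℕ) + 1) → Fin (n + 1)))
      (fun f g h => by ext i : 3; exact congrFun h i)
  refine isClosed_iUnion_of_finite fun p => ?_
  have : Subsingleton {a : Y _⦋(p.1 : ℕ)⦌ // i.app _ a = Z.map p.2.op b} :=
    ⟨fun a a' => Subtype.ext ((mono_iff_injective (i.app (op ⦋(p.1 : ℕ)⦌))).1 inferInstance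
      (a.2.trans a'.2.symm))⟩
  refine isClosed_iUnion_of_finite fun a => ?_
  exact ((hC.preimage (real a.1).continuous).isCompact.image
    (stdSimplex.continuous_map _)).isClosed

end NormalForm

end CommClassifying

end

/-! ### Compact subsets of a realization. -/

noncomputable section

open Simplicial Opposite AlgebraicTopology

namespace CommClassifying

variable {Y : SSet.{u}}

instance finite_simplexCategory_hom (r n : ℕ) : Finite (⦋r⦌ ⟶ ⦋n⦌) :=
  Finite.of_injective (fun f => (f : Fin (r + 1) → Fin (n + 1)))
    (fun f g h => by ext i : 3; exact congrFun h i)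

/-- Each simplex meets the set in finitely many compact pieces, since each of its faces is a
degeneracy of only one nondegenerate simplex. As `W` is arbitrary, one point chosen in each open
cell gives a closed discrete set. -/
lemma isClosed_image_normalForm {W : Set Y.N}
    (s : ∀ z : Y.N, stdSimplex ℝ (Fin (z.dim + 1))) (hs : ∀ z ∈ W, Interior (s z)) :
    IsClosed ((fun z : Y.N => real z.simplex (s z)) '' W) := by
  rw [isClosed_toTop_iff]
  intro n y
  have key : real y ⁻¹' ((fun z : Y.N => real z.simplex (s z)) '' W) =
      ⋃ p : Σ r : Fin (n + 1), (⦋(r : ℕ)⦌ ⟶ ⦋n⦌),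
      ⋃ z : {z : Y.N // z ∈ W ∧ ∃ τ : ⦋(p.1 : ℕ)⦌ ⟶ ⦋z.dim⦌, Epi τ ∧
        Y.map p.2.op y = Y.map τ.op z.simplex},
      ⋃ τ : {τ : ⦋(p.1 : ℕ)⦌ ⟶ ⦋z.1.dim⦌ // Y.map p.2.op y = Y.map τ.op z.1.simplex},
        (stdSimplex.map p.2) '' ((stdSimplex.map τ.1) ⁻¹' {s z.1}) := by
    ext t
    simp only [Set.mem_iUnion, Set.mem_preimage, Set.mem_image, Set.mem_singleton_iff]
    constructor
    · rintro ⟨z, hz, hzt⟩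
      obtain ⟨r, k, t₀, hk, h₀, rfl⟩ := exists_face t
      obtain ⟨τ, hτ, h1, h2⟩ := exists_epi_of_real_eq z.nonDegenerate (hs z hz) k t₀ h₀ hzt.symm
      have hr : r < n + 1 := Nat.lt_succ_of_le (SimplexCategory.len_le_of_mono k)
      exact ⟨⟨⟨r, hr⟩, k⟩, ⟨z, hz, τ, hτ, h1⟩, ⟨τ, h1⟩, t₀, h2, rfl⟩
    · rintro ⟨⟨r, k⟩, ⟨z, hz, hz'⟩, ⟨τ, hτ⟩, t', ht', rfl⟩
      refine ⟨z, hz, ?_⟩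
      have hτ' : Y.map k.op y = Y.map τ.op z.simplex := hτ
      rw [← real_map, hτ', real_map, ht']
  rw [key]
  refine isClosed_iUnion_of_finite fun p => ?_
  have : Subsingleton {z : Y.N // z ∈ W ∧ ∃ τ : ⦋(p.1 : ℕ)⦌ ⟶ ⦋z.dim⦌, Epi τ ∧
        Y.map p.2.op y = Y.map τ.op z.simplex} := by
    refine ⟨?_⟩
    rintro ⟨z, -, τ, hτ, h⟩ ⟨z', -, τ', hτ', h'⟩
    obtain ⟨d, z, rfl⟩ := z.mk_surjective
    obtain ⟨d', z', rfl⟩ := z'.mk_surjective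
    have e := Y.unique_nonDegenerate_dim _ τ z h τ' z' h'
    subst e
    have := Y.unique_nonDegenerate_simplex _ τ z h τ' z' h'
    subst this
    rfl
  refine isClosed_iUnion_of_finite fun z => ?_
  refine isClosed_iUnion_of_finite fun τ => ?_
  exact ((isClosed_singleton.preimage (stdSimplex.continuous_map _)).isCompact.image
    (stdSimplex.continuous_map _)).isClosed

/-- A compact subset of `|Y|` meets only finitely many open simplices. -/
lemma finite_cells_of_isCompact {K : Set (SSet.toTop.obj Y)} (hK : IsCompact K) :
    (Set.ofPred fun z : Y.N => ∃ s, Interior s ∧ real z.simplex s ∈ K).Finite := by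
  set W := (Set.ofPred fun z : Y.N => ∃ s, Interior s ∧ real z.simplex s ∈ K)
  have hex : ∀ z : Y.N, ∃ s : stdSimplex ℝ (Fin (z.dim + 1)), z ∈ W →
      Interior s ∧ real z.simplex s ∈ K := fun z => by
    by_cases hz : z ∈ W
    · obtain ⟨s, hs⟩ := hz
      exact ⟨s, fun _ => hs⟩
    · exact ⟨stdSimplex.barycenter, fun h => absurd h hz⟩
  choose s hs using hex
  -- The chosen points embed the discrete set `W` as a closed subset, all of which maps into `K`. So
  -- `W` is compact and discrete, hence finite.
  let _ : TopologicalSpace W := ⊥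
  have : DiscreteTopology W := ⟨rfl⟩
  let x : W → SSet.toTop.obj Y := fun z => real z.1.simplex (s z.1)
  have hx : Topology.IsClosedEmbedding x := by
    refine .of_continuous_injective_isClosedMap continuous_of_discreteTopology ?_ ?_
    · rintro ⟨z, hz⟩ ⟨z', hz'⟩ h
      obtain ⟨e, he⟩ := normalForm_unique z.nonDegenerate z'.nonDegenerate (hs z hz).1
        (hs z' hz').1 h
      obtain ⟨d, z, rfl⟩ := z.mk_surjective
      obtain ⟨d', z', rfl⟩ := z'.mk_surjective
      obtain rfl : d' = d := e
      obtain rfl : z' = z := Subtype.ext he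
      rfl
    · intro C _
      have := isClosed_image_normalForm (W := Subtype.val '' C) s (by
        rintro _ ⟨z, -, rfl⟩; exact (hs _ z.2).1)
      rwa [Set.image_image] at this
  have hc := hx.isCompact_preimage hK
  have hu : x ⁻¹' K = Set.univ := Set.eq_univ_of_forall fun z => (hs _ z.2).2
  rw [hu] at hc
  have : CompactSpace W := ⟨hc⟩
  exact finite_of_compact_of_discrete (X := W)

lemma exists_finite_subcomplex {K : Set (SSet.toTop.obj Y)} (hK : IsCompact K) :
    ∃ A : Y.Subcomplex, SSet.Finite (A : SSet.{u}) ∧ K ⊆ Set.range (SSet.toTop.map A.ι) := by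
  have hfin := finite_cells_of_isCompact hK
  set W := (Set.ofPred fun z : Y.N => ∃ s, Interior s ∧ real z.simplex s ∈ K)
  have : Finite W := hfin
  refine ⟨⨆ z : W, z.1.subcomplex, ?_, ?_⟩
  · rw [SSet.finite_iSup_iff]
    intro z
    have h : z.1.subcomplex = SSet.Subcomplex.range (SSet.yonedaEquiv.symm z.1.simplex) := by
      rw [SSet.Subcomplex.range_eq_ofSimplex, Equiv.apply_symm_apply]
    rw [h]
    infer_instance
  · intro x hx
    obtain ⟨d, z, s, hz, hs, rfl⟩ := exists_normalForm x
    have hzW : SSet.N.mk z hz ∈ W := ⟨s, hs, hx⟩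
    have hm : z ∈ (⨆ z : W, z.1.subcomplex).obj (op ⦋d⦌) :=
      (le_iSup (fun z : W => z.1.subcomplex) ⟨_, hzW⟩) _ (SSet.Subcomplex.mem_ofSimplex_obj z)
    refine ⟨real (Y := (⨆ z : W, z.1.subcomplex : Y.Subcomplex)) ⟨z, hm⟩ s, ?_⟩
    exact toTop_map_real (⨆ z : W, z.1.subcomplex : Y.Subcomplex).ι
      (y := (⟨z, hm⟩ : (⨆ z : W, z.1.subcomplex : Y.Subcomplex).obj (op ⦋d⦌))) s

end CommClassifying

end

noncomputable section

open Simplicial Opposite AlgebraicTopology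

namespace CommClassifying

/-! ### Homotopy invariance. -/

section HomotopyInvariance

variable {k : Type} [CommRing k]

lemma qi_iff_chainComplexFunctor {X Y : SSet.{u}} (f : X ⟶ Y) :
    QI k f ↔ QuasiIso (((SSet.chainComplexFunctor (ModuleCat.{u} k)).obj (coeffMod k)).map f) :=
  (quasiIso_iff_of_arrow_mk_iso _ _
    (Arrow.isoMk ((chainsIso k).app X) ((chainsIso k).app Y) ((chainsIso k).hom.naturality f).symm)).symm

lemma qi_iff_isIso {X Y : SSet.{u}} (f : X ⟶ Y) :
    QI k f ↔ ∀ n, IsIso (SSet.homologyMap f (coeffMod.{u} k) n) := by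
  rw [qi_iff_chainComplexFunctor, quasiIso_iff]
  simp only [quasiIsoAt_iff_isIso_homologyMap]

lemma qi_iff_of_homotopy {X Y : SSet.{u}} {f g : X ⟶ Y} (H : SimplicialObject.Homotopy f g) :
    QI k f ↔ QI k g := by
  simp only [qi_iff_isIso, H.congr_sSetHomologyMap]

lemma QI.of_comp_of_comp {X Y : SSet.{u}} {f : X ⟶ Y} {g : Y ⟶ X} (h : QI k (f ≫ g))
    (h' : QI k (g ≫ f)) : QI k f := by
  rw [qi_iff_isIso] at *
  intro n
  have h1 := h n
  have h2 := h' n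
  rw [SSet.homologyMap_comp] at h1 h2
  have : Mono (SSet.homologyMap f (coeffMod.{u} k) n) := mono_of_mono _ (SSet.homologyMap g (coeffMod.{u} k) n)
  have : Epi (SSet.homologyMap f (coeffMod.{u} k) n) := epi_of_epi (SSet.homologyMap g (coeffMod.{u} k) n) _
  exact isIso_of_mono_of_epi _

lemma QI.id (X : SSet.{u}) : QI k (𝟙 X) := QI.of_isIso _

lemma qi_of_homotopyEquiv {X Y : TopCat.{u}} {f : X ⟶ Y} {g : Y ⟶ X}
    (h : TopCat.Homotopy (𝟙 X) (f ≫ g)) (h' : TopCat.Homotopy (𝟙 Y) (g ≫ f)) :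
    QI k (TopCat.toSSet.map f) := by
  refine QI.of_comp_of_comp (g := TopCat.toSSet.map g) ?_ ?_
  · rw [← Functor.map_comp]
    exact (qi_iff_of_homotopy h.toSSet.toSimplicialObjectHomotopy).1 (by rw [CategoryTheory.Functor.map_id]; exact QI.id _)
  · rw [← Functor.map_comp]
    exact (qi_iff_of_homotopy h'.toSSet.toSimplicialObjectHomotopy).1 (by rw [CategoryTheory.Functor.map_id]; exact QI.id _)

end HomotopyInvariance

/-! ### Singular simplices in a subset, and excision. -/

section Excision

variable {X Y : TopCat.{u}}

/-- The singular simplices of `X` contained in `U`. -/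
def singSub (X : TopCat.{u}) (U : Set X) : (TopCat.toSSet.obj X).Subcomplex where
  obj Δ := {σ | ∀ t, X.toSSetObjEquiv Δ σ t ∈ U}
  map f _ hσ t := hσ (stdSimplex.map f.unop t)

lemma mem_singSub {U : Set X} {n : ℕ} (σ : (TopCat.toSSet.obj X) _⦋n⦌) :
    σ ∈ (singSub X U).obj (op ⦋n⦌) ↔ ∀ t, asMap σ t ∈ U := Iff.rfl

lemma singSub_mono {U V : Set X} (h : U ⊆ V) : singSub X U ≤ singSub X V :=
  fun _ _ hσ t => h (hσ t)

/-- The map on small singular simplices induced by a map of pairs. -/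
def mapSub (g : X ⟶ Y) {U : Set X} {V : Set Y} (h : ∀ x ∈ U, g x ∈ V) :
    (singSub X U : SSet.{u}) ⟶ (singSub Y V : SSet.{u}) :=
  SSet.Subcomplex.lift ((singSub X U).ι ≫ TopCat.toSSet.map g) (by
    rintro Δ _ ⟨σ, rfl⟩ t
    exact h _ (σ.2 t))

/-- A map with values in `V` induces a map to the singular simplices in `V`. -/
def toSub (g : X ⟶ Y) {V : Set Y} (h : ∀ x, g x ∈ V) :
    TopCat.toSSet.obj X ⟶ (singSub Y V : SSet.{u}) :=
  SSet.Subcomplex.lift (TopCat.toSSet.map g) (by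
    rintro Δ _ ⟨σ, rfl⟩ t
    exact h _)

lemma isIso_of_bijective {S T : SSet.{u}} (f : S ⟶ T)
    (h : ∀ n, Function.Bijective (f.app (op ⦋n⦌))) : IsIso f := by
  rw [NatTrans.isIso_iff_isIso_app]
  rintro ⟨Δ⟩
  induction Δ using SimplexCategory.rec with | _ n => ?_
  exact (isIso_iff_bijective _).2 (h n)

/-- The hypotheses say that `g` restricts to a homeomorphism from `U` to `V`; openness makes the
pointwise lift of a singular simplex continuous. -/
lemma isIso_mapSub (g : X ⟶ Y) {U : Set X} {V : Set Y} (h : ∀ x ∈ U, g x ∈ V) (hU : IsOpen U)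
    (inj : ∀ x ∈ U, ∀ y ∈ U, g x = g y → x = y) (surj : ∀ y ∈ V, ∃ x ∈ U, g x = y)
    (op : ∀ W ⊆ U, IsOpen W → IsOpen (g '' W)) : IsIso (mapSub g h) := by
  refine isIso_of_bijective _ fun n => ⟨?_, ?_⟩
  · rintro ⟨σ, hσ⟩ ⟨τ, hτ⟩ e
    refine Subtype.ext (asMap.injective (ContinuousMap.ext fun t => ?_))
    exact inj _ (hσ t) _ (hτ t) (congrArg (fun ρ => asMap ρ.1 t) e)
  · rintro ⟨τ, hτ⟩
    choose s hs hg using fun t => surj _ ((mem_singSub τ).1 hτ t)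
    have hc : Continuous s := by
      refine continuous_def.2 fun W hW => ?_
      have : s ⁻¹' W = asMap τ ⁻¹' (g '' (W ∩ U)) := by
        ext t
        constructor
        · intro ht
          exact ⟨s t, ⟨ht, hs t⟩, hg t⟩
        · rintro ⟨x, ⟨hx, hxU⟩, hxt⟩
          have : x = s t := inj x hxU _ (hs t) (hxt.trans (hg t).symm)
          rw [this] at hx
          exact hx
      rw [this]
      exact (op _ Set.inter_subset_right (hW.inter hU)).preimage (asMap τ).continuous
    refine ⟨⟨asMap.symm ⟨s, hc⟩, fun t => hs t⟩, ?_⟩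
    refine Subtype.ext (asMap.injective (ContinuousMap.ext fun t => ?_))
    exact hg t

lemma isIso_toSub (U : Set X) :
    IsIso (toSub (X := TopCat.of U) (TopCat.ofHom ⟨Subtype.val, continuous_subtype_val⟩) (V := U)
      fun x => x.2) := by
  refine isIso_of_bijective _ fun n => ⟨?_, ?_⟩
  · intro σ τ e
    refine asMap.injective (ContinuousMap.ext fun t => ?_)
    exact Subtype.ext (congrArg (fun ρ : (singSub X U : SSet.{u}) _⦋n⦌ => asMap (n := n) ρ.1 t) e)
  · rintro ⟨τ, hτ⟩
    refine ⟨asMap.symm ⟨fun t => ⟨asMap τ t, hτ t⟩, (asMap τ).continuous.subtype_mk _⟩, ?_⟩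
    exact Subtype.ext (asMap.injective (ContinuousMap.ext fun t => rfl))

variable {k : Type} [CommRing k]

/-- The simplices lying in `U` or in `V` form a pushout of simplicial sets, for which excision is
formal. Small simplices then replace this union by all of `X`. -/
lemma relQI_excision {U V : Set X} (hU : IsOpen U) (hV : IsOpen V) (h : U ∪ V = Set.univ) :
    RelQI k (SSet.Subcomplex.homOfLE (singSub_mono (X := X) (Set.inter_subset_right : U ∩ V ⊆ V)))
      (singSub X U).ι
      (SSet.Subcomplex.homOfLE (singSub_mono (X := X) (Set.inter_subset_left : U ∩ V ⊆ U)))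
      (singSub X V).ι := by
  have sq : SSet.Subcomplex.BicartSq (singSub X (U ∩ V)) (singSub X U) (singSub X V)
      (singSub X U ⊔ singSub X V) :=
    { sup_eq := rfl
      inf_eq := by
        apply le_antisymm
        · intro Δ σ hσ t
          exact ⟨hσ.1 t, hσ.2 t⟩
        · intro Δ σ hσ
          exact ⟨fun t => (hσ t).1, fun t => (hσ t).2⟩ }
  have h1 := RelQI.of_isPushout (k := k) sq.isPushout
  have h2 : QI k (singSub X U ⊔ singSub X V).ι := by
    refine qi_small (U := fun b : Bool => cond b U V) ?_ ?_ _ ?_ ?_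
    · rintro (_ | _)
      exacts [hV, hU]
    · intro x
      rcases (h.ge (Set.mem_univ x) : x ∈ U ∪ V) with hx | hx
      exacts [⟨true, hx⟩, ⟨false, hx⟩]
    · intro n
      exact Subtype.val_injective
    · intro n
      ext σ
      constructor
      · rintro ⟨⟨σ, hσ⟩, rfl⟩
        rcases hσ with hσ | hσ
        exacts [⟨true, hσ⟩, ⟨false, hσ⟩]
      · rintro ⟨_ | _, hσ⟩
        exacts [⟨⟨σ, Or.inr hσ⟩, rfl⟩, ⟨⟨σ, Or.inl hσ⟩, rfl⟩]
  have h3 : RelQI k (SSet.Subcomplex.homOfLE (le_sup_left : singSub X U ≤ singSub X U ⊔ singSub X V))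
      (singSub X U).ι (𝟙 _) (singSub X U ⊔ singSub X V).ι :=
    RelQI.of_qi rfl (QI.id _) h2
  exact h1.comp h3

end Excision

end CommClassifying

end

/-! ### Collared subspaces. -/

noncomputable section

open Simplicial Opposite AlgebraicTopology

namespace CommClassifying

/-- A subspace with a neighbourhood `{m < 1/2}` that deforms to it. -/
structure GoodPair {A B : TopCat.{u}} (j : A ⟶ B) where
  emb : Topology.IsEmbedding j
  m : C(B, ℝ)
  m_nonneg : ∀ b, 0 ≤ m b
  m_eq_zero : ∀ b, m b = 0 ↔ b ∈ Set.range j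
  H : C(unitInterval × B, B)
  H_zero : ∀ b, H (0, b) = b
  H_apply : ∀ t a, H (t, j a) = j a
  m_H : ∀ t b, m (H (t, b)) ≤ m b
  H_one : ∀ b, m b < 1 / 2 → H (1, b) ∈ Set.range j

namespace GoodPair

variable {A B : TopCat.{u}} {j : A ⟶ B} (P : GoodPair j)

/-- The neighbourhood of the subspace. -/
def nbhd : Set B := {b | P.m b < 1 / 2}

lemma isOpen_nbhd : IsOpen P.nbhd := isOpen_lt P.m.continuous continuous_const

/-- The complement of the subspace. -/
def compl : Set B := {b | 0 < P.m b}

lemma isOpen_compl : IsOpen P.compl := isOpen_lt continuous_const P.m.continuous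

lemma nbhd_union_compl : P.nbhd ∪ P.compl = Set.univ := by
  refine Set.eq_univ_of_forall fun b => ?_
  rcases (P.m_nonneg b).eq_or_lt with h | h
  · left
    show P.m b < 1 / 2
    rw [← h]; norm_num
  · exact Or.inr h

lemma mem_nbhd (a : A) : j a ∈ P.nbhd := by
  show P.m (j a) < 1 / 2
  rw [(P.m_eq_zero _).2 ⟨a, rfl⟩]; norm_num

variable {k : Type} [CommRing k]

/-- The deformation never increases `m`, so it stays in the neighbourhood and retracts it onto the
subspace. -/
lemma qi_toSub : QI k (toSub j P.mem_nbhd) := by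
  let U : TopCat.{u} := TopCat.of P.nbhd
  let f : A ⟶ U := TopCat.ofHom ⟨fun a => ⟨j a, P.mem_nbhd a⟩, j.hom.continuous.subtype_mk _⟩
  have hex : ∀ b : P.nbhd, ∃ a, j a = P.H (1, b.1) := fun b => P.H_one b.1 b.2
  choose r hr using hex
  have hrc : Continuous r := by
    rw [P.emb.continuous_iff]
    have : (j ∘ r) = fun b : P.nbhd => P.H (1, b.1) := funext hr
    rw [this]
    fun_prop
  let g : U ⟶ A := TopCat.ofHom ⟨r, hrc⟩
  have hfg : f ≫ g = 𝟙 A := by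
    ext a
    refine P.emb.injective ((hr _).trans ?_)
    exact P.H_apply 1 a
  have h1 : TopCat.Homotopy (𝟙 A) (f ≫ g) := by rw [hfg]; exact ContinuousMap.Homotopy.refl _
  have hmem : ∀ (t : unitInterval) (b : P.nbhd), P.H (t, b.1) ∈ P.nbhd := fun t b =>
    lt_of_le_of_lt (P.m_H t b.1) b.2
  have h2 : TopCat.Homotopy (𝟙 U) (g ≫ f) :=
    { toFun := fun p : unitInterval × P.nbhd => ⟨P.H (p.1, p.2.1), hmem p.1 p.2⟩
      continuous_toFun := by
        refine Continuous.subtype_mk ?_ _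
        exact P.H.continuous.comp
          (continuous_fst.prodMk (continuous_subtype_val.comp continuous_snd))
      map_zero_left := fun b => Subtype.ext (P.H_zero b.1)
      map_one_left := fun b => Subtype.ext (hr b).symm }
  have h3 : QI k (TopCat.toSSet.map f) := qi_of_homotopyEquiv h1 h2
  have h4 := isIso_toSub P.nbhd
  have h5 := h3.comp (QI.of_isIso (k := k) (toSub (X := TopCat.of P.nbhd)
    (TopCat.ofHom ⟨Subtype.val, continuous_subtype_val⟩) (V := P.nbhd) fun x => x.2))
  exact h5

lemma mono (P : GoodPair j) : Mono (TopCat.toSSet.map j) := by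
  have : Mono j := (TopCat.mono_iff_injective j).2 P.emb.injective
  infer_instance

lemma relQI_nbhd : RelQI k (TopCat.toSSet.map j) (singSub B P.nbhd).ι (toSub j P.mem_nbhd) (𝟙 _) :=
  have := P.mono
  RelQI.of_qi (by rw [Category.comp_id]; rfl) P.qi_toSub (QI.id _)

end GoodPair

/-! ### Attaching along a collared subspace. -/

section Pushout

variable {S A D B : TopCat.{u}} {f : S ⟶ A} {j : S ⟶ D} {j' : A ⟶ B} {g : D ⟶ B}

lemma exists_of_topPushout (sq : IsPushout f j j' g) (b : B) :
    (∃ a, j' a = b) ∨ ∃ d, g d = b := by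
  let _ : TopologicalSpace (ULift.{u} Prop) := ⊤
  let p : B ⟶ TopCat.of (ULift.{u} Prop) :=
    TopCat.ofHom ⟨fun b => ULift.up ((∃ a, j' a = b) ∨ ∃ d, g d = b), continuous_top⟩
  let q : B ⟶ TopCat.of (ULift.{u} Prop) :=
    TopCat.ofHom ⟨fun _ => ULift.up True, continuous_top⟩
  have h : p = q := sq.hom_ext
    (ConcreteCategory.hom_ext _ _ fun a => ULift.ext _ _ (propext ⟨fun _ => trivial, fun _ => Or.inl ⟨a, rfl⟩⟩))
    (ConcreteCategory.hom_ext _ _ fun a => ULift.ext _ _ (propext ⟨fun _ => trivial, fun _ => Or.inr ⟨a, rfl⟩⟩))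
  have h' : ULift.down (p b) := by rw [h]; trivial
  exact h'

/-- The indicator of `d` vanishes on the attaching subspace, so it glues with `False` on `A` to a
predicate on `B` that separates `d` from every other point. -/
lemma injective_of_topPushout (sq : IsPushout f j j' g) {d d' : D} (hd : d ∉ Set.range j)
    (h : g d' = g d) : d' = d := by
  let _ : TopologicalSpace (ULift.{u} Prop) := ⊤
  let p : A ⟶ TopCat.of (ULift.{u} Prop) := TopCat.ofHom ⟨fun _ => ULift.up False, continuous_top⟩
  let q : D ⟶ TopCat.of (ULift.{u} Prop) :=
    TopCat.ofHom ⟨fun x => ULift.up (x = d), continuous_top⟩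
  have w : f ≫ p = j ≫ q := by
    refine ConcreteCategory.hom_ext _ _ fun s => ?_
    exact ULift.ext _ _ (propext ⟨False.elim, fun h => hd ⟨s, h⟩⟩)
  have h1 : ∀ x, sq.desc p q w (g x) = q x := fun x =>
    ConcreteCategory.congr_hom (sq.inr_desc p q w) x
  have h2 : q d' = q d := by rw [← h1, ← h1, h]
  have h3 : (d' = d) = (d = d) := congrArg ULift.down h2
  rw [h3]

lemma isOpen_of_topPushout (sq : IsPushout f j j' g) {U : Set B} (h1 : IsOpen (j' ⁻¹' U))
    (h2 : IsOpen (g ⁻¹' U)) : IsOpen U := by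
  let p : A ⟶ TopCat.of (ULift.{u} Prop) :=
    TopCat.ofHom ⟨fun x => ULift.up (j' x ∈ U), continuous_uliftUp.comp (continuous_Prop.2 h1)⟩
  let q : D ⟶ TopCat.of (ULift.{u} Prop) :=
    TopCat.ofHom ⟨fun x => ULift.up (g x ∈ U), continuous_uliftUp.comp (continuous_Prop.2 h2)⟩
  have w : f ≫ p = j ≫ q := by
    refine ConcreteCategory.hom_ext _ _ fun s => ?_
    exact congrArg (fun x => ULift.up (x ∈ U)) (ConcreteCategory.congr_hom sq.w s)
  have hU : U = {x | (sq.desc p q w x).down} := by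
    ext x
    rcases exists_of_topPushout sq x with ⟨a, rfl⟩ | ⟨a, rfl⟩
    · exact iff_of_eq (congrArg ULift.down (ConcreteCategory.congr_hom (sq.inl_desc p q w) a)).symm
    · exact iff_of_eq (congrArg ULift.down (ConcreteCategory.congr_hom (sq.inr_desc p q w) a)).symm
  rw [hU]
  exact continuous_Prop.1 (continuous_uliftDown.comp (sq.desc p q w).hom.continuous)

/-- A good pair structure is inherited by pushouts. -/
lemma GoodPair.exists_pushout (P : GoodPair j) (sq : IsPushout f j j' g)
    (hj' : Topology.IsEmbedding j') : ∃ P' : GoodPair j', ∀ d, P'.m (g d) = P.m d := by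
  have hw : ∀ s, j' (f s) = g (j s) := fun s => ConcreteCategory.congr_hom sq.w s
  obtain ⟨m, hmA, hmD⟩ : ∃ m : C(B, ℝ), (∀ a, m (j' a) = 0) ∧ ∀ d, m (g d) = P.m d := by
    let p : A ⟶ TopCat.of (ULift.{u} ℝ) := TopCat.ofHom ⟨fun _ => ULift.up 0, continuous_const⟩
    let q : D ⟶ TopCat.of (ULift.{u} ℝ) := TopCat.ofHom ⟨fun x => ULift.up (P.m x),
      continuous_uliftUp.comp P.m.continuous⟩
    have w : f ≫ p = j ≫ q := by
      refine ConcreteCategory.hom_ext _ _ fun s => ?_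
      exact ULift.ext _ _ ((P.m_eq_zero _).2 ⟨s, rfl⟩).symm
    refine ⟨⟨fun b => (sq.desc p q w b).down,
      continuous_uliftDown.comp (sq.desc p q w).hom.continuous⟩, fun a => ?_, fun d => ?_⟩
    · exact congrArg ULift.down (ConcreteCategory.congr_hom (sq.inl_desc p q w) a)
    · exact congrArg ULift.down (ConcreteCategory.congr_hom (sq.inr_desc p q w) d)
  obtain ⟨H, hHA, hHD⟩ : ∃ H : C(unitInterval × B, B), (∀ t a, H (t, j' a) = j' a) ∧
      ∀ t d, H (t, g d) = g (P.H (t, d)) := by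
    -- A homotopy is glued as a map to the path space, which avoids showing that the product with
    -- the interval preserves the pushout.
    let p : A ⟶ TopCat.of C(unitInterval, B) := TopCat.ofHom
      (ContinuousMap.curry ⟨fun x : A × unitInterval => j' x.1, by fun_prop⟩)
    let q : D ⟶ TopCat.of C(unitInterval, B) := TopCat.ofHom
      (ContinuousMap.curry ⟨fun x : D × unitInterval => g (P.H (x.2, x.1)), by fun_prop⟩)
    have w : f ≫ p = j ≫ q := by
      refine ConcreteCategory.hom_ext _ _ fun s => ?_
      refine ContinuousMap.ext fun t => ?_
      exact (hw s).trans (congrArg g (P.H_apply t s)).symm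
    refine ⟨⟨fun x => (sq.desc p q w x.2 : C(unitInterval, B)) x.1, ?_⟩, fun t a => ?_, fun t d => ?_⟩
    · have : Continuous fun x : unitInterval × B => ((sq.desc p q w).hom x.2, x.1) := by fun_prop
      exact ContinuousEval.continuous_eval.comp this
    · exact congrArg (fun c : C(unitInterval, B) => c t)
        (ConcreteCategory.congr_hom (sq.inl_desc p q w) a)
    · exact congrArg (fun c : C(unitInterval, B) => c t)
        (ConcreteCategory.congr_hom (sq.inr_desc p q w) d)
  refine ⟨{ emb := hj', m := m, m_nonneg := ?_, m_eq_zero := ?_, H := H, H_zero := ?_,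
            H_apply := hHA, m_H := ?_, H_one := ?_ }, hmD⟩
  · intro b
    rcases exists_of_topPushout sq b with ⟨a, rfl⟩ | ⟨d, rfl⟩
    · rw [hmA]
    · rw [hmD]; exact P.m_nonneg d
  · intro b
    constructor
    · intro h
      rcases exists_of_topPushout sq b with ⟨a, rfl⟩ | ⟨d, rfl⟩
      · exact ⟨a, rfl⟩
      · rw [hmD, P.m_eq_zero] at h
        obtain ⟨s, rfl⟩ := h
        exact ⟨f s, hw s⟩
    · rintro ⟨a, rfl⟩
      exact hmA a
  · intro b
    rcases exists_of_topPushout sq b with ⟨a, rfl⟩ | ⟨d, rfl⟩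
    · exact hHA 0 a
    · rw [hHD, P.H_zero]
  · intro t b
    rcases exists_of_topPushout sq b with ⟨a, rfl⟩ | ⟨d, rfl⟩
    · rw [hHA]
    · rw [hHD, hmD, hmD]; exact P.m_H t d
  · intro b hb
    rcases exists_of_topPushout sq b with ⟨a, rfl⟩ | ⟨d, rfl⟩
    · exact ⟨a, (hHA 1 a).symm⟩
    · rw [hmD] at hb
      obtain ⟨s, hs⟩ := P.H_one d hb
      exact ⟨f s, by rw [hw, hs, hHD]⟩

variable {k : Type} [CommRing k]

/-- A pushout of a good pair induces an isomorphism on relative homology. -/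
theorem relQI_of_topPushout (P : GoodPair j) (sq : IsPushout f j j' g)
    (hj' : Topology.IsEmbedding j') :
    RelQI k (TopCat.toSSet.map j) (TopCat.toSSet.map j') (TopCat.toSSet.map f)
      (TopCat.toSSet.map g) := by
  obtain ⟨P', hP'⟩ := P.exists_pushout sq hj'
  have hU : ∀ d ∈ P.nbhd, g d ∈ P'.nbhd := fun d hd => (hP' d).trans_lt hd
  have hV : ∀ d ∈ P.compl, g d ∈ P'.compl := fun d hd =>
    lt_of_lt_of_eq (show 0 < P.m d from hd) (hP' d).symm
  have hUV : ∀ d ∈ P.nbhd ∩ P.compl, g d ∈ P'.nbhd ∩ P'.compl := fun d hd =>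
    ⟨hU d hd.1, hV d hd.2⟩
  have hr : ∀ d ∈ P.compl, d ∉ Set.range j := fun d hd h =>
    (show 0 < P.m d from hd).ne' ((P.m_eq_zero d).2 h)
  have inj : ∀ d ∈ P.compl, ∀ d' ∈ P.compl, g d = g d' → d = d' := fun d _ d' hd' h =>
    injective_of_topPushout sq (hr d' hd') h
  have surj : ∀ b ∈ P'.compl, ∃ d ∈ P.compl, g d = b := by
    intro b hb
    have hb' : 0 < P'.m b := hb
    rcases exists_of_topPushout sq b with ⟨a, rfl⟩ | ⟨d, rfl⟩
    · rw [(P'.m_eq_zero _).2 ⟨a, rfl⟩] at hb'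
      exact absurd hb' (lt_irrefl 0)
    · exact ⟨d, lt_of_lt_of_eq hb' (hP' d), rfl⟩
  have opn : ∀ W ⊆ P.compl, IsOpen W → IsOpen (g '' W) := by
    intro W hW hWo
    refine isOpen_of_topPushout sq ?_ ?_
    · convert isOpen_empty
      refine Set.eq_empty_of_forall_notMem ?_
      rintro a ⟨d, hd, hda⟩
      have h1 := hV d (hW hd)
      have h2 : 0 < P'.m (g d) := h1
      rw [(P'.m_eq_zero _).2 ⟨a, hda.symm⟩] at h2
      exact lt_irrefl 0 h2
    · convert hWo
      ext d
      constructor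
      · rintro ⟨d', hd', h⟩
        rw [injective_of_topPushout sq (hr d' (hW hd')) h.symm]
        exact hd'
      · intro hd
        exact ⟨d, hd, rfl⟩
  have i1 : IsIso (mapSub g hV) := isIso_mapSub g hV P.isOpen_compl inj surj opn
  have i2 : IsIso (mapSub g hUV) := by
    refine isIso_mapSub g hUV (P.isOpen_nbhd.inter P.isOpen_compl)
      (fun x hx y hy => inj x hx.2 y hy.2) ?_
      (fun W hW => opn W (hW.trans Set.inter_subset_right))
    rintro b ⟨hb, hb'⟩
    obtain ⟨d, hd, rfl⟩ := surj b hb'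
    exact ⟨d, ⟨lt_of_eq_of_lt (hP' d).symm hb, hd⟩, rfl⟩
  -- Excision moves both pairs off the subspaces, where `g` is a homeomorphism. The collars then
  -- replace the neighbourhoods by the subspaces themselves.
  have e1 := relQI_excision (k := k) P.isOpen_nbhd P.isOpen_compl P.nbhd_union_compl
  have e2 := relQI_excision (k := k) P'.isOpen_nbhd P'.isOpen_compl P'.nbhd_union_compl
  have e3 : RelQI k
      (SSet.Subcomplex.homOfLE (singSub_mono (Set.inter_subset_right : P.nbhd ∩ P.compl ⊆ _)))
      (SSet.Subcomplex.homOfLE (singSub_mono (Set.inter_subset_right : P'.nbhd ∩ P'.compl ⊆ _)))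
      (mapSub g hUV) (mapSub g hV) :=
    RelQI.of_qi rfl (QI.of_isIso _) (QI.of_isIso _)
  have e4 : RelQI k (singSub D P.nbhd).ι (singSub B P'.nbhd).ι (mapSub g hU)
      (TopCat.toSSet.map g) :=
    RelQI.of_comp_left e1 rfl (e3.comp e2)
  have e5 := P.relQI_nbhd (k := k)
  have e6 := P'.relQI_nbhd (k := k)
  refine RelQI.of_comp_right ?_ e6 ?_
  · rw [← Functor.map_comp, ← Functor.map_comp, sq.w]
  · have h := e5.comp e4
    have h1 : toSub j P.mem_nbhd ≫ mapSub g hU = TopCat.toSSet.map f ≫ toSub j' P'.mem_nbhd := by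
      have h2 : TopCat.toSSet.map j ≫ TopCat.toSSet.map g =
          TopCat.toSSet.map f ≫ TopCat.toSSet.map j' := by
        rw [← Functor.map_comp, ← Functor.map_comp, sq.w]
      rw [← cancel_mono (singSub B P'.nbhd).ι]
      exact h2
    rw [h1, Category.id_comp] at h
    rw [Category.comp_id]
    exact h

end Pushout

end CommClassifying

end

noncomputable section

open Simplicial Opposite AlgebraicTopology

namespace CommClassifying

/-! ### The realized simplex and a collar of its boundary. -/

section Simplex

variable (d : ℕ)

/-- The tautological simplex of `Δ[d]`. -/
def tautSimplex : (Δ[d] : SSet.{u}) _⦋d⦌ := SSet.stdSimplex.objEquiv.symm (𝟙 _)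

lemma map_tautSimplex {n : ℕ} (f : ⦋n⦌ ⟶ ⦋d⦌) :
    (Δ[d] : SSet.{u}).map f.op (tautSimplex d) = SSet.stdSimplex.objEquiv.symm f :=
  congrArg SSet.stdSimplex.objEquiv.symm (Category.comp_id f)

lemma exists_coords : ∃ φ : C(SSet.toTop.obj (Δ[d] : SSet.{u}), stdSimplex ℝ (Fin (d + 1))),
    (∀ n (y : (Δ[d] : SSet.{u}) _⦋n⦌) t, φ (real y t) =
      stdSimplex.map (SSet.stdSimplex.objEquiv y) t) ∧
    (∀ x, real (tautSimplex d) (φ x) = x) ∧ (∀ t, φ (real (tautSimplex d) t) = t) := by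
  obtain ⟨g, hg⟩ := exists_toTop_desc (Y := (Δ[d] : SSet.{u}))
    (TopCat.of (ULift.{u} (stdSimplex ℝ (Fin (d + 1)))))
    (fun n y => ⟨fun t => ULift.up (stdSimplex.map (SSet.stdSimplex.objEquiv y) t),
      continuous_uliftUp.comp (stdSimplex.continuous_map _)⟩) (fun n m f y t => by
        refine congrArg ULift.up ?_
        exact map_comp_hom f (SSet.stdSimplex.objEquiv y) t)
  have h1 : ∀ n (y : (Δ[d] : SSet.{u}) _⦋n⦌) t, (g (real y t)).down =
      stdSimplex.map (SSet.stdSimplex.objEquiv y) t := fun n y t => congrArg ULift.down (hg n y t)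
  refine ⟨⟨fun x => (g x).down, continuous_uliftDown.comp g.hom.continuous⟩, h1, ?_, ?_⟩
  · intro x
    obtain ⟨n, y, t, rfl⟩ := exists_real x
    refine (congrArg _ (h1 n y t)).trans ?_
    rw [← real_map, map_tautSimplex, Equiv.symm_apply_apply]
  · intro t
    exact (h1 _ _ t).trans (map_id_hom t)

/-- Barycentric coordinates on `|Δ[d]|`. -/
def coords : C(SSet.toTop.obj (Δ[d] : SSet.{u}), stdSimplex ℝ (Fin (d + 1))) :=
  (exists_coords d).choose

lemma coords_real {n : ℕ} (y : (Δ[d] : SSet.{u}) _⦋n⦌) (t) : coords d (real y t) =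
      stdSimplex.map (SSet.stdSimplex.objEquiv y) t := (exists_coords d).choose_spec.1 n y t

lemma real_coords (x : SSet.toTop.obj (Δ[d] : SSet.{u})) :
    real (tautSimplex d) (coords d x) = x := (exists_coords d).choose_spec.2.1 x

lemma coords_taut (t) : coords.{u} d (real (tautSimplex d) t) = t :=
  (exists_coords d).choose_spec.2.2 t

variable {d}

/-- The point dividing a segment in the simplex. -/
def mix (s : unitInterval) (t t' : stdSimplex ℝ (Fin (d + 1))) : stdSimplex ℝ (Fin (d + 1)) :=
  ⟨(1 - (s : ℝ)) • t.1 + (s : ℝ) • t'.1,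
    convex_stdSimplex ℝ _ t.2 t'.2 (sub_nonneg.2 s.2.2) s.2.1 (by ring)⟩

lemma mix_val (s : unitInterval) (t t' : stdSimplex ℝ (Fin (d + 1))) (i : Fin (d + 1)) :
    (mix s t t').1 i = (1 - (s : ℝ)) * t.1 i + (s : ℝ) * t'.1 i := rfl

lemma mix_zero (t t' : stdSimplex ℝ (Fin (d + 1))) : mix 0 t t' = t :=
  Subtype.ext (funext fun i => by rw [mix_val]; simp)

lemma mix_one (t t' : stdSimplex ℝ (Fin (d + 1))) : mix 1 t t' = t' :=
  Subtype.ext (funext fun i => by rw [mix_val]; simp)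

lemma mix_self (s : unitInterval) (t : stdSimplex ℝ (Fin (d + 1))) : mix s t t = t :=
  Subtype.ext (funext fun i => by rw [mix_val]; ring)

lemma continuous_mix {X : Type*} [TopologicalSpace X] {s : X → unitInterval}
    {t t' : X → stdSimplex ℝ (Fin (d + 1))} (hs : Continuous s) (ht : Continuous t)
    (ht' : Continuous t') : Continuous fun x => mix (s x) (t x) (t' x) := by
  refine Continuous.subtype_mk ?_ _
  have h1 : Continuous fun x => (t x).1 := continuous_subtype_val.comp ht
  have h2 : Continuous fun x => (t' x).1 := continuous_subtype_val.comp ht'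
  have h3 : Continuous fun x => (s x : ℝ) := continuous_subtype_val.comp hs
  exact ((continuous_const.sub h3).smul h1).add (h3.smul h2)

/-- Maps into `|Δ[d]|` are homotopic. -/
def simplexHomotopy {X : TopCat.{u}} (f g : X ⟶ SSet.toTop.obj (Δ[d] : SSet.{u})) :
    TopCat.Homotopy f g where
  toFun p := real (tautSimplex d) (mix p.1 (coords d (f p.2)) (coords d (g p.2)))
  continuous_toFun := (real (tautSimplex d)).continuous.comp
    (continuous_mix continuous_fst
      ((coords d).continuous.comp (f.hom.continuous.comp continuous_snd))
      ((coords d).continuous.comp (g.hom.continuous.comp continuous_snd)))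
  map_zero_left x := by
    show real (tautSimplex d) (mix 0 (coords d (f x)) (coords d (g x))) = f x
    rw [mix_zero, real_coords]
  map_one_left x := by
    show real (tautSimplex d) (mix 1 (coords d (f x)) (coords d (g x))) = g x
    rw [mix_one, real_coords]

/-- The least barycentric coordinate. -/
def minCoord (t : stdSimplex ℝ (Fin (d + 1))) : ℝ :=
  Finset.univ.inf' Finset.univ_nonempty fun i => t.1 i

lemma minCoord_le (t : stdSimplex ℝ (Fin (d + 1))) (i) : minCoord t ≤ t.1 i :=
  Finset.inf'_le _ (Finset.mem_univ i)

lemma exists_minCoord (t : stdSimplex ℝ (Fin (d + 1))) : ∃ i, minCoord t = t.1 i := by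
  obtain ⟨i, -, hi⟩ := Finset.exists_mem_eq_inf' Finset.univ_nonempty (fun i => t.1 i)
  exact ⟨i, hi⟩

lemma minCoord_nonneg (t : stdSimplex ℝ (Fin (d + 1))) : 0 ≤ minCoord t := by
  obtain ⟨i, hi⟩ := exists_minCoord t
  rw [hi]; exact t.2.1 i

lemma continuous_minCoord : Continuous (minCoord (d := d)) := by
  unfold minCoord
  refine Continuous.finset_inf'_apply Finset.univ_nonempty fun i _ => ?_
  exact (continuous_apply i).comp continuous_subtype_val

/-- The normalized distance to the boundary. -/
def depth (t : stdSimplex ℝ (Fin (d + 1))) : ℝ := (d + 1) * minCoord t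

lemma continuous_depth : Continuous (depth (d := d)) := continuous_const.mul continuous_minCoord

lemma depth_nonneg (t : stdSimplex ℝ (Fin (d + 1))) : 0 ≤ depth t :=
  mul_nonneg (by positivity) (minCoord_nonneg t)

lemma depth_le_one (t : stdSimplex ℝ (Fin (d + 1))) : depth t ≤ 1 := by
  have h := Finset.card_nsmul_le_sum Finset.univ (fun i => t.1 i) (minCoord t)
    (fun i _ => minCoord_le t i)
  have h1 : ∑ i, t.1 i = 1 := t.2.2
  rw [h1] at h
  simpa [depth] using h

lemma depth_eq_zero_iff (t : stdSimplex ℝ (Fin (d + 1))) : depth t = 0 ↔ ∃ i, t.1 i = 0 := by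
  have : (d + 1 : ℝ) ≠ 0 := by positivity
  rw [depth, mul_eq_zero, or_iff_right this]
  constructor
  · intro h
    obtain ⟨i, hi⟩ := exists_minCoord t
    exact ⟨i, by rw [← hi, h]⟩
  · rintro ⟨i, hi⟩
    exact le_antisymm (hi ▸ minCoord_le t i) (minCoord_nonneg t)

/-- Stretching the simplex so that a collar goes to the boundary. -/
def stretch (t : stdSimplex ℝ (Fin (d + 1))) : stdSimplex ℝ (Fin (d + 1)) :=
  -- A point is `depth t` times the barycentre plus a remainder of mass `1 - depth t` with a
  -- vanishing coordinate. The barycentric weight becomes `max 0 (2 * depth t - 1)`, and the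
  -- denominator rescales the remainder so that the total mass is again `1`.
  ⟨fun i => max 0 (2 * depth t - 1) / (d + 1) + (t.1 i - minCoord t) / max (1 - depth t) (1 / 2), by
    refine ⟨fun i => ?_, ?_⟩
    · have h1 : 0 ≤ t.1 i - minCoord t := sub_nonneg.2 (minCoord_le t i)
      have h2 : 0 < max (1 - depth t) (1 / 2) := lt_max_of_lt_right (by norm_num)
      positivity
    · have h1 : ∑ i, t.1 i = 1 := t.2.2
      rw [Finset.sum_add_distrib, ← Finset.sum_div, ← Finset.sum_div, Finset.sum_sub_distrib, h1]
      simp only [Finset.sum_const, Finset.card_univ, Fintype.card_fin, nsmul_eq_mul, Nat.cast_add,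
        Nat.cast_one]
      have h3 : (d + 1 : ℝ) ≠ 0 := by positivity
      rw [mul_div_assoc, ← mul_div_assoc, mul_div_cancel_left₀ _ h3]
      change max 0 (2 * depth t - 1) + (1 - depth t) / max (1 - depth t) (1 / 2) = 1
      rcases le_total (depth t) (1 / 2) with h | h
      · rw [max_eq_left (by linarith), max_eq_left (by linarith), div_self (by linarith), zero_add]
      · rw [max_eq_right (by linarith), max_eq_right (by linarith)]
        ring⟩

lemma stretch_val (t : stdSimplex ℝ (Fin (d + 1))) (i) : (stretch t).1 i =
    max 0 (2 * depth t - 1) / (d + 1) + (t.1 i - minCoord t) / max (1 - depth t) (1 / 2) := rfl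

lemma continuous_stretch : Continuous (stretch (d := d)) := by
  refine Continuous.subtype_mk (continuous_pi fun i => ?_) _
  refine ((continuous_const.max ((continuous_const.mul continuous_depth).sub
    continuous_const)).div_const _).add (Continuous.div ?_ ?_ fun t => ?_)
  · exact ((continuous_apply i).comp continuous_subtype_val).sub continuous_minCoord
  · exact (continuous_const.sub continuous_depth).max continuous_const
  · exact (lt_max_of_lt_right (by norm_num)).ne'

lemma stretch_eq_self {t : stdSimplex ℝ (Fin (d + 1))} (h : depth t = 0) : stretch t = t := by
  refine Subtype.ext (funext fun i => ?_)
  have h1 : minCoord t = 0 := by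
    have : (d + 1 : ℝ) ≠ 0 := by positivity
    rwa [depth, mul_eq_zero, or_iff_right this] at h
  rw [stretch_val, h, h1]
  norm_num

lemma depth_mix_stretch_le (s : unitInterval) (t : stdSimplex ℝ (Fin (d + 1))) :
    depth (mix s t (stretch t)) ≤ depth t := by
  obtain ⟨i, hi⟩ := exists_minCoord t
  have h1 : minCoord (mix s t (stretch t)) ≤ minCoord t := by
    refine (minCoord_le _ i).trans ?_
    rw [mix_val, stretch_val, ← hi, sub_self, zero_div, add_zero]
    have h2 : max 0 (2 * depth t - 1) / (d + 1) ≤ minCoord t := by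
      rw [div_le_iff₀ (by positivity)]
      have h4 := depth_nonneg t
      have h5 := depth_le_one t
      have h6 : minCoord t * (d + 1) = depth t := mul_comm _ _
      rw [h6]
      exact max_le h4 (by linarith)
    have h3 := mul_le_mul_of_nonneg_left h2 s.2.1
    linarith
  exact mul_le_mul_of_nonneg_left h1 (by positivity)

lemma depth_stretch {t : stdSimplex ℝ (Fin (d + 1))} (h : depth t < 1 / 2) :
    depth (stretch t) = 0 := by
  obtain ⟨i, hi⟩ := exists_minCoord t
  rw [depth_eq_zero_iff]
  refine ⟨i, ?_⟩
  rw [stretch_val, ← hi, sub_self, zero_div, add_zero, max_eq_left (by linarith), zero_div]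

lemma mem_range_boundary_iff (x : SSet.toTop.obj (Δ[d] : SSet.{u})) :
    x ∈ Set.range (SSet.toTop.map (SSet.boundary.{u} d).ι) ↔ depth (coords d x) = 0 := by
  rw [depth_eq_zero_iff]
  constructor
  · rintro ⟨x, rfl⟩
    obtain ⟨n, ⟨y, hy⟩, t, rfl⟩ := exists_real x
    obtain ⟨i, hi⟩ := (SSet.mem_boundary_iff_notMem_range y).1 hy
    refine ⟨i, ?_⟩
    have h1 := (congrArg (coords d) (toTop_map_real (SSet.boundary.{u} d).ι
      (y := (⟨y, hy⟩ : (SSet.boundary.{u} d).obj (op ⦋n⦌))) t)).trans (coords_real d y t)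
    refine (congrArg (fun s => s.1 i) h1).trans ?_
    refine (map_val _ t i).trans (Finset.sum_eq_zero fun j hj => ?_)
    exact absurd ⟨j, (Finset.mem_filter.1 hj).2⟩ hi
  · rintro ⟨i, hi⟩
    obtain ⟨r, k, t₀, hk, h₀, ht⟩ := exists_face (coords d x)
    have hm : (SSet.stdSimplex.objEquiv.symm k : (Δ[d] : SSet.{u}) _⦋r⦌) ∈
        (SSet.boundary.{u} d).obj (op ⦋r⦌) := by
      rw [SSet.mem_boundary_iff_notMem_range]
      refine ⟨i, fun h => ?_⟩
      have h1 := (map_val_pos_iff k h₀ i).2 h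
      rw [ht, hi] at h1
      exact lt_irrefl _ h1
    refine ⟨real (Y := (SSet.boundary.{u} d : SSet.{u})) ⟨_, hm⟩ t₀, ?_⟩
    refine (toTop_map_real (SSet.boundary.{u} d).ι
      (y := (⟨_, hm⟩ : (SSet.boundary.{u} d).obj (op ⦋r⦌))) t₀).trans ?_
    show real (SSet.stdSimplex.objEquiv.symm k : (Δ[d] : SSet.{u}) _⦋r⦌) t₀ = x
    rw [← map_tautSimplex, real_map, ht, real_coords]

variable (d) in
/-- The boundary of the simplex has a collar. -/
def boundaryGoodPair : GoodPair (SSet.toTop.map (SSet.boundary.{u} d).ι) where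
  emb := (toTop_map_isClosedEmbedding _).isEmbedding
  m := ⟨fun x => depth (coords d x), continuous_depth.comp (coords d).continuous⟩
  m_nonneg x := depth_nonneg _
  m_eq_zero x := (mem_range_boundary_iff x).symm
  H := ⟨fun p => real (tautSimplex d) (mix p.1 (coords d p.2) (stretch (coords d p.2))),
    (real (tautSimplex d)).continuous.comp (continuous_mix continuous_fst
      ((coords d).continuous.comp continuous_snd)
      (continuous_stretch.comp ((coords d).continuous.comp continuous_snd)))⟩
  H_zero x := by
    show real (tautSimplex d) (mix 0 (coords d x) (stretch (coords d x))) = x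
    rw [mix_zero, real_coords]
  H_apply s a := by
    have h := (mem_range_boundary_iff _).1 ⟨a, rfl⟩
    generalize SSet.toTop.map (SSet.boundary.{u} d).ι a = x at *
    show real (tautSimplex d) (mix s (coords d x) (stretch (coords d x))) = x
    rw [stretch_eq_self h, mix_self, real_coords]
  m_H s x := by
    show depth (coords d (real (tautSimplex d) (mix s (coords d x) (stretch (coords d x))))) ≤
      depth (coords d x)
    rw [coords_taut]
    exact depth_mix_stretch_le s _
  H_one x hx := by
    rw [mem_range_boundary_iff]
    show depth (coords d (real (tautSimplex d) (mix 1 (coords d x) (stretch (coords d x))))) = 0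
    rw [mix_one, coords_taut]
    exact depth_stretch hx

end Simplex

/-! ### The unit `Y → Sing |Y|` for the point and the simplices. -/

section Units

variable {k : Type} [CommRing k]

/-- The point. -/
abbrev pointSSet : SSet.{u} := (SimplicialObject.const (Type u)).obj (⊤_ (Type u))

lemma subsingleton_pointSSet (Δ : SimplexCategoryᵒᵖ) : Subsingleton (pointSSet.{u}.obj Δ) :=
  ⟨fun _ _ => (Types.terminalIso.{u}.toEquiv.injective (Subsingleton.elim _ _) : _)⟩

lemma subsingleton_toTop_pointSSet : Subsingleton (SSet.toTop.obj pointSSet.{u}) := by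
  have key : ∀ n (y : pointSSet.{u} _⦋n⦌) t (y₀ : pointSSet.{u} _⦋0⦌),
      real y t = real y₀ default := by
    intro n y t y₀
    let f : ⦋n⦌ ⟶ ⦋0⦌ := SimplexCategory.isTerminalZero.from _
    have h := subsingleton_pointSSet.{u} (op ⦋n⦌)
    have : y = pointSSet.{u}.map f.op y₀ := Subsingleton.elim _ _
    rw [this, real_map]
    congr 1
    exact Subsingleton.elim (α := stdSimplex ℝ (Fin 1)) _ _
  refine ⟨fun a b => ?_⟩
  obtain ⟨n, y, t, rfl⟩ := exists_real a
  obtain ⟨m, z, s, rfl⟩ := exists_real b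
  let y₀ : pointSSet.{u} _⦋0⦌ := y
  rw [key n y t y₀, key m z s y₀]

lemma qi_unit_pointSSet : QI k (sSetTopAdj.unit.app pointSSet.{u}) := by
  have : IsIso (sSetTopAdj.unit.app pointSSet.{u}) := by
    refine isIso_of_bijective _ fun n => ⟨?_, ?_⟩
    · intro a b _
      have h := subsingleton_pointSSet.{u} (op ⦋n⦌)
      exact h.elim a b
    · intro σ
      have h := subsingleton_toTop_pointSSet.{u}
      let y : pointSSet.{u} _⦋n⦌ := Types.terminalIso.{u}.inv PUnit.unit
      exact ⟨y, asMap.injective (ContinuousMap.ext fun t => Subsingleton.elim _ _)⟩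
  exact QI.of_isIso _

/-- The simplex and its realization both contract to a point, so naturality of the unit reduces the
claim to the point. -/
lemma qi_unit_stdSimplex (d : ℕ) : QI k (sSetTopAdj.unit.app (Δ[d] : SSet.{u})) := by
  let ed := SSet.Augmented.StandardSimplex.extraDegeneracy.{u} ⦋d⦌
  let f : (Δ[d] : SSet.{u}) ⟶ pointSSet.{u} := (SSet.Augmented.stdSimplex.{u}.obj ⦋d⦌).hom
  let g : pointSSet.{u} ⟶ (Δ[d] : SSet.{u}) := ed.section_
  have hgf : g ≫ f = 𝟙 _ := ed.section_comp_hom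
  have H : SimplicialObject.Homotopy (f ≫ g) (𝟙 (Δ[d] : SSet.{u})) := ed.homotopy
  have hg : QI k g := by
    refine QI.of_comp_of_comp (g := f) (by rw [hgf]; exact QI.id _) ?_
    exact (qi_iff_of_homotopy H).2 (QI.id _)
  have hn : g ≫ sSetTopAdj.unit.app (Δ[d] : SSet.{u}) =
      sSetTopAdj.unit.app pointSSet.{u} ≫ TopCat.toSSet.map (SSet.toTop.map g) :=
    sSetTopAdj.unit.naturality g
  refine QI.of_comp_left hg ?_
  rw [hn]
  refine qi_unit_pointSSet.comp (qi_of_homotopyEquiv (g := SSet.toTop.map f) ?_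
    (simplexHomotopy _ _))
  rw [← Functor.map_comp, hgf, CategoryTheory.Functor.map_id]
  exact ContinuousMap.Homotopy.refl _

end Units

end CommClassifying

end

noncomputable section

open Simplicial Opposite AlgebraicTopology

namespace CommClassifying

/-! ### Removing a top-dimensional cell. -/

section Cells

variable {X : SSet.{u}}

/-- A square of simplicial sets is a pushout if it is one in each degree. The simplices of `Δ[d]`
off the boundary are the surjections; they give degeneracies of `z`, which lie outside `A` and are
pairwise distinct by Eilenberg–Zilber. -/
lemma isPushout_cell (A : X.Subcomplex) {d : ℕ} (z : X _⦋d⦌) (hz : z ∈ X.nonDegenerate d)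
    (hzA : z ∉ A.obj (op ⦋d⦌))
    (hb : ∀ (n : ℕ) (f : ⦋n⦌ ⟶ ⦋d⦌), ¬ Function.Surjective f → X.map f.op z ∈ A.obj (op ⦋n⦌))
    (hcov : ∀ (n : ℕ) (x : X _⦋n⦌), x ∈ A.obj (op ⦋n⦌) ∨ ∃ f : ⦋n⦌ ⟶ ⦋d⦌, X.map f.op z = x) :
    ∃ t : (SSet.boundary.{u} d : SSet.{u}) ⟶ (A : SSet.{u}),
      IsPushout t (SSet.boundary.{u} d).ι A.ι (SSet.yonedaEquiv.symm z) := by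
  have hζ : ∀ (n : ℕ) (f : ⦋n⦌ ⟶ ⦋d⦌), (SSet.yonedaEquiv.symm z).app (op ⦋n⦌)
      (SSet.stdSimplex.objEquiv.symm f) = X.map f.op z := fun n f => rfl
  let t : (SSet.boundary.{u} d : SSet.{u}) ⟶ (A : SSet.{u}) :=
    SSet.Subcomplex.lift ((SSet.boundary.{u} d).ι ≫ SSet.yonedaEquiv.symm z) (by
      rintro ⟨Δ⟩ _ ⟨⟨f, hf⟩, rfl⟩
      induction Δ using SimplexCategory.rec with | _ n => ?_
      exact hb n (SSet.stdSimplex.objEquiv f) hf)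
  have w : t ≫ A.ι = (SSet.boundary.{u} d).ι ≫ SSet.yonedaEquiv.symm z := rfl
  refine ⟨t, ⟨⟨w⟩, ⟨evaluationJointlyReflectsColimits _ ?_⟩⟩⟩
  rintro ⟨Δ⟩
  induction Δ using SimplexCategory.rec with | _ n => ?_
  refine (isColimitMapCoconePushoutCoconeEquiv _ _).2 (IsPushout.isColimit ?_)
  have hepi : ∀ (f : ⦋n⦌ ⟶ ⦋d⦌), Function.Surjective f → Epi f := fun f hf =>
    SimplexCategory.epi_iff_surjective.2 hf
  have hmemA : ∀ (f : ⦋n⦌ ⟶ ⦋d⦌), X.map f.op z ∈ A.obj (op ⦋n⦌) → ¬ Function.Surjective f := by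
    intro f hf hs
    have := hepi f hs
    obtain ⟨⟨s⟩⟩ := isSplitEpi_of_epi f
    refine hzA ?_
    have h1 : X.map s.section_.op (X.map f.op z) ∈ A.obj (op ⦋d⦌) := A.map s.section_.op hf
    rw [← map_comp_simplex, s.id] at h1
    simpa using h1
  refine Types.isPushout_of_isPullback_of_mono' ?_ ?_ ?_
  · rw [Types.isPullback_iff]
    refine ⟨NatTrans.congr_app w _, ?_, ?_⟩
    · rintro x₁ x₂ ⟨-, h⟩
      exact Subtype.ext h
    · rintro ⟨x, hx⟩ f h
      have h' : x = X.map (SSet.stdSimplex.objEquiv f).op z := h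
      rw [h'] at hx
      exact ⟨⟨f, hmemA _ hx⟩, Subtype.ext h'.symm, rfl⟩
  · refine Set.eq_univ_of_forall fun x => ?_
    rcases hcov n x with hx | ⟨f, rfl⟩
    · exact Or.inl ⟨⟨x, hx⟩, rfl⟩
    · exact Or.inr ⟨SSet.stdSimplex.objEquiv.symm f, rfl⟩
  · intro f₁ f₂ hf₁ hf₂ h
    have key : ∀ f : (Δ[d] : SSet.{u}) _⦋n⦌, f ∉ Set.range ((SSet.boundary.{u} d).ι.app (op ⦋n⦌)) →
        Epi (SSet.stdSimplex.objEquiv f) := by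
      intro f hf
      refine hepi _ ?_
      by_contra hs
      exact hf ⟨⟨f, hs⟩, rfl⟩
    have e1 := key f₁ hf₁
    have e2 := key f₂ hf₂
    have hmap : X.map (SSet.stdSimplex.objEquiv f₁).op z = X.map (SSet.stdSimplex.objEquiv f₂).op z := h
    exact SSet.stdSimplex.objEquiv.injective
      (X.unique_nonDegenerate_map _ _ ⟨z, hz⟩ rfl _ ⟨z, hz⟩ hmap)

/-- The subcomplex generated by the nondegenerate simplices other than `z`. -/
def removeCell (z : X.N) : X.Subcomplex := ⨆ w : {w : X.N // w ≠ z}, w.1.subcomplex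

lemma map_mem_removeCell {z w : X.N} (h : w ≠ z) {n : ℕ} (f : ⦋n⦌ ⟶ ⦋w.dim⦌) :
    X.map f.op w.simplex ∈ (removeCell z).obj (op ⦋n⦌) :=
  (le_iSup (fun w : {w : X.N // w ≠ z} => w.1.subcomplex) ⟨w, h⟩) _
    ((SSet.Subcomplex.mem_ofSimplex_obj_iff _ _).2 ⟨f, rfl⟩)

lemma notMem_removeCell {z : X.N} (hmax : ∀ w : X.N, w.dim ≤ z.dim) :
    z.simplex ∉ (removeCell z).obj (op ⦋z.dim⦌) := by
  intro h
  obtain ⟨⟨w, hw⟩, h⟩ : ∃ w : {w : X.N // w ≠ z}, z.simplex ∈ w.1.subcomplex.obj (op ⦋z.dim⦌) := by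
    simpa [removeCell] using h
  obtain ⟨f, hf⟩ := (SSet.Subcomplex.mem_ofSimplex_obj_iff _ _).1 h
  obtain ⟨d, z, rfl⟩ := z.mk_surjective
  obtain ⟨d', w, rfl⟩ := w.mk_surjective
  change ⦋d⦌ ⟶ ⦋d'⦌ at f
  replace hf : X.map f.op w.1 = z.1 := hf
  have := X.mono_of_nonDegenerate z f w.1 hf
  have h1 : d ≤ d' := SimplexCategory.len_le_of_mono f
  have h2 : d' ≤ d := hmax (SSet.N.mk w.1 w.2)
  obtain rfl := le_antisymm h1 h2
  obtain rfl := SimplexCategory.eq_id_of_mono f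
  apply hw
  have : w = z := Subtype.ext (by simpa using hf)
  rw [this]

/-- By maximality `z` is not generated by the other nondegenerate simplices, while its proper faces
are degeneracies of simplices of lower dimension and so survive its removal. -/
lemma exists_isPushout_removeCell {z : X.N} (hmax : ∀ w : X.N, w.dim ≤ z.dim) :
    ∃ t : (SSet.boundary.{u} z.dim : SSet.{u}) ⟶ (removeCell z : SSet.{u}),
      IsPushout t (SSet.boundary.{u} z.dim).ι (removeCell z).ι (SSet.yonedaEquiv.symm z.simplex) := by
  refine isPushout_cell (removeCell z) z.simplex z.nonDegenerate (notMem_removeCell hmax) ?_ ?_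
  · intro n f hf
    obtain ⟨r, e, m, he, hm, rfl⟩ : ∃ (r : ℕ) (e : ⦋n⦌ ⟶ ⦋r⦌) (m : ⦋r⦌ ⟶ ⦋z.dim⦌), Epi e ∧ Mono m ∧
        e ≫ m = f := by
      generalize hI : image f = I
      induction I using SimplexCategory.rec with | _ r => ?_
      exact ⟨r, factorThruImage f ≫ eqToHom hI, eqToHom hI.symm ≫ image.ι f, inferInstance,
        inferInstance, by simp⟩
    have hr : r < z.dim := by
      by_contra hr
      have hm' : Function.Injective m := SimplexCategory.mono_iff_injective.1 hm
      have hb : Function.Bijective (m : Fin (r + 1) → Fin (z.dim + 1)) :=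
        Function.Injective.bijective_of_nat_card_le hm' (by simp; omega)
      exact hf (hb.2.comp (SimplexCategory.epi_iff_surjective.1 he))
    obtain ⟨p, g, hg, w, hw⟩ := X.exists_nonDegenerate (X.map m.op z.simplex)
    have hp : p ≤ r := SimplexCategory.len_le_of_epi g
    rw [map_comp_simplex, hw, ← map_comp_simplex]
    refine map_mem_removeCell (w := SSet.N.mk w.1 w.2) ?_ (e ≫ g)
    rintro rfl
    exact absurd hp (not_le.2 hr)
  · intro n x
    obtain ⟨p, g, hg, w, hw⟩ := X.exists_nonDegenerate x
    by_cases h : SSet.N.mk w.1 w.2 = z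
    · subst h
      exact Or.inr ⟨g, hw.symm⟩
    · left
      rw [hw]
      exact map_mem_removeCell (w := SSet.N.mk w.1 w.2) h g

lemma card_removeCell_lt [X.Finite] {z : X.N} (hmax : ∀ w : X.N, w.dim ≤ z.dim) :
    Nat.card (removeCell z : SSet.{u}).N < Nat.card X.N := by
  have hfin : Finite X.N := SSet.Finite.finite
  let F : (removeCell z : SSet.{u}).N → X.N := fun s => SSet.N.mk ((removeCell z).ι.app _ s.simplex)
    ((SSet.nonDegenerate_iff_of_mono _ _).2 s.nonDegenerate)
  have hF : Function.Injective F := by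
    intro s s' h
    obtain ⟨d, s, rfl⟩ := s.mk_surjective
    obtain ⟨d', s', rfl⟩ := s'.mk_surjective
    obtain rfl : d = d' := congrArg (fun x : X.N => x.dim) h
    have h1 : F (SSet.N.mk s.1 s.2) = F (SSet.N.mk s'.1 s'.2) := h
    have : s.1 = s'.1 := by
      apply Subtype.ext
      have h2 : SSet.S.mk s.1.1 = SSet.S.mk s'.1.1 := congrArg SSet.N.toS h1
      injection h2
    obtain rfl : s = s' := Subtype.ext this
    rfl
  have hFin' : Finite (removeCell z : SSet.{u}).N := Finite.of_injective F hF
  have := Fintype.ofFinite X.N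
  have := Fintype.ofFinite (removeCell z : SSet.{u}).N
  rw [Nat.card_eq_fintype_card, Nat.card_eq_fintype_card]
  refine Fintype.card_lt_of_injective_of_notMem F hF (b := z) ?_
  rintro ⟨s, hs⟩
  have key : ∀ w : X.N, w = z → w.simplex ∉ (removeCell z).obj (op ⦋w.dim⦌) := by
    rintro _ rfl
    exact notMem_removeCell hmax
  exact key _ hs s.simplex.2

end Cells

/-! ### Simplicial and singular homology. -/

section Comparison

variable {k : Type} [CommRing k]

/-- The pair `(X, A)` has the relative homology of the simplex modulo its boundary, combinatorially
by the pushout and topologically by the collar. The unit is known on the simplex and its boundary,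
so it is an isomorphism on the relative homology of `(X, A)`; the five lemma concludes. -/
lemma qi_unit_of_isPushout {X : SSet.{u}} (A : X.Subcomplex) {d : ℕ}
    {t : (SSet.boundary.{u} d : SSet.{u}) ⟶ (A : SSet.{u})} {ζ : (Δ[d] : SSet.{u}) ⟶ X}
    (sq : IsPushout t (SSet.boundary.{u} d).ι A.ι ζ)
    (hA : QI k (sSetTopAdj.unit.app (A : SSet.{u})))
    (hb : QI k (sSetTopAdj.unit.app (SSet.boundary.{u} d : SSet.{u}))) :
    QI k (sSetTopAdj.unit.app X) := by
  have hemb := (toTop_map_isClosedEmbedding A.ι).isEmbedding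
  have m1 := (boundaryGoodPair.{u} d).mono
  have m2 : Mono (TopCat.toSSet.map (SSet.toTop.map A.ι)) := by
    have : Mono (SSet.toTop.map A.ι) := (TopCat.mono_iff_injective _).2 hemb.injective
    infer_instance
  have r1 := relQI_of_topPushout (k := k) (boundaryGoodPair.{u} d) (sq.map SSet.toTop) hemb
  have r2 := RelQI.of_isPushout (k := k) sq
  have n1 : ∀ {S T : SSet.{u}} (f : S ⟶ T), f ≫ sSetTopAdj.unit.app T =
      sSetTopAdj.unit.app S ≫ TopCat.toSSet.map (SSet.toTop.map f) :=
    fun f => sSetTopAdj.unit.naturality f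
  have r3 : RelQI k (SSet.boundary.{u} d).ι (TopCat.toSSet.map (SSet.toTop.map
      (SSet.boundary.{u} d).ι)) (sSetTopAdj.unit.app (SSet.boundary.{u} d : SSet.{u}))
      (sSetTopAdj.unit.app (Δ[d] : SSet.{u})) :=
    RelQI.of_qi (n1 _) hb (qi_unit_stdSimplex d)
  have r4 := r3.comp r1
  rw [← n1, ← n1] at r4
  have r5 : RelQI k A.ι (TopCat.toSSet.map (SSet.toTop.map A.ι))
      (sSetTopAdj.unit.app (A : SSet.{u})) (sSetTopAdj.unit.app X) :=
    RelQI.of_comp_left r2 (n1 _) r4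
  exact r5.qi hA

lemma qi_unit_of_isEmpty {X : SSet.{u}} (h : IsEmpty X.N) : QI k (sSetTopAdj.unit.app X) := by
  have : IsIso (sSetTopAdj.unit.app X) := by
    refine isIso_of_bijective _ fun n => ⟨?_, ?_⟩
    · intro x
      obtain ⟨p, g, hg, w, hw⟩ := X.exists_nonDegenerate x
      exact h.elim (SSet.N.mk w.1 w.2)
    · intro σ
      obtain ⟨p, w, s, hw, -⟩ := exists_normalForm (asMap σ stdSimplex.barycenter)
      exact h.elim (SSet.N.mk w hw)
  exact QI.of_isIso _

/-- Double induction: the dimension drops for the boundary of the removed cell, and the number of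
nondegenerate simplices drops for what remains. -/
lemma qi_unit_of_hasDimensionLT (D : ℕ) :
    ∀ (X : SSet.{u}) [X.Finite] [X.HasDimensionLT D], QI k (sSetTopAdj.unit.app X) := by
  induction D with
  | zero =>
    intro X _ _
    refine qi_unit_of_isEmpty ⟨fun z => ?_⟩
    exact absurd (X.dim_lt_of_nonDegenerate ⟨z.simplex, z.nonDegenerate⟩ 0) (Nat.not_lt_zero _)
  | succ D ih =>
    intro X hX hD
    generalize hN : Nat.card X.N = N
    induction N using Nat.strong_induction_on generalizing X with | _ N ihN => ?_
    rcases isEmpty_or_nonempty X.N with h | h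
    · exact qi_unit_of_isEmpty h
    have hfin : Finite X.N := SSet.Finite.finite
    obtain ⟨z, hz⟩ := Finite.exists_max (fun z : X.N => z.dim)
    obtain ⟨t, sq⟩ := exists_isPushout_removeCell hz
    have hd : z.dim ≤ D := X.dim_le_of_nonDegenerate ⟨z.simplex, z.nonDegenerate⟩ D
    have : SSet.HasDimensionLT (SSet.boundary.{u} z.dim : SSet.{u}) D :=
      SSet.hasDimensionLT_of_le _ z.dim D hd
    refine qi_unit_of_isPushout _ sq ?_ (ih _)
    exact ihN _ (hN ▸ card_removeCell_lt hz) (removeCell z) rfl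

lemma qi_unit_of_finite (X : SSet.{u}) [X.Finite] : QI k (sSetTopAdj.unit.app X) := by
  obtain ⟨D, h⟩ := X.hasDimensionLT_of_finite
  exact qi_unit_of_hasDimensionLT D X

/-- Every class in the singular homology of `|Y|` comes from a simplicial class. -/
theorem exists_simplicial_cycle (Y : SSet.{u}) {n : ℕ}
    (x : (TopCat.toSSet.obj (SSet.toTop.obj Y)) _⦋n⦌ →₀ k) (hx : IsCyc k x) :
    ∃ y : Y _⦋n⦌ →₀ k, IsCyc k y ∧ ∃ w,
      x = Finsupp.mapDomain ((sSetTopAdj.unit.app Y).app (op ⦋n⦌)) y + bd k _ n w := by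
  -- A singular chain has compact image, so it lives in the realization of a finite subcomplex.
  -- Closed embeddedness keeps its simplices continuous there.
  let K : Set (SSet.toTop.obj Y) := ⋃ σ ∈ x.support, Set.range (asMap σ)
  have hK : IsCompact K := x.support.isCompact_biUnion fun σ _ => isCompact_range (asMap σ).continuous
  obtain ⟨A, hA, hKA⟩ := exists_finite_subcomplex hK
  have hemb := (toTop_map_isClosedEmbedding A.ι).isEmbedding
  have hinj : ∀ m, Function.Injective ((TopCat.toSSet.map (SSet.toTop.map A.ι)).app (op ⦋m⦌)) := by
    intro m σ τ h
    refine asMap.injective (ContinuousMap.ext fun t => hemb.injective ?_)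
    exact congrArg (fun ρ => asMap ρ t) h
  have hsupp : x ∈ Finsupp.supported k k
      (Set.range ((TopCat.toSSet.map (SSet.toTop.map A.ι)).app (op ⦋n⦌))) := by
    intro σ hσ
    have h1 : ∀ t, ∃ a, SSet.toTop.map A.ι a = asMap σ t := fun t =>
      hKA (Set.mem_biUnion hσ ⟨t, rfl⟩)
    choose s hs using h1
    have hc : Continuous s := by
      rw [hemb.continuous_iff]
      have : (SSet.toTop.map A.ι) ∘ s = asMap σ := funext hs
      rw [this]
      exact (asMap σ).continuous
    exact ⟨asMap.symm ⟨s, hc⟩, asMap.injective (ContinuousMap.ext hs)⟩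
  obtain ⟨x', rfl⟩ := (mapDomain_mem_supported_iff (hinj n) x).1 hsupp
  have hx' : IsCyc k x' := by
    cases n with
    | zero => trivial
    | succ n =>
      refine Finsupp.mapDomain_injective (hinj n) ?_
      refine (bd_naturality _ n x').symm.trans (Eq.trans hx ?_)
      rw [Finsupp.mapDomain_zero]
  obtain ⟨y, hy, w, hw⟩ := ((qi_iff _).1 (qi_unit_of_finite (k := k) (A : SSet.{u})) n).2 x' hx'
  refine ⟨Finsupp.mapDomain (A.ι.app (op ⦋n⦌)) y, hy.map A.ι,
    Finsupp.mapDomain ((TopCat.toSSet.map (SSet.toTop.map A.ι)).app (op ⦋n + 1⦌)) w, ?_⟩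
  have hcomp : ∀ a, (TopCat.toSSet.map (SSet.toTop.map A.ι)).app (op ⦋n⦌)
      ((sSetTopAdj.unit.app (A : SSet.{u})).app (op ⦋n⦌) a) =
      (sSetTopAdj.unit.app Y).app (op ⦋n⦌) (A.ι.app (op ⦋n⦌) a) := fun a =>
    asMap.injective (ContinuousMap.ext fun t => toTop_map_real A.ι a t)
  rw [bd_naturality, hw, Finsupp.mapDomain_add]
  refine congrArg (· + _) ?_
  refine (Finsupp.mapDomain_comp (v := y)).symm.trans (Eq.trans ?_ Finsupp.mapDomain_comp)
  exact congrArg (fun f => Finsupp.mapDomain f y) (funext hcomp)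

end Comparison

end CommClassifying

end

noncomputable section

open Simplicial Opposite

namespace CommClassifying

/-! ### `Hom(ℤ^•, K)` for commutative `K` as the bar construction. -/

section Edges

variable {K : Type u} [CommGroup K]

lemma prod_ite_step {m : ℕ} (v : Fin (m + 1) → K) {s t : Fin (m + 1)} (h : s ≤ t) :
    (∏ j : Fin m, if s ≤ j.castSucc ∧ j.succ ≤ t then (v j.castSucc)⁻¹ * v j.succ else 1) =
      (v s)⁻¹ * v t := by
  induction t using Fin.induction with
  | zero =>
    obtain rfl : s = 0 := Fin.le_zero_iff.1 h
    simp
  | succ j ih =>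
    rcases h.eq_or_lt with rfl | hlt
    · rw [inv_mul_cancel]
      refine Finset.prod_eq_one fun i _ => if_neg fun hi => ?_
      simp only [Fin.le_def, Fin.val_castSucc, Fin.val_succ] at hi
      omega
    · have hs : s ≤ j.castSucc := by
        simp only [Fin.le_def, Fin.lt_def, Fin.val_castSucc, Fin.val_succ] at hlt ⊢
        omega
      have e : ∀ i : Fin m,
          (if s ≤ i.castSucc ∧ i.succ ≤ j.succ then (v i.castSucc)⁻¹ * v i.succ else 1) =
          (if s ≤ i.castSucc ∧ i.succ ≤ j.castSucc then (v i.castSucc)⁻¹ * v i.succ else 1) *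
            (if j = i then (v i.castSucc)⁻¹ * v i.succ else 1) := by
        intro i
        by_cases hij : j = i
        · subst hij
          rw [if_pos ⟨hs, le_rfl⟩, if_pos rfl, if_neg, one_mul]
          simp only [Fin.le_def, Fin.val_castSucc, Fin.val_succ]
          omega
        · rw [if_neg hij, mul_one]
          congr 1
          simp only [Fin.le_def, Fin.val_castSucc, Fin.val_succ, Fin.ext_iff, eq_iff_iff] at hij ⊢
          omega
      rw [Finset.prod_congr rfl fun i _ => e i, Finset.prod_mul_distrib, ih hs,
        Finset.prod_ite_eq Finset.univ j, if_pos (Finset.mem_univ j)]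
      group

variable [TopologicalSpace K]

/-- The homomorphism `ℤⁿ → K` whose values on the basis are the edges of a tuple of points. -/
def edges {n : ℕ} (v : Fin (n + 1) → K) : Multiplicative (Fin n → ℤ) →ₜ* K where
  toFun a := ∏ i, ((v i.castSucc)⁻¹ * v i.succ) ^ a.toAdd i
  map_one' := by simp
  map_mul' a b := by simp [zpow_add, Finset.prod_mul_distrib]
  continuous_toFun := continuous_of_discreteTopology

lemma edges_apply {n : ℕ} (v : Fin (n + 1) → K) (a : Multiplicative (Fin n → ℤ)) :
    edges v a = ∏ i, ((v i.castSucc)⁻¹ * v i.succ) ^ a.toAdd i := rfl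

lemma edges_single {n : ℕ} (v : Fin (n + 1) → K) (i : Fin n) :
    edges v (Multiplicative.ofAdd (Pi.single i 1)) = (v i.castSucc)⁻¹ * v i.succ := by
  rw [edges_apply, Finset.prod_eq_single i]
  · simp
  · intro j _ hj
    simp [Pi.single_eq_of_ne hj]
  · simp

lemma hom_apply_eq_prod {G : Type u} [CommGroup G] {n : ℕ}
    (ρ : Multiplicative (Fin n → ℤ) →* G) (a : Multiplicative (Fin n → ℤ)) :
    ρ a = ∏ i, ρ (Multiplicative.ofAdd (Pi.single i 1)) ^ a.toAdd i := by
  have h : a = ∏ i, (Multiplicative.ofAdd (Pi.single i 1 : Fin n → ℤ)) ^ a.toAdd i := by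
    refine Multiplicative.toAdd.injective (funext fun j => ?_)
    rw [toAdd_prod, Finset.sum_apply, Finset.sum_eq_single j]
    · simp
    · intro i _ hi
      simp [Pi.single_eq_of_ne hi.symm]
    · simp
  conv_lhs => rw [h]
  rw [map_prod]
  exact Finset.prod_congr rfl fun i _ => map_zpow _ _ _

lemma zpow_sum {G ι : Type*} [CommGroup G] (w : G) (s : Finset ι) (a : ι → ℤ) :
    w ^ ∑ i ∈ s, a i = ∏ i ∈ s, w ^ a i := by
  classical
  induction s using Finset.induction_on with
  | empty => simp
  | insert i s hi ih => rw [Finset.sum_insert hi, Finset.prod_insert hi, zpow_add, ih]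

lemma edges_comp {n m : ℕ} (v : Fin (m + 1) → K) (f : Fin (n + 1) →o Fin (m + 1)) :
    (edges v).comp (pushforwardHom ℤ f) = edges (v ∘ f) := by
  refine ContinuousMonoidHom.ext fun a => ?_
  show (∏ j, ((v j.castSucc)⁻¹ * v j.succ) ^ pushforward ℤ f a.toAdd j) = _
  rw [edges_apply]
  have h1 : ∀ j : Fin m, ((v j.castSucc)⁻¹ * v j.succ) ^ pushforward ℤ f a.toAdd j =
      ∏ i : Fin n, (if f i.castSucc ≤ j.castSucc ∧ j.succ ≤ f i.succ then
        (v j.castSucc)⁻¹ * v j.succ else 1) ^ a.toAdd i := by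
    intro j
    rw [pushforward_apply, zpow_sum]
    refine Finset.prod_congr rfl fun i _ => ?_
    split_ifs <;> simp
  rw [Finset.prod_congr rfl fun j _ => h1 j, Finset.prod_comm]
  refine Finset.prod_congr rfl fun i _ => ?_
  rw [Finset.prod_zpow, prod_ite_step v (f.monotone (Fin.castSucc_lt_succ (i := i)).le)]
  rfl

/-- Partial products of the values on the basis serve as vertices. Together with the two lemmas
below, this presents the simplices as orbits of tuples under translation. -/
lemma edges_surjective (n : ℕ) : Function.Surjective (edges (K := K) (n := n)) := by
  intro ρ
  refine ⟨Fin.partialProd fun i => ρ (Multiplicative.ofAdd (Pi.single i 1)),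
    ContinuousMonoidHom.ext fun a => ?_⟩
  rw [edges_apply]
  refine Eq.trans ?_ (hom_apply_eq_prod ρ.toMonoidHom a).symm
  refine Finset.prod_congr rfl fun i _ => ?_
  rw [Fin.partialProd_right_inv]
  rfl

lemma edges_mul_left {n : ℕ} (c : K) (v : Fin (n + 1) → K) :
    edges (fun i => c * v i) = edges v := by
  refine ContinuousMonoidHom.ext fun a => ?_
  simp only [edges_apply]
  refine Finset.prod_congr rfl fun i _ => ?_
  rw [mul_inv_rev, mul_assoc, inv_mul_cancel_left]

lemma exists_of_edges_eq {n : ℕ} {v v' : Fin (n + 1) → K} (h : edges v = edges v') :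
    ∃ c, v' = fun i => c * v i := by
  refine ⟨v' 0 * (v 0)⁻¹, funext fun i => ?_⟩
  induction i using Fin.induction with
  | zero => simp
  | succ i ih =>
    have e : (v i.castSucc)⁻¹ * v i.succ = (v' i.castSucc)⁻¹ * v' i.succ := by
      rw [← edges_single, ← edges_single, h]
    rw [eq_inv_mul_iff_mul_eq] at e
    rw [← e, ih]
    group

end Edges

section Post

variable {A : Type} [AddCommGroup A] [TopologicalSpace A] [IsTopologicalAddGroup A]

/-- Postcomposition with a continuous homomorphism of the targets. -/
def homSSetPost {G G' : Type u} [Group G] [TopologicalSpace G] [Group G'] [TopologicalSpace G']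
    (φ : G →ₜ* G') : homSSet A G ⟶ homSSet A G' where
  app _ := TypeCat.ofHom fun ρ => φ.comp ρ
  naturality _ _ _ := rfl

end Post

/-! ### Averaging prisms over a kernel of invertible order. -/

section Transfer

variable (k : Type) [CommRing k] {K : Type u} [CommGroup K] [TopologicalSpace K]

/-- The simplex with the given vertices, up to translation. -/
def edgesSimplex {n : ℕ} (v : Fin (n + 1) → K) : (homSSet ℤ K) _⦋n⦌ := edges v

/-- The chain map from tuples to simplices. -/
def edgesMap (n : ℕ) : ((Fin (n + 1) → K) →₀ k) →ₗ[k] ((homSSet ℤ K) _⦋n⦌ →₀ k) :=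
  Finsupp.lmapDomain k k edgesSimplex

variable {k}

lemma edgesMap_tup {n : ℕ} (v : Fin (n + 1) → K) :
    edgesMap k n (tup k v) = Finsupp.single (edgesSimplex v) 1 := by
  simp [edgesMap]

lemma bd_edgesMap {n : ℕ} (x : (Fin (n + 2) → K) →₀ k) :
    bd k (homSSet ℤ K) n (edgesMap k (n + 1) x) = edgesMap k n (tbd k K n x) := by
  suffices h : bd k (homSSet ℤ K) n ∘ₗ edgesMap k (n + 1) = edgesMap k n ∘ₗ tbd k K n from
    LinearMap.congr_fun h x
  refine tuple_hom_ext fun v => ?_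
  rw [LinearMap.comp_apply, LinearMap.comp_apply, edgesMap_tup, tbd_tup, map_sum, bd_single]
  refine Finset.sum_congr rfl fun i _ => ?_
  rw [map_smul, edgesMap_tup]
  congr 2
  exact edges_comp v (SimplexCategory.δ i).toOrderHom

/-- A lift of chains to tuples. -/
def liftTuples (k : Type) [CommRing k] (n : ℕ) :
    ((homSSet ℤ K) _⦋n⦌ →₀ k) →ₗ[k] ((Fin (n + 1) → K) →₀ k) :=
  Finsupp.lmapDomain k k (Function.surjInv (f := edgesSimplex) (edges_surjective n))

lemma edgesMap_liftTuples {n : ℕ} (x : (homSSet ℤ K) _⦋n⦌ →₀ k) :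
    edgesMap k n (liftTuples k n x) = x := by
  have h : edgesSimplex ∘ Function.surjInv (f := edgesSimplex (K := K)) (edges_surjective n) = id :=
    funext (Function.surjInv_eq (f := edgesSimplex (K := K)) (edges_surjective n))
  refine (Finsupp.mapDomain_comp (f := Function.surjInv (f := edgesSimplex) (edges_surjective n))
    (g := edgesSimplex)).symm.trans ?_
  rw [h, Finsupp.mapDomain_id]

lemma edgesMap_tmap_mul {n : ℕ} (c : K) (x : (Fin (n + 1) → K) →₀ k) :
    edgesMap k n (tmap k (fun y => c * y) n x) = edgesMap k n x := by
  suffices h : edgesMap k n ∘ₗ tmap k (fun y => c * y) n = edgesMap k n from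
    LinearMap.congr_fun h x
  refine tuple_hom_ext fun v => ?_
  rw [LinearMap.comp_apply, tmap_tup, edgesMap_tup, edgesMap_tup]
  congr 1
  exact edges_mul_left c v

/-- The lift to tuples is an arbitrary choice, but two lifts differ by a translation, which an
invariant map does not see. -/
lemma apply_liftTuples_edgesMap {n : ℕ} {M : Type*} [AddCommGroup M] [Module k M]
    {Φ : ((Fin (n + 1) → K) →₀ k) →ₗ[k] M}
    (hΦ : ∀ (c : K) x, Φ (tmap k (fun y => c * y) n x) = Φ x) (x : (Fin (n + 1) → K) →₀ k) :
    Φ (liftTuples k n (edgesMap k n x)) = Φ x := by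
  suffices h : Φ ∘ₗ liftTuples k n ∘ₗ edgesMap k n = Φ from LinearMap.congr_fun h x
  refine tuple_hom_ext fun v => ?_
  obtain ⟨c, hc⟩ := exists_of_edges_eq
    (Function.surjInv_eq (f := edgesSimplex) (edges_surjective n) (edgesSimplex v)).symm
  rw [LinearMap.comp_apply, LinearMap.comp_apply, edgesMap_tup, ← hΦ c (tup k v), tmap_tup]
  congr 1
  refine (Finsupp.mapDomain_single (f := Function.surjInv (f := edgesSimplex)
    (edges_surjective n))).trans ?_
  exact congrArg (tup k) hc

variable (b : K →* K)

/-- The average over the kernel of an idempotent `b` of the prisms of the maps `x ↦ b x * g`. -/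
def averagePrism (k : Type) [CommRing k] (n : ℕ) :
    ((Fin (n + 1) → K) →₀ k) →ₗ[k] ((homSSet ℤ K) _⦋n + 1⦌ →₀ k) :=
  ∑ᶠ g : b.ker, edgesMap k (n + 1) ∘ₗ prism k (fun x => b x * g) n

lemma averagePrism_apply [Fintype b.ker] {n : ℕ} (x : (Fin (n + 1) → K) →₀ k) :
    averagePrism b k n x = ∑ g : b.ker, edgesMap k (n + 1) (prism k (fun x => b x * g) n x) := by
  rw [averagePrism, finsum_eq_sum_of_fintype, LinearMap.sum_apply]
  rfl

variable {b}

/-- Translation by `c` turns the prism of `x ↦ b x * g` into that of `x ↦ b x * g'` with `g' = c *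
(b c)⁻¹ * g`. By idempotency `c * (b c)⁻¹` lies in the kernel, so the sum is only reindexed. -/
lemma averagePrism_tmap_mul [Finite K] (hb : ∀ x, b (b x) = b x) {n : ℕ} (c : K)
    (x : (Fin (n + 1) → K) →₀ k) :
    averagePrism b k n (tmap k (fun y => c * y) n x) = averagePrism b k n x := by
  have := Fintype.ofFinite b.ker
  rw [averagePrism_apply, averagePrism_apply]
  let c' : b.ker := ⟨c * (b c)⁻¹, by rw [MonoidHom.mem_ker, map_mul, map_inv, hb, mul_inv_cancel]⟩
  refine (Fintype.sum_equiv (Equiv.mulLeft c') _ _ fun g => ?_).symm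
  rw [← tmap_prism (k := k) (fun y => c * y) (r := fun x => b x * g) (fun y => ?_),
    edgesMap_tmap_mul]
  show b (c * y) * (c * (b c)⁻¹ * g) = c * (b y * g)
  rw [map_mul]
  calc b c * b y * (c * (b c)⁻¹ * g) = (b c * (b c)⁻¹) * (c * (b y * g)) := by ac_rfl
    _ = _ := by rw [mul_inv_cancel, one_mul]

lemma edgesMap_tmap (φ : K →ₜ* K) (g : K) {n : ℕ} (x : (Fin (n + 1) → K) →₀ k) :
    edgesMap k n (tmap k (fun y => φ y * g) n x) =
      Finsupp.mapDomain ((homSSetPost (A := ℤ) φ).app (op ⦋n⦌)) (edgesMap k n x) := by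
  suffices h : edgesMap k n ∘ₗ tmap k (fun y => φ y * g) n =
      Finsupp.lmapDomain k k ((homSSetPost (A := ℤ) φ).app (op ⦋n⦌)) ∘ₗ edgesMap k n from
    LinearMap.congr_fun h x
  refine tuple_hom_ext fun v => ?_
  rw [LinearMap.comp_apply, LinearMap.comp_apply, tmap_tup, edgesMap_tup, edgesMap_tup]
  refine Eq.trans ?_ (Finsupp.mapDomain_single).symm
  congr 1
  refine ContinuousMonoidHom.ext fun a => ?_
  show edges (fun i => φ (v i) * g) a = φ (edges v a)
  rw [edges_apply, edges_apply, map_prod]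
  refine Finset.prod_congr rfl fun i _ => ?_
  rw [map_zpow, map_mul, map_inv, mul_inv_rev, mul_comm g⁻¹, mul_assoc, mul_comm g⁻¹,
    mul_inv_cancel_right]

/-- If the order of the kernel of an idempotent endomorphism is invertible, cycles of positive
degree that it kills are boundaries. -/
lemma exists_bd_eq_of_idempotent [Finite K] {φ : K →ₜ* K} (hφ : ∀ x, φ (φ x) = φ x)
    (hk : IsUnit (Nat.card φ.toMonoidHom.ker : k)) {n : ℕ} (u : (homSSet ℤ K) _⦋n + 1⦌ →₀ k)
    (hu : bd k _ n u = 0)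
    (hu' : Finsupp.mapDomain ((homSSetPost (A := ℤ) φ).app (op ⦋n + 1⦌)) u = 0) :
    ∃ w, bd k _ (n + 1) w = u := by
  have := Fintype.ofFinite φ.toMonoidHom.ker
  obtain ⟨d, hd⟩ := hk
  have key : bd k _ (n + 1) (averagePrism φ.toMonoidHom k (n + 1) (liftTuples k (n + 1) u)) =
      -((Nat.card φ.toMonoidHom.ker : k) • u) := by
    -- The lift of a cycle need not be a cycle of tuples, but its boundary maps to zero modulo
    -- translation, and the averaged prism factors through that quotient.
    have h1 : averagePrism φ.toMonoidHom k n (tbd k K n (liftTuples k (n + 1) u)) = 0 := by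
      rw [← apply_liftTuples_edgesMap (averagePrism_tmap_mul (b := φ.toMonoidHom) hφ),
        ← bd_edgesMap, edgesMap_liftTuples, hu, map_zero, map_zero]
    rw [averagePrism_apply] at h1
    have h2 : ∀ g : φ.toMonoidHom.ker, bd k _ (n + 1) (edgesMap k (n + 2)
        (prism k (fun x => φ.toMonoidHom x * g) (n + 1) (liftTuples k (n + 1) u))) =
        -u - edgesMap k (n + 1) (prism k (fun x => φ.toMonoidHom x * g) n
          (tbd k K n (liftTuples k (n + 1) u))) := by
      -- Translation by `g` cancels in the edges, so the far end of each prism is the image of `u`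
      -- under `φ`, which vanishes.
      intro g
      rw [bd_edgesMap, tbd_prism, map_sub, map_sub, edgesMap_liftTuples]
      congr 1
      rw [sub_eq_neg_self]
      refine (edgesMap_tmap φ g _).trans ?_
      rw [edgesMap_liftTuples, hu']
    rw [averagePrism_apply, map_sum, Finset.sum_congr rfl fun g _ => h2 g, Finset.sum_sub_distrib,
      h1, Finset.sum_const, Finset.card_univ, Nat.card_eq_fintype_card, sub_zero, smul_neg,
      Nat.cast_smul_eq_nsmul]
  refine ⟨-((↑d⁻¹ : k) • averagePrism φ.toMonoidHom k (n + 1) (liftTuples k (n + 1) u)), ?_⟩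
  rw [map_neg, map_smul, key, ← hd, smul_neg, neg_neg, smul_smul, Units.inv_mul, one_smul]

end Transfer

end CommClassifying

end

noncomputable section

open Simplicial Opposite

namespace CommClassifying

/-! ### Primary parts of torsion elements. -/

section PrimaryPart

variable (l : ℕ)

/-- An exponent that projects a group of exponent `e` to its `l`-primary part. -/
def primaryExp (e : ℕ) : ℕ :=
  -- The remainder is `1` modulo the `l`-part of `e` and `0` modulo the complementary part. For `l`
  -- prime and `e ≠ 0` the two are coprime and the default is not reached.
  if h : (ordProj[l] e).Coprime (ordCompl[l] e) then Nat.chineseRemainder h 1 0 else 1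

/-- The `l`-primary part of a torsion element. -/
def primaryPart {G : Type*} [Group G] (h : G) : G := h ^ primaryExp l (orderOf h)

lemma primaryPart_map {G G' : Type*} [Group G] [Group G'] (j : G →* G') (hj : Function.Injective j) (h : G) :
    primaryPart l (j h) = j (primaryPart l h) := by
  rw [primaryPart, primaryPart, map_pow, orderOf_injective j hj]

variable {l} [hl : Fact l.Prime]

lemma primaryExp_modEq_one {e : ℕ} (he : e ≠ 0) : primaryExp l e ≡ 1 [MOD ordProj[l] e] := by
  have h : (ordProj[l] e).Coprime (ordCompl[l] e) :=
    Nat.Coprime.pow_left _ (Nat.coprime_ordCompl hl.out he)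
  rw [primaryExp, dif_pos h]
  exact (Nat.chineseRemainder h 1 0).2.1

lemma ordCompl_dvd_primaryExp {e : ℕ} (he : e ≠ 0) : ordCompl[l] e ∣ primaryExp l e := by
  have h : (ordProj[l] e).Coprime (ordCompl[l] e) :=
    Nat.Coprime.pow_left _ (Nat.coprime_ordCompl hl.out he)
  rw [primaryExp, dif_pos h]
  exact Nat.modEq_zero_iff_dvd.1 (Nat.chineseRemainder h 1 0).2.2

lemma primaryExp_modEq {e o : ℕ} (he : e ≠ 0) (ho : o ∣ e) :
    primaryExp l e ≡ primaryExp l o [MOD o] := by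
  have ho' : o ≠ 0 := fun h => he (zero_dvd_iff.1 (h ▸ ho))
  have h : (ordProj[l] o).Coprime (ordCompl[l] o) :=
    Nat.Coprime.pow_left _ (Nat.coprime_ordCompl hl.out ho')
  have key := (Nat.modEq_and_modEq_iff_modEq_mul (a := primaryExp l e) (b := primaryExp l o) h).1
    ⟨((primaryExp_modEq_one he).of_dvd (Nat.ordProj_dvd_ordProj_of_dvd he ho l)).trans
      (primaryExp_modEq_one ho').symm,
    (Nat.modEq_zero_iff_dvd.2 ((Nat.ordCompl_dvd_ordCompl_of_dvd ho l).trans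
      (ordCompl_dvd_primaryExp he))).trans
      (Nat.modEq_zero_iff_dvd.2 (ordCompl_dvd_primaryExp ho')).symm⟩
  rwa [Nat.ordProj_mul_ordCompl_eq_self] at key

variable {G : Type*} [Group G]

/-- Any exponent killing `h` may replace its order. Hence a single power map computes primary parts
on a whole finite group, which makes them multiplicative on commuting elements. -/
lemma pow_primaryExp {h : G} {e : ℕ} (he : e ≠ 0) (hh : h ^ e = 1) :
    h ^ primaryExp l e = primaryPart l h :=
  pow_eq_pow_iff_modEq.2 (primaryExp_modEq he (orderOf_dvd_of_pow_eq_one hh))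

lemma primaryPart_of_pow_eq_one {h : G} {a : ℕ} (hh : h ^ l ^ a = 1) : primaryPart l h = h := by
  have h0 : l ^ a ≠ 0 := pow_ne_zero _ hl.out.ne_zero
  rw [← pow_primaryExp h0 hh]
  conv_rhs => rw [← pow_one h]
  refine pow_eq_pow_iff_modEq.2 (Nat.ModEq.of_dvd (orderOf_dvd_of_pow_eq_one hh) ?_)
  have := primaryExp_modEq_one (l := l) h0
  rwa [hl.out.factorization_pow, Finsupp.single_eq_same] at this

lemma exists_primaryPart_pow_eq_one {h : G} (hh : IsOfFinOrder h) :
    ∃ a, primaryPart l h ^ l ^ a = 1 := by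
  have h0 := hh.orderOf_pos.ne'
  refine ⟨(orderOf h).factorization l, ?_⟩
  rw [primaryPart, ← pow_mul]
  refine orderOf_dvd_iff_pow_eq_one.1 ?_
  conv_lhs => rw [← Nat.ordProj_mul_ordCompl_eq_self (orderOf h) l, mul_comm]
  exact Nat.mul_dvd_mul_right (ordCompl_dvd_primaryExp h0) _

lemma primaryPart_primaryPart {h : G} (hh : IsOfFinOrder h) :
    primaryPart l (primaryPart l h) = primaryPart l h := by
  obtain ⟨a, ha⟩ := exists_primaryPart_pow_eq_one (l := l) hh
  exact primaryPart_of_pow_eq_one ha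

lemma coprime_card_of_primaryPart_eq_one [Finite G] (h : ∀ x : G, primaryPart l x = 1) :
    (Nat.card G).Coprime l := by
  rw [Nat.coprime_comm, hl.out.coprime_iff_not_dvd]
  intro hdvd
  obtain ⟨x, hx⟩ := exists_prime_orderOf_dvd_card' l hdvd
  have h1 : x ^ l ^ 1 = 1 := by rw [pow_one, ← hx, pow_orderOf_eq_one]
  have h2 := (primaryPart_of_pow_eq_one h1).symm.trans (h x)
  rw [h2, orderOf_one] at hx
  exact hl.out.one_lt.ne hx

end PrimaryPart

/-! ### Homomorphisms from lattices to torsion groups. -/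

section Torsion

variable {H : Type u} [Group H]

/-- The forgetful functor preserves filtered colimits, so each element comes from a finite group.
Torsion is all that is needed of local finiteness afterwards. -/
lemma isMulTorsion_of_isLocallyFinite (hH : IsLocallyFinite H) : IsMulTorsion H := by
  obtain ⟨J, _, _, F, ι, hF, ⟨hc⟩⟩ := hH
  intro h
  obtain ⟨j, y, hy⟩ := Types.jointly_surjective_of_isColimit
    (isColimitOfPreserves (forget GrpCat.{u}) hc) h
  have := hF j
  have h1 : IsOfFinOrder (y : F.obj j) := isOfFinOrder_of_finite _
  have h2 := MonoidHom.isOfFinOrder (ι.app j).hom h1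
  exact (show (ι.app j).hom y = h from hy) ▸ h2

/-- The image is a finitely generated commutative torsion group. -/
lemma finite_range_of_isMulTorsion (hT : IsMulTorsion H) {n : ℕ}
    (ρ : Multiplicative (Fin n → ℤ) →* H) : Finite ρ.range := by
  let _ : CommGroup ρ.range := { (inferInstance : Group ρ.range) with
    mul_comm := fun x y => mul_comm' x y }
  exact CommGroup.finite_of_fg_isMulTorsion _ fun x => (Submonoid.isOfFinOrder_coe).1 (hT x)

lemma exists_exponent (hT : IsMulTorsion H) {n : ℕ} (ρ : Multiplicative (Fin n → ℤ) →* H) :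
    ∃ e ≠ 0, ∀ a, ρ a ^ e = 1 := by
  have := finite_range_of_isMulTorsion hT ρ
  refine ⟨Nat.card ρ.range, Nat.card_pos.ne', fun a => ?_⟩
  exact congrArg Subtype.val (pow_card_eq_one' (x := (⟨ρ a, a, rfl⟩ : ρ.range)))

variable [TopologicalSpace H] (l : ℕ) [hl : Fact l.Prime] (hT : IsMulTorsion H)

/-- The `l`-primary part of a homomorphism from a lattice to a torsion group. -/
def primaryHom {n : ℕ} (ρ : Multiplicative (Fin n → ℤ) →ₜ* H) :
    Multiplicative (Fin n → ℤ) →ₜ* H where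
  toFun a := primaryPart l (ρ a)
  map_one' := by rw [map_one, primaryPart, one_pow]
  map_mul' a b := by
    obtain ⟨e, he, h⟩ := exists_exponent hT ρ.toMonoidHom
    have h' : ∀ a, ρ a ^ e = 1 := h
    rw [← pow_primaryExp he (h' _), ← pow_primaryExp he (h' a), ← pow_primaryExp he (h' b), map_mul]
    exact ((Commute.all a b).map ρ.toMonoidHom).mul_pow _
  continuous_toFun := continuous_of_discreteTopology

/-- Taking the `l`-primary part, as a simplicial map. -/
def primaryMap : homSSet ℤ H ⟶ homSSet ℤ H where
  app _ := TypeCat.ofHom fun ρ => primaryHom l hT ρ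
  naturality _ _ _ := rfl

end Torsion

end CommClassifying

end

noncomputable section

open Simplicial Opposite

namespace CommClassifying

/-! ### The homotopy from the identity to the primary part. -/

section Carriers

variable {H : Type u} [Group H] [TopologicalSpace H]

/-- A simplex of `homSSet A H` as a homomorphism. -/
def toHom {A : Type} [AddCommGroup A] [TopologicalSpace A] [IsTopologicalAddGroup A] {n : ℕ}
    (τ : (homSSet A H) _⦋n⦌) : Multiplicative (Fin n → A) →ₜ* H := τ

/-- The simplices with values in a subgroup. -/
def valuedIn (K : Subgroup H) (n : ℕ) : Set ((homSSet ℤ H) _⦋n⦌) :=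
  Set.ofPred fun τ => ∀ a, toHom τ a ∈ K

lemma valuedIn_mono {K K' : Subgroup H} (h : K ≤ K') (n : ℕ) : valuedIn K n ⊆ valuedIn K' n :=
  fun _ hτ a => h (hτ a)

lemma δ_mem_valuedIn {K : Subgroup H} {n : ℕ} {τ : (homSSet ℤ H) _⦋n + 1⦌}
    (h : τ ∈ valuedIn K (n + 1)) (i : Fin (n + 2)) : (homSSet ℤ H).δ i τ ∈ valuedIn K n :=
  fun _ => h _

lemma mem_valuedIn_range {n : ℕ} (τ : (homSSet ℤ H) _⦋n⦌) :
    τ ∈ valuedIn (toHom τ).toMonoidHom.range n := fun a => ⟨a, rfl⟩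

lemma homSSetPost_injective {K : Type u} [Group K] [TopologicalSpace K] {j : K →ₜ* H}
    (hj : Function.Injective j) (n : ℕ) :
    Function.Injective ((homSSetPost (A := ℤ) j).app (op ⦋n⦌)) := fun σ τ h =>
  ContinuousMonoidHom.ext fun a => hj (DFunLike.congr_fun (show j.comp (toHom σ) =
    j.comp (toHom τ) from h) a)

lemma range_homSSetPost {K : Type u} [Group K] [TopologicalSpace K] {j : K →ₜ* H}
    (hj : Function.Injective j) (n : ℕ) :
    Set.range ((homSSetPost (A := ℤ) j).app (op ⦋n⦌)) = valuedIn j.toMonoidHom.range n := by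
  refine Set.Subset.antisymm ?_ fun τ hτ => ?_
  · rintro _ ⟨σ, rfl⟩ a
    exact ⟨toHom σ a, rfl⟩
  · let e := MonoidHom.ofInjective (f := j.toMonoidHom) hj
    let σ : Multiplicative (Fin n → ℤ) →ₜ* K :=
      { toMonoidHom := e.symm.toMonoidHom.comp ((toHom τ).toMonoidHom.codRestrict _ hτ)
        continuous_toFun := continuous_of_discreteTopology }
    refine ⟨σ, ContinuousMonoidHom.ext fun a => ?_⟩
    exact congrArg Subtype.val (e.apply_symm_apply ⟨toHom τ a, hτ a⟩)

variable (k : Type) [CommRing k] (l : ℕ) [Fact l.Prime] (hT : IsMulTorsion H)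

variable {l k}

lemma primaryMap_mem_valuedIn {K : Subgroup H} {n : ℕ} {τ : (homSSet ℤ H) _⦋n⦌}
    (h : τ ∈ valuedIn K n) : (primaryMap l hT).app (op ⦋n⦌) τ ∈ valuedIn K n :=
  fun a => K.pow_mem (h a) _

lemma primaryMap_primaryMap {n : ℕ} (τ : (homSSet ℤ H) _⦋n⦌) :
    (primaryMap l hT).app (op ⦋n⦌) ((primaryMap l hT).app (op ⦋n⦌) τ) =
      (primaryMap l hT).app (op ⦋n⦌) τ :=
  ContinuousMonoidHom.ext fun _ => primaryPart_primaryPart (hT _)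

lemma mapDomain_primaryMap_mem {K : Subgroup H} {n : ℕ} {x : (homSSet ℤ H) _⦋n⦌ →₀ k}
    (h : x ∈ Finsupp.supported k k (valuedIn K n)) :
    Finsupp.mapDomain ((primaryMap l hT).app (op ⦋n⦌)) x ∈
      Finsupp.supported k k (valuedIn K n) := by
  classical
  intro τ hτ
  obtain ⟨σ, hσ, rfl⟩ := Finset.mem_image.1 (Finsupp.mapDomain_support hτ)
  exact primaryMap_mem_valuedIn hT (h hσ)

lemma bd_single_mem_supported {K : Subgroup H} {n : ℕ} {τ : (homSSet ℤ H) _⦋n + 1⦌}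
    (h : τ ∈ valuedIn K (n + 1)) :
    bd k _ n (Finsupp.single τ 1) ∈ Finsupp.supported k k (valuedIn K n) := by
  rw [bd_single]
  exact Submodule.sum_mem _ fun i _ => Submodule.smul_mem _ _
    (Finsupp.single_mem_supported k 1 (δ_mem_valuedIn h i))

lemma mapDomain_mapDomain_primaryMap {n : ℕ} (x : (homSSet ℤ H) _⦋n⦌ →₀ k) :
    Finsupp.mapDomain ((primaryMap l hT).app (op ⦋n⦌))
      (Finsupp.mapDomain ((primaryMap l hT).app (op ⦋n⦌)) x) =
      Finsupp.mapDomain ((primaryMap l hT).app (op ⦋n⦌)) x := by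
  rw [← Finsupp.mapDomain_comp]
  congr 1
  exact funext (primaryMap_primaryMap hT)

/-- Cycles with values in a finite commutative subgroup that are killed by the `l`-primary part
are boundaries of chains with values in that subgroup. -/
lemma exists_bd_eq_of_finite {K : Type u} [CommGroup K] [TopologicalSpace K] [DiscreteTopology K]
    [Finite K] {j : K →ₜ* H} (hj : Function.Injective j) {n : ℕ}
    {u : (homSSet ℤ H) _⦋n + 1⦌ →₀ ZMod l}
    (hs : u ∈ Finsupp.supported _ (ZMod l) (valuedIn j.toMonoidHom.range (n + 1)))
    (hu : bd _ _ n u = 0)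
    (hu' : Finsupp.mapDomain ((primaryMap l hT).app (op ⦋n + 1⦌)) u = 0) :
    ∃ w ∈ Finsupp.supported _ (ZMod l) (valuedIn j.toMonoidHom.range (n + 2)),
      bd _ _ (n + 1) w = u := by
  rw [← range_homSSetPost hj, mapDomain_mem_supported_iff (homSSetPost_injective hj _)] at hs
  obtain ⟨u', rfl⟩ := hs
  -- Raising to this power projects `K` to its `l`-primary part. The kernel has no element of order
  -- `l`, so by Cauchy its order is invertible mod `l`.
  let N := primaryExp l (Nat.card K)
  have hN (x : K) : x ^ N = primaryPart l x := pow_primaryExp Nat.card_pos.ne' pow_card_eq_one'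
  let φ : K →ₜ* K :=
    { toMonoidHom := powMonoidHom N
      continuous_toFun := continuous_of_discreteTopology }
  have hφ (x : K) : φ x = primaryPart l x := hN x
  have hcard : IsUnit (Nat.card φ.toMonoidHom.ker : ZMod l) := by
    rw [ZMod.isUnit_iff_coprime]
    refine coprime_card_of_primaryPart_eq_one fun x => Subtype.ext ?_
    refine (primaryPart_map l φ.toMonoidHom.ker.subtype Subtype.val_injective x).symm.trans ?_
    exact (hφ x).symm.trans x.2
  have hcomm : homSSetPost (A := ℤ) j ≫ primaryMap l hT = homSSetPost φ ≫ homSSetPost j := by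
    ext Δ σ
    refine ContinuousMonoidHom.ext fun a => ?_
    exact (primaryPart_map l j.toMonoidHom hj (toHom σ a)).trans (congrArg j (hφ _).symm)
  have h1 : bd _ _ n u' = 0 := by
    refine Finsupp.mapDomain_injective (homSSetPost_injective hj n) ?_
    rw [← bd_naturality, hu, Finsupp.mapDomain_zero]
  have h2 : Finsupp.mapDomain ((homSSetPost (A := ℤ) φ).app (op ⦋n + 1⦌)) u' = 0 := by
    refine Finsupp.mapDomain_injective (homSSetPost_injective hj (n + 1)) ?_
    rw [Finsupp.mapDomain_zero, ← hu', ← Finsupp.mapDomain_comp, ← Finsupp.mapDomain_comp]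
    congr 1
    exact funext fun σ => (ConcreteCategory.congr_hom (congr_app hcomm (op ⦋n + 1⦌)) σ).symm
  obtain ⟨w', hw'⟩ := exists_bd_eq_of_idempotent (φ := φ) (k := ZMod l)
    (fun x => by rw [hφ, hφ, primaryPart_primaryPart (isOfFinOrder_of_finite x)]) hcard u' h1 h2
  refine ⟨Finsupp.mapDomain ((homSSetPost (A := ℤ) j).app (op ⦋n + 2⦌)) w', ?_, ?_⟩
  · rw [← range_homSSetPost hj]
    exact (mapDomain_mem_supported_iff (homSSetPost_injective hj _) _).2 ⟨w', rfl⟩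
  · rw [bd_naturality, hw']

lemma exists_bd_eq_of_range [DiscreteTopology H] {m : ℕ} (ρ : Multiplicative (Fin m → ℤ) →* H)
    {n : ℕ} {u : (homSSet ℤ H) _⦋n + 1⦌ →₀ ZMod l}
    (hs : u ∈ Finsupp.supported _ (ZMod l) (valuedIn ρ.range (n + 1)))
    (hu : bd _ _ n u = 0)
    (hker : Finsupp.mapDomain ((primaryMap l hT).app (op ⦋n + 1⦌)) u = 0) :
    ∃ w ∈ Finsupp.supported _ (ZMod l) (valuedIn ρ.range (n + 2)), bd _ _ (n + 1) w = u := by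
  let _ : CommGroup ρ.range := { (inferInstance : Group ρ.range) with
    mul_comm := fun x y => mul_comm' x y }
  have := finite_range_of_isMulTorsion hT ρ
  let j : ρ.range →ₜ* H :=
    { toMonoidHom := ρ.range.subtype
      continuous_toFun := continuous_of_discreteTopology }
  have hj : j.toMonoidHom.range = ρ.range := ρ.range.range_subtype
  have := exists_bd_eq_of_finite hT (j := j) Subtype.val_injective (n := n) (u := u)
  rw [hj] at this
  exact this hs hu hker

/-- The homotopy from the identity to the `l`-primary part, built on acyclic carriers. -/
lemma exists_carried_homotopy [DiscreteTopology H] (n : ℕ) :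
    ∃ h : ((homSSet ℤ H) _⦋n⦌ →₀ ZMod l) →ₗ[ZMod l] ((homSSet ℤ H) _⦋n + 1⦌ →₀ ZMod l),
      (∀ (K : Subgroup H) x, x ∈ Finsupp.supported _ (ZMod l) (valuedIn K n) →
        h x ∈ Finsupp.supported _ (ZMod l) (valuedIn K (n + 1))) ∧
      (∀ x, Finsupp.mapDomain ((primaryMap l hT).app (op ⦋n + 1⦌)) (h x) = 0) ∧
      ∀ z, IsCyc (ZMod l) z →
        bd _ _ n (h z) = z - Finsupp.mapDomain ((primaryMap l hT).app (op ⦋n⦌)) z := by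
  induction n with
  | zero =>
    refine ⟨0, fun K x _ => Submodule.zero_mem _, fun x => Finsupp.mapDomain_zero, fun z _ => ?_⟩
    -- There is only one homomorphism from the trivial group `ℤ⁰`, so the zero homotopy works in
    -- degree zero.
    have h : ⇑((primaryMap l hT).app (op ⦋0⦌)) = id := funext fun τ =>
      ContinuousMonoidHom.ext fun a => by
        have ha : a = 1 := Multiplicative.toAdd.injective (funext fun i => i.elim0)
        rw [ha]
        exact (map_one (toHom ((primaryMap l hT).app (op ⦋0⦌) τ))).trans (map_one (toHom τ)).symm
    rw [h, Finsupp.mapDomain_id, sub_self]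
    exact map_zero _
  | succ n ih =>
    obtain ⟨h, hs, hp, hc⟩ := ih
    let P (m : ℕ) := Finsupp.lmapDomain (ZMod l) (ZMod l) ((primaryMap l hT).app (op ⦋m⦌))
    -- The defect of the homotopy at `ρ` is a cycle of positive degree, is killed by the primary
    -- part, and takes values in the finite commutative image of `ρ`; so it bounds there.
    have step (ρ : (homSSet ℤ H) _⦋n + 1⦌) :
        ∃ w ∈ Finsupp.supported _ (ZMod l) (valuedIn (toHom ρ).toMonoidHom.range (n + 2)),
          bd _ _ (n + 1) w = Finsupp.single ρ 1 - P (n + 1) (Finsupp.single ρ 1) -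
            h (bd _ _ n (Finsupp.single ρ 1)) := by
      have hρ := Finsupp.single_mem_supported (ZMod l) (1 : ZMod l) (mem_valuedIn_range ρ)
      refine exists_bd_eq_of_range hT _ ?_ ?_ ?_
      · exact Submodule.sub_mem _ (Submodule.sub_mem _ hρ (mapDomain_primaryMap_mem hT hρ))
          (hs _ _ (bd_single_mem_supported (mem_valuedIn_range ρ)))
      · rw [map_sub, map_sub, hc _ (isCyc_bd _)]
        refine sub_eq_zero.2 (congrArg _ ?_)
        exact bd_naturality _ _ _
      · show P (n + 1) _ = 0
        rw [map_sub, map_sub]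
        refine (congrArg₂ _ (sub_eq_zero.2 ?_) (hp _)).trans (sub_zero _)
        exact (mapDomain_mapDomain_primaryMap hT _).symm
    choose w hw hw' using step
    let h' : ((homSSet ℤ H) _⦋n + 1⦌ →₀ ZMod l) →ₗ[ZMod l] ((homSSet ℤ H) _⦋n + 2⦌ →₀ ZMod l) :=
      -- Subtracting the primary part of `w ρ` makes `P` kill the homotopy. It does not change the
      -- boundary, since `P` kills the defect.
      Finsupp.linearCombination (ZMod l) fun ρ => w ρ - P (n + 2) (w ρ)
    have hP (m : ℕ) (x) : P m (P m x) = P m x := mapDomain_mapDomain_primaryMap hT x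
    have e1 : P (n + 2) ∘ₗ h' = 0 := Finsupp.lhom_ext' fun ρ => LinearMap.ext_ring <| by
      simp only [LinearMap.comp_apply, Finsupp.lsingle_apply, h', Finsupp.linearCombination_single,
        one_smul, map_sub, hP, sub_self, LinearMap.zero_apply]
    have e2 : bd _ _ (n + 1) ∘ₗ h' = LinearMap.id - P (n + 1) - h ∘ₗ bd _ _ n :=
      Finsupp.lhom_ext' fun ρ => LinearMap.ext_ring <| by
        simp only [LinearMap.comp_apply, Finsupp.lsingle_apply, h',
          Finsupp.linearCombination_single, one_smul, LinearMap.sub_apply, LinearMap.id_apply]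
        rw [map_sub, show bd _ _ (n + 1) (P (n + 2) (w ρ)) = P (n + 1) (bd _ _ (n + 1) (w ρ)) from
          bd_naturality _ _ _, hw', map_sub, map_sub, hP, sub_self, zero_sub,
          show P (n + 1) (h _) = 0 from hp _, neg_zero, sub_zero]
    refine ⟨h', fun K x hx => ?_, fun x => LinearMap.congr_fun e1 x, fun z hz => ?_⟩
    · refine Submodule.sum_mem _ fun ρ hρ => Submodule.smul_mem _ _ ?_
      have hρK : (toHom ρ).toMonoidHom.range ≤ K := by
        rintro _ ⟨a, rfl⟩
        exact hx hρ a
      have hwK := Finsupp.supported_mono (valuedIn_mono hρK (n + 2)) (hw ρ)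
      exact Submodule.sub_mem _ hwK (mapDomain_primaryMap_mem hT hwK)
    · refine (LinearMap.congr_fun e2 z).trans ?_
      simp only [LinearMap.comp_apply, LinearMap.sub_apply, LinearMap.id_apply]
      rw [show bd _ _ n z = 0 from hz, map_zero, sub_zero]
      rfl

end Carriers

end CommClassifying

end

noncomputable section

open Simplicial Opposite Filter Topology

namespace CommClassifying

/-! ### Homomorphisms from `ℤ_ℓⁿ` and the retraction. -/

section Completion

variable {H : Type u} [Group H] [TopologicalSpace H]

lemma eq_of_intCast_eq {n q : ℕ} {τ : Multiplicative (Fin n → ℤ) →ₜ* H}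
    (hτ : ∀ a, τ a ^ q = 1) {a b : Fin n → ℤ}
    (h : ∀ i, (a i : ZMod (q)) = b i) :
    τ (Multiplicative.ofAdd a) = τ (Multiplicative.ofAdd b) := by
  have h' (i) : ∃ c : ℤ, a i = b i + (q : ℕ) * c := by
    obtain ⟨c, hc⟩ := (ZMod.intCast_eq_intCast_iff_dvd_sub _ _ _).1 (h i).symm
    exact ⟨c, by rw [← hc]; ring⟩
  choose c hc using h'
  have e : Multiplicative.ofAdd a = Multiplicative.ofAdd b * Multiplicative.ofAdd c ^ (q) := by
    refine Multiplicative.toAdd.injective (funext fun i => ?_)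
    simpa using hc i
  rw [e, map_mul, map_pow, hτ, mul_one]

variable {l : ℕ} [hl : Fact l.Prime]

lemma continuous_toZModPow (N : ℕ) :
    @Continuous ℤ_[l] (ZMod (l ^ N)) _ ⊥ (PadicInt.toZModPow N) := by
  let _ : TopologicalSpace (ZMod (l ^ N)) := ⊥
  have _ : DiscreteTopology (ZMod (l ^ N)) := ⟨rfl⟩
  refine continuous_iff_continuousAt.2 fun x => ?_
  rw [ContinuousAt, nhds_discrete (ZMod (l ^ N)), tendsto_pure]
  have h0 : (0 : ℝ) < (l : ℝ) ^ (-N : ℤ) := zpow_pos (Nat.cast_pos.2 hl.out.pos) _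
  filter_upwards [Metric.closedBall_mem_nhds x h0] with y hy
  rw [Metric.mem_closedBall, dist_eq_norm, PadicInt.norm_le_pow_iff_mem_span_pow,
    ← PadicInt.ker_toZModPow, RingHom.mem_ker, map_sub, sub_eq_zero] at hy
  exact hy

/-- Such a homomorphism factors through `(ℤ/l^N)ⁿ`, so it extends along the reduction of `ℤ_l`,
which is continuous to the discrete group `ℤ/l^N`. -/
lemma mem_range_homSSetMap {n N : ℕ} (τ : (homSSet ℤ H) _⦋n⦌) (hτ : ∀ a, toHom τ a ^ l ^ N = 1) :
    τ ∈ Set.range ((homSSetMap (completionMap l) H).app (op ⦋n⦌)) := by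
  let _ : TopologicalSpace (ZMod (l ^ N)) := ⊥
  have _ : DiscreteTopology (ZMod (l ^ N)) := ⟨rfl⟩
  have _ : NeZero (l ^ N) := ⟨pow_ne_zero _ hl.out.ne_zero⟩
  let q (x : Fin n → ℤ_[l]) (i : Fin n) : ℤ := (PadicInt.toZModPow N (x i)).val
  have hq (x i) : (q x i : ZMod (l ^ N)) = PadicInt.toZModPow N (x i) := by simp [q]
  let σ : Multiplicative (Fin n → ℤ_[l]) →ₜ* H :=
    { toFun := fun x => toHom τ (Multiplicative.ofAdd (q x.toAdd))
      map_one' := by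
        refine (eq_of_intCast_eq hτ (b := 0) fun i => ?_).trans (map_one (toHom τ))
        rw [hq]
        simp
      map_mul' := fun x y => by
        rw [← map_mul]
        refine eq_of_intCast_eq hτ (b := q x.toAdd + q y.toAdd) fun i => ?_
        rw [hq, Pi.add_apply, Int.cast_add, hq, hq]
        exact map_add _ _ _
      continuous_toFun := by
        have h1 : Continuous fun (x : Fin n → ℤ_[l]) (i : Fin n) => PadicInt.toZModPow N (x i) :=
          continuous_pi fun i => (continuous_toZModPow N).comp (continuous_apply i)
        exact (continuous_of_discreteTopology (f := fun y : Fin n → ZMod (l ^ N) =>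
          toHom τ (Multiplicative.ofAdd fun i => ((y i).val : ℤ)))).comp h1 }
  refine ⟨σ, ContinuousMonoidHom.ext fun a => ?_⟩
  refine eq_of_intCast_eq hτ (b := a.toAdd) fun i => (hq _ i).trans ?_
  exact map_intCast (PadicInt.toZModPow (p := l) N) _

lemma primaryMap_mem_range (hT : IsMulTorsion H) {n : ℕ} (τ : (homSSet ℤ H) _⦋n⦌) :
    (primaryMap l hT).app (op ⦋n⦌) τ ∈
      Set.range ((homSSetMap (completionMap l) H).app (op ⦋n⦌)) := by
  obtain ⟨e, he, h⟩ := exists_exponent hT (toHom τ).toMonoidHom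
  have h' : ∀ a, toHom τ a ^ e = 1 := h
  refine mem_range_homSSetMap (N := e.factorization l) _ fun a => ?_
  show primaryPart l (toHom τ a) ^ _ = 1
  rw [← pow_primaryExp he (h' a), ← pow_mul]
  obtain ⟨c, hc⟩ := ordCompl_dvd_primaryExp (l := l) he
  rw [hc, mul_comm, ← mul_assoc, Nat.ordProj_mul_ordCompl_eq_self, pow_mul, h', one_pow]

variable [DiscreteTopology H]

lemma homSSetMap_completionMap_injective (n : ℕ) :
    Function.Injective ((homSSetMap (completionMap l) H).app (op ⦋n⦌)) := by
  intro σ τ h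
  have hd : DenseRange (coordHom (completionMap l) n) :=
    DenseRange.piMap (fun _ => PadicInt.denseRange_intCast)
  have h' : toHom σ ∘ coordHom (completionMap l) n = toHom τ ∘ coordHom (completionMap l) n :=
    congrArg (fun ρ => ⇑(toHom ρ)) h
  exact ContinuousMonoidHom.ext (congrFun (hd.equalizer (map_continuous (toHom σ))
    (map_continuous (toHom τ)) h'))

/-- As `l^N • x` tends to zero and the target is discrete, its image is eventually trivial. -/
lemma exists_pow_eq_one {n : ℕ} (σ : Multiplicative (Fin n → ℤ_[l]) →ₜ* H)
    (x : Multiplicative (Fin n → ℤ_[l])) : ∃ N, σ x ^ l ^ N = 1 := by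
  have h1 : Tendsto (fun N => Multiplicative.ofAdd ((l : ℤ_[l]) ^ N • x.toAdd)) atTop (𝓝 1) := by
    have hlt : ‖(l : ℤ_[l])‖ < 1 := by
      rw [PadicInt.norm_p]
      exact inv_lt_one_of_one_lt₀ (Nat.one_lt_cast.2 hl.out.one_lt)
    have h := (tendsto_pow_atTop_nhds_zero_of_norm_lt_one hlt).smul_const x.toAdd
    rw [zero_smul] at h
    exact h
  have h2 := ((map_continuous σ).tendsto 1).comp h1
  rw [map_one, nhds_discrete, tendsto_pure] at h2
  obtain ⟨N, hN⟩ := h2.exists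
  refine ⟨N, Eq.trans ?_ hN⟩
  rw [← map_pow]
  refine congrArg σ (Multiplicative.toAdd.injective (funext fun i => ?_))
  simp

/-- The retraction of `Hom(ℤ^•, H)` to `Hom(ℤ_l^•, H)` given by `l`-primary parts. -/
lemma exists_retraction (l : ℕ) [Fact l.Prime] (hT : IsMulTorsion H) :
    ∃ r : homSSet ℤ H ⟶ homSSet ℤ_[l] H,
    homSSetMap (completionMap l) H ≫ r = 𝟙 _ ∧
      r ≫ homSSetMap (completionMap l) H = primaryMap l hT := by
  have h (Δ : SimplexCategoryᵒᵖ) (τ : (homSSet ℤ H).obj Δ) : ∃ σ : (homSSet ℤ_[l] H).obj Δ,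
      (homSSetMap (completionMap l) H).app Δ σ = (primaryMap l hT).app Δ τ :=
    primaryMap_mem_range hT (n := Δ.unop.len) τ
  have hinj (Δ : SimplexCategoryᵒᵖ) :
      Function.Injective ((homSSetMap (completionMap l) H).app Δ) :=
    homSSetMap_completionMap_injective Δ.unop.len
  choose r hr using h
  let R : homSSet ℤ H ⟶ homSSet ℤ_[l] H :=
    { app := fun Δ => TypeCat.ofHom (r Δ)
      naturality := fun Δ Δ' f => by
        ext τ
        refine hinj _ ((hr _ _).trans ?_)
        have h1 := ConcreteCategory.congr_hom ((primaryMap l hT).naturality f) τ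
        have h2 := ConcreteCategory.congr_hom
          ((homSSetMap (completionMap l) H).naturality f) (r Δ τ)
        refine h1.trans (Eq.trans ?_ h2.symm)
        exact congrArg ((homSSet ℤ H).map f) (hr Δ τ).symm }
  refine ⟨R, ?_, ?_⟩
  · ext Δ σ
    refine hinj _ ((hr _ _).trans ?_)
    -- Values of a continuous homomorphism on `ℤ_lⁿ` have `l`-power order, so they equal their own
    -- primary parts.
    refine ContinuousMonoidHom.ext fun a => ?_
    obtain ⟨N, hN⟩ := exists_pow_eq_one (n := Δ.unop.len) σ (coordHom (completionMap l) _ a)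
    exact primaryPart_of_pow_eq_one hN
  · ext Δ τ
    exact hr Δ τ

end Completion

end CommClassifying

end

/-! ### From simplicial cycles to singular homology, and the conclusion. -/

noncomputable section

open Simplicial Opposite AlgebraicTopology

namespace CommClassifying

/-- A map of simplicial sets with a retraction that is, on simplicial cycles, homologous to the
identity induces isomorphisms on the singular homology of the realizations. -/
theorem qi_toTop_of_retraction {k : Type} [CommRing k] {X Y : SSet.{u}} (i : X ⟶ Y) (r : Y ⟶ X)
    (hr : i ≫ r = 𝟙 X)
    (h : ∀ (n : ℕ) (y : Y _⦋n⦌ →₀ k), IsCyc k y →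
      ∃ w, bd k Y n w = y - Finsupp.mapDomain ((r ≫ i).app (op ⦋n⦌)) y) :
    QI k (TopCat.toSSet.map (SSet.toTop.map i)) := by
  let I := TopCat.toSSet.map (SSet.toTop.map i)
  let R := TopCat.toSSet.map (SSet.toTop.map r)
  have hR : I ≫ R = 𝟙 _ := by
    rw [← CategoryTheory.Functor.map_comp, ← CategoryTheory.Functor.map_comp, hr,
      CategoryTheory.Functor.map_id, CategoryTheory.Functor.map_id]
  refine (qi_iff _).2 fun n => ⟨fun x _ y hxy => ?_, fun x hx => ?_⟩
  -- Injectivity: the retraction carries a bounding chain back.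
  · refine ⟨Finsupp.mapDomain (R.app (op ⦋n + 1⦌)) y, ?_⟩
    rw [bd_naturality, ← hxy, ← Finsupp.mapDomain_comp]
    have e : ⇑(R.app (op ⦋n⦌)) ∘ ⇑(I.app (op ⦋n⦌)) = id :=
      funext fun σ => ConcreteCategory.congr_hom (congr_app hR (op ⦋n⦌)) σ
    exact (congrArg (fun g => Finsupp.mapDomain g x) e).trans Finsupp.mapDomain_id
  -- Surjectivity: a singular cycle is replaced by a simplicial one, which the hypothesis pushes
  -- into the image of `i`.
  · obtain ⟨y, hy, w, rfl⟩ := exists_simplicial_cycle Y x hx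
    obtain ⟨w', hw'⟩ := h n y hy
    let U := sSetTopAdj.unit.app Y
    let z := Finsupp.mapDomain (r.app (op ⦋n⦌)) y
    refine ⟨Finsupp.mapDomain ((sSetTopAdj.unit.app X).app (op ⦋n⦌)) z, (hy.map r).map _,
      w + Finsupp.mapDomain (U.app (op ⦋n + 1⦌)) w', ?_⟩
    have e1 : y = Finsupp.mapDomain (i.app (op ⦋n⦌)) z + bd k Y n w' := by
      rw [hw', ← Finsupp.mapDomain_comp]
      exact (add_sub_cancel _ _).symm
    have e2 (z : X _⦋n⦌ →₀ k) : Finsupp.mapDomain (U.app (op ⦋n⦌)) (Finsupp.mapDomain (i.app (op ⦋n⦌)) z) =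
        Finsupp.mapDomain (I.app (op ⦋n⦌))
          (Finsupp.mapDomain ((sSetTopAdj.unit.app X).app (op ⦋n⦌)) z) := by
      rw [← Finsupp.mapDomain_comp, ← Finsupp.mapDomain_comp]
      have e (σ : X _⦋n⦌) : I.app (op ⦋n⦌) ((sSetTopAdj.unit.app X).app (op ⦋n⦌) σ) =
          U.app (op ⦋n⦌) (i.app (op ⦋n⦌) σ) :=
        asMap.injective (ContinuousMap.ext fun t => toTop_map_real i σ t)
      exact congrArg (fun g => Finsupp.mapDomain g z) (funext fun σ => (e σ).symm)
    rw [map_add, bd_naturality]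
    have e3 := congrArg (Finsupp.mapDomain (U.app (op ⦋n⦌))) e1
    rw [Finsupp.mapDomain_add, e2] at e3
    refine (congrArg (· + _) e3).trans ?_
    rw [add_assoc]
    exact congrArg _ (add_comm _ _)

end CommClassifying

end

theorem proposition4p3 (l : ℕ) [Fact l.Prime] (H : Type u) [Group H] [TopologicalSpace H]
    [DiscreteTopology H] (hH : CommClassifying.IsLocallyFinite H) :
    CommClassifying.IsModEquivalence l
      (CommClassifying.BMap (CommClassifying.completionMap l) H) := by
  have hT := CommClassifying.isMulTorsion_of_isLocallyFinite hH
  obtain ⟨r, hr, hr'⟩ := CommClassifying.exists_retraction l hT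
  have h := CommClassifying.qi_toTop_of_retraction (k := ZMod l)
    (CommClassifying.homSSetMap (CommClassifying.completionMap l) H) r hr fun n y hy => by
      obtain ⟨h, -, -, hc⟩ := CommClassifying.exists_carried_homotopy (l := l) hT n
      rw [hr']
      exact ⟨h y, hc y hy⟩
  exact (CommClassifying.qi_iff_isIso _).1 h
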